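/- Let $\mathbb P(1,1,2,4,7)$ be the complex weighted projective space with homogeneous coordinates $y_0,\dots,y_4$ of weights $1,1,2,4,7$. The *type* of a point of a complex space is the analytic equivalence class of the germ of the space at this point (equivalently, the isomorphism class of its analytic local ring as a $\mathbb C$-algebra). We say that a hypersurface $X\subset\mathbb P(1,1,2,4,7)$ *has the singularities of* $\mathbb P(1,2,4,7)$ if the set of types of the singular points of $X$ equals the set of types of the singular points of $\mathbb P(1,2,4,7)$. A *coordinate change* is an automorphism of the graded $\mathbb C$-algebra $\mathbb C[y_0,\dots,y_4]$. For $\nu\in\{1,2,3,4,5,\infty\}$ consider the following normal forms of weighted degree $8$, with arbitrary $a_i\in\mathbb C$: $$\begin{array}{ll} \nu=\infty: & y_0y_4-y_3^2,\\ \nu=5: & y_0y_4-y_3^2+y_1^8,\\ \nu=4: & y_0y_4-y_3^2+y_2y_1^6,\\ \nu=3: & y_0y_4-y_3^2+(y_2^2+a_5y_1^4)y_1^4,\\ \nu=2: & y_0y_4-y_3^2+(y_2^3+a_4y_2y_1^4+a_5y_1^6)y_1^2,\\ \nu=1: & y_0y_4-y_3^2+y_2^4+(a_3y_2^2+a_4y_2y_1^2+a_5y_1^4)y_1^4.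 \end{array}$$ 1. Let $F_8\neq 0$ be weighted homogeneous of degree $8$ and suppose that the hypersurface $\{F_8=0\}\subset\mathbb P(1,1,2,4,7)$ has the singularities of $\mathbb P(1,2,4,7)$. Then some coordinate change carries $F_8$ to one of the normal forms above. 2. If $F_8$ is one of the normal forms with $\nu\neq\infty$, then the hypersurface $\{F_8=0\}\subset\mathbb P(1,1,2,4,7)$ has a singular point whose type is different from the types of all singular points of $\mathbb P(1,2,4,7)$. -/

import Mathlib

noncomputable section

namespace WeightedOctic

/-- The formal power series `f` converges absolutely on some polydisc of positive radius around the
origin. -/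
def Converges {σ : Type*} (f : MvPowerSeries σ ℂ) : Prop :=
  ∃ r : ℝ, 0 < r ∧ Summable fun m : σ →₀ ℕ => ‖MvPowerSeries.coeff m f‖ * r ^ m.degree

theorem summable_of_le {σ : Type*} {f : MvPowerSeries σ ℂ} {r s : ℝ} (hs : 0 < s) (hsr : s ≤ r)
    (h : Summable fun m : σ →₀ ℕ => ‖MvPowerSeries.coeff m f‖ * r ^ m.degree) :
    Summable fun m : σ →₀ ℕ => ‖MvPowerSeries.coeff m f‖ * s ^ m.degree :=
  h.of_nonneg_of_le (fun m => by positivity) (fun m => by gcongr)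

theorem Converges.add {σ : Type*} {f g : MvPowerSeries σ ℂ} (hf : Converges f)
    (hg : Converges g) : Converges (f + g) := by
  obtain ⟨r, hr, hf⟩ := hf
  obtain ⟨s, hs, hg⟩ := hg
  have h0 : (0 : ℝ) < min r s := lt_min hr hs
  have hf' := summable_of_le h0 (min_le_left r s) hf
  have hg' := summable_of_le h0 (min_le_right r s) hg
  refine ⟨min r s, h0, (hf'.add hg').of_nonneg_of_le (fun m => by positivity) (fun m => ?_)⟩
  rw [map_add, ← add_mul]
  gcongr
  exact norm_add_le _ _

theorem Converges.mul {σ : Type*} {f g : MvPowerSeries σ ℂ} (hf : Converges f)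
    (hg : Converges g) : Converges (f * g) := by
  classical
  obtain ⟨r, hr, hf⟩ := hf
  obtain ⟨s, hs, hg⟩ := hg
  have h0 : (0 : ℝ) < min r s := lt_min hr hs
  have hf' := summable_of_le h0 (min_le_left r s) hf
  have hg' := summable_of_le h0 (min_le_right r s) hg
  refine ⟨min r s, h0, ?_⟩
  have key := summable_sum_mul_antidiagonal_of_summable_mul
    (Summable.mul_of_nonneg hf' hg' (fun m => by positivity) (fun m => by positivity))
  refine key.of_nonneg_of_le (fun m => by positivity) (fun m => ?_)
  rw [MvPowerSeries.coeff_mul]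
  refine (mul_le_mul_of_nonneg_right (norm_sum_le _ _) (by positivity)).trans (le_of_eq ?_)
  rw [Finset.sum_mul]
  refine Finset.sum_congr rfl (fun p hp => ?_)
  rw [← Finset.HasAntidiagonal.mem_antidiagonal.1 hp, map_add, pow_add, norm_mul]
  ring

theorem converges_coe {σ : Type*} (f : MvPolynomial σ ℂ) :
    Converges (f : MvPowerSeries σ ℂ) := by
  refine ⟨1, one_pos, summable_of_ne_finset_zero (s := f.support) (fun m hm => ?_)⟩
  rw [MvPolynomial.coeff_coe, MvPolynomial.notMem_support_iff.1 hm]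
  simp

/-- The algebra `ℂ{z_j : j ∈ σ}` of convergent power series, for finite `σ`. It is the local ring of
germs of holomorphic functions at a point of `ℂ^σ`. -/
def convergentSeries (σ : Type*) [Finite σ] : Subalgebra ℂ (MvPowerSeries σ ℂ) where
  carrier := {f | Converges f}
  mul_mem' := Converges.mul
  add_mem' := Converges.add
  algebraMap_mem' c := by
    have h := converges_coe (σ := σ) (MvPolynomial.C c)
    rwa [MvPolynomial.coe_C] at h

/-- A point of a weighted projective space with `n` homogeneous coordinates, given by an affine
chart `{y_i ≠ 0}` containing it and by homogeneous coordinates normalized so that `y_i = 1`.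
Every point has such coordinates in every chart that contains it. They are unique up to the
action of the roots of unity of order the weight of `y_i`; this ambiguity, and the choice of the
chart, change the local ring below only by an isomorphism. -/
structure Point (n : ℕ) where
  chart : Fin n
  coord : Fin n → ℂ
  coord_chart : coord chart = 1

variable {n : ℕ}

/-- The local coordinates `z_j = y_j - p_j`, `j ≠ i`, in the chart `y_i = 1` around `p`. -/
abbrev Point.Index (P : Point n) : Type := {j : Fin n // j ≠ P.chart}

/-- The stabilizer of the point `p` of `ℂⁿ` under `t • y = (t ^ w_j * y_j)_j`, `t ∈ ℂ*`. When the
weights are positive it is a finite cyclic group contained in the group of `w_i`-th roots of unity,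
which acts on the chart `y_i = 1`. -/
def Point.stabilizer (w : Fin n → ℕ) (P : Point n) : Set ℂ :=
  {t | t ≠ 0 ∧ ∀ j, t ^ w j * P.coord j = P.coord j}

/-- The local ring `O_{ℙ(w), p} = ℂ{z}^μ` of the complex space `ℙ(w)` at `p`, where `μ` is the
stabilizer of `p`: convergent power series in the local coordinates at `p` of the chart `y_i = 1`,
invariant under the substitutions `z_j ↦ t ^ w_j z_j`, `t ∈ μ`. -/
def Point.ambientRing (w : Fin n → ℕ) (P : Point n) : Subalgebra ℂ (MvPowerSeries P.Index ℂ) where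
  carrier := {f | Converges f ∧ ∀ t ∈ P.stabilizer w,
    MvPowerSeries.rescale (fun j : P.Index => t ^ w j) f = f}
  mul_mem' := by
    intro f g hf hg
    refine ⟨hf.1.mul hg.1, fun t ht => ?_⟩
    rw [map_mul, hf.2 t ht, hg.2 t ht]
  add_mem' := by
    intro f g hf hg
    refine ⟨hf.1.add hg.1, fun t ht => ?_⟩
    rw [map_add, hf.2 t ht, hg.2 t ht]
  algebraMap_mem' c := by
    classical
    refine ⟨(convergentSeries P.Index).algebraMap_mem c, fun t _ => ?_⟩
    ext m
    rw [MvPowerSeries.coeff_rescale, MvPowerSeries.algebraMap_apply, MvPowerSeries.coeff_C]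
    split_ifs with h
    · simp [h]
    · simp

theorem Point.ambientRing_le (w : Fin n → ℕ) (P : Point n) :
    P.ambientRing w ≤ convergentSeries P.Index :=
  fun _ hf => hf.1

/-- The equation of the hypersurface `F = 0` in the chart `y_i = 1`, in the coordinates
`z_j = y_j - p_j`. -/
def Point.localEquation (P : Point n) (F : MvPolynomial (Fin n) ℂ) : MvPolynomial P.Index ℂ :=
  MvPolynomial.aeval
    (fun j => if h : j = P.chart then 1 else MvPolynomial.X ⟨j, h⟩ + MvPolynomial.C (P.coord j)) F

/-- The germ at `p` of the local equation, as a convergent power series. -/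
def Point.germEquation (P : Point n) (F : MvPolynomial (Fin n) ℂ) : convergentSeries P.Index :=
  ⟨(P.localEquation F : MvPowerSeries P.Index ℂ), converges_coe _⟩

/-- The ideal in `O_{ℙ(w), p}` of the hypersurface `F = 0`: the germs of functions on `ℙ(w)` whose
pull-back to the chart `ℂ^{n-1}` is a multiple of the local equation. -/
def Point.hypersurfaceIdeal (w : Fin n → ℕ) (P : Point n) (F : MvPolynomial (Fin n) ℂ) :
    Ideal (P.ambientRing w) :=
  (Ideal.span {P.germEquation F}).comap (Subalgebra.inclusion (P.ambientRing_le w))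

/-- The analytic local ring `O_{X, p}` of the hypersurface `X = {F = 0}` of `ℙ(w)` at `p`. (It is
also the ring of `μ`-invariants of `ℂ{z} / (F)`, `μ` being finite.) For `F = 0` it is the local ring
of `ℙ(w)` itself. -/
abbrev Point.localRing (w : Fin n → ℕ) (F : MvPolynomial (Fin n) ℂ) (P : Point n) : Type :=
  P.ambientRing w ⧸ P.hypersurfaceIdeal w F

/-- `p` is a singular point of the hypersurface `{F = 0}` of `ℙ(w)`: it lies on it, and the germ
there is not analytically equivalent to the germ of a smooth space `ℂ^d`. -/
def IsSingularPoint (w : Fin n → ℕ) (F : MvPolynomial (Fin n) ℂ) (P : Point n) : Prop :=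
  MvPolynomial.eval P.coord F = 0 ∧
    ∀ d : ℕ, IsEmpty (P.localRing w F ≃ₐ[ℂ] convergentSeries (Fin d))

/-- Analytic equivalence of the germ of `{F = 0} ⊆ ℙ(w)` at `P` and the germ of
`{F' = 0} ⊆ ℙ(w')` at `P'`: their analytic local rings are isomorphic as `ℂ`-algebras. -/
def SameType {n' : ℕ} (w : Fin n → ℕ) (F : MvPolynomial (Fin n) ℂ) (P : Point n)
    (w' : Fin n' → ℕ) (F' : MvPolynomial (Fin n') ℂ) (P' : Point n') : Prop :=
  Nonempty (P.localRing w F ≃ₐ[ℂ] P'.localRing w' F')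

/-- The weights of `ℙ(1,1,2,4,7)`. -/
def w₅ : Fin 5 → ℕ := ![1, 1, 2, 4, 7]

/-- The weights of `ℙ(1,2,4,7)`. -/
def w₄ : Fin 4 → ℕ := ![1, 2, 4, 7]

/-- The germ of `{F = 0} ⊆ ℙ(1,1,2,4,7)` at `P` is analytically equivalent to the germ of
`ℙ(1,2,4,7)` (the zero locus of the zero polynomial in it) at one of its singular points. -/
def TypeOccurs (F : MvPolynomial (Fin 5) ℂ) (P : Point 5) : Prop :=
  ∃ Q : Point 4, IsSingularPoint w₄ 0 Q ∧ SameType w₅ F P w₄ 0 Q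

/-- The singularities of `{F = 0} ⊆ ℙ(1,1,2,4,7)` are those of `ℙ(1,2,4,7)`: the same analytic
types of singular germs occur on both. -/
def HasSingularitiesOfP1247 (F : MvPolynomial (Fin 5) ℂ) : Prop :=
  (∀ P : Point 5, IsSingularPoint w₅ F P → TypeOccurs F P) ∧
    ∀ Q : Point 4, IsSingularPoint w₄ 0 Q →
      ∃ P : Point 5, IsSingularPoint w₅ F P ∧ SameType w₅ F P w₄ 0 Q

/-- Coordinate changes of `ℙ(1,1,2,4,7)`: automorphisms of the graded polynomial algebra
`ℂ[y₀,…,y₄]`, i.e. substitutions replacing each `y_j` by a weighted homogeneous polynomial of the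
same weight, and invertible. -/
def IsCoordinateChange (φ : MvPolynomial (Fin 5) ℂ ≃ₐ[ℂ] MvPolynomial (Fin 5) ℂ) : Prop :=
  ∀ j, (φ (MvPolynomial.X j)).IsWeightedHomogeneous w₅ (w₅ j)

open MvPolynomial in
/-- The list of normal forms, indexed by `ν ∈ {1,2,3,4,5,∞}`. -/
inductive IsNormalForm : ℕ∞ → MvPolynomial (Fin 5) ℂ → Prop
  | nu_top : IsNormalForm ⊤ (X 0 * X 4 - X 3 ^ 2)
  | nu_five : IsNormalForm 5 (X 0 * X 4 - X 3 ^ 2 + X 1 ^ 8)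
  | nu_four : IsNormalForm 4 (X 0 * X 4 - X 3 ^ 2 + X 2 * X 1 ^ 6)
  | nu_three (a₅ : ℂ) :
      IsNormalForm 3 (X 0 * X 4 - X 3 ^ 2 + (X 2 ^ 2 + C a₅ * X 1 ^ 4) * X 1 ^ 4)
  | nu_two (a₄ a₅ : ℂ) :
      IsNormalForm 2 (X 0 * X 4 - X 3 ^ 2
        + (X 2 ^ 3 + C a₄ * X 2 * X 1 ^ 4 + C a₅ * X 1 ^ 6) * X 1 ^ 2)
  | nu_one (a₃ a₄ a₅ : ℂ) :
      IsNormalForm 1 (X 0 * X 4 - X 3 ^ 2 + X 2 ^ 4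
        + (C a₃ * X 2 ^ 2 + C a₄ * X 2 * X 1 ^ 2 + C a₅ * X 1 ^ 4) * X 1 ^ 4)

end WeightedOctic

end

/-! Analytic types are told apart by three invariants of a local `ℂ`-algebra: the embedding
dimension (`EdimLE`), a divisibility property of squares that holds in smooth rings
(`SquareProperty`), and the existence of a nonconstant formal arc along which the tangent space has
generic rank more than three (`HasSingularArc`).

The local rings of `ℙ(1,2,4,7)` are rings of invariants of `μ_N`, N = 1, 2, 4, 7. The curve y₀ = y₃
= 0 of that space carries the μ₂ and μ₄ points; it consists of nonisolated singularities, so these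
points have a singular arc, and their embedding dimension is at most 6. The point 1/7(1,2,4) has
embedding dimension exactly 13. Where the stabilizer is trivial the ring is smooth. This dichotomy
is `localRing_w₄_cases`.

For the first claim, suppose that `F` has neither y₀y₄ nor y₁y₄. At (0:0:0:0:1) the equation then
has weight 8 in variables of weights 1, 1, 2, 4, too high to interfere with the invariants of weight
7, and fourteen of these are independent in the cotangent space: the embedding dimension exceeds 13
(`vertex_four`). If one of these terms occurs but y₃² does not, then (0:0:0:1:0) lies on the
hypersurface. The ambient germ 1/4(1,1,2,3) has 13 generators, and the equation eliminates y₀y₄ or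
y₁y₄, so the embedding dimension is at most 12; it is more than 6 because eight invariants of weight
4 meet a single relation (`vertex_three`). Neither germ occurs on `ℙ(1,2,4,7)`. Hence `F` contains
y₃² and a term ℓ(y₀,y₁)y₄. Linear changes, completing the square in y₃ and absorbing multiples of y₀
into y₄ leave y₀y₄ - y₃² plus a quartic in y₂ and y₁². A Tschirnhaus substitution y₂ ↦ l y₂ + μ y₁²
(or, for the last coefficient alone, a scaling of y₁) then gives the normal forms
(`exists_isNormalForm`).

For the second claim, take the point (0:0:1:η:0), where η ∈ {0, 1} is the coefficient of y₂⁴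
(`octic_singular`). The germ there is the quotient by μ₂ of a threefold hypersurface germ that is
smooth outside the origin, unless the quartic vanishes, which is the case ν = ∞. So it is singular,
but no arc is singular: it is neither smooth nor on a curve of singularities, and its embedding
dimension is at most 7, which excludes 13. -/

noncomputable section

namespace WeightedOctic

section LocalAlgebra

open MvPowerSeries

/-! ### Derivations along a homomorphism -/

section Tangent

variable {A A' B : Type*} [CommRing A] [Algebra ℂ A] [CommRing A'] [Algebra ℂ A'] [CommRing B]
  [Algebra ℂ B]

/-- `D` is a `ℂ`-linear derivation of `A` with values in `B`, regarded as an `A`-module by `γ`. -/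
def IsDer (γ : A →ₐ[ℂ] B) (D : A →ₗ[ℂ] B) : Prop :=
  ∀ x y, D (x * y) = γ x * D y + γ y * D x

/-- Some `n` elements of `A` determine all derivations along `γ`. -/
def TangentLE (γ : A →ₐ[ℂ] B) (n : ℕ) : Prop :=
  ∃ x : Fin n → A, ∀ D : A →ₗ[ℂ] B, IsDer γ D → (∀ i, D (x i) = 0) → D = 0

theorem TangentLE.mono {γ : A →ₐ[ℂ] B} {n k : ℕ} (h : TangentLE γ n) (hk : n ≤ k) :
    TangentLE γ k := by
  obtain ⟨x, hx⟩ := h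
  refine ⟨fun i => if hi : (i : ℕ) < n then x ⟨i, hi⟩ else 0, fun D hD h0 => hx D hD fun i => ?_⟩
  simpa using h0 (Fin.castLE hk i)

theorem IsDer.comp {γ : A →ₐ[ℂ] B} {D : A →ₗ[ℂ] B} (hD : IsDer γ D) (e : A' →ₐ[ℂ] A) :
    IsDer (γ.comp e) (D ∘ₗ e.toLinearMap) := fun x y => by
  simp [hD (e x) (e y)]

theorem TangentLE.of_equiv {γ : A →ₐ[ℂ] B} {n : ℕ} (e : A ≃ₐ[ℂ] A')
    (h : TangentLE (γ.comp (e.symm : A' →ₐ[ℂ] A)) n) : TangentLE γ n := by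
  obtain ⟨x, hx⟩ := h
  refine ⟨fun i => e.symm (x i), fun D hD h0 => ?_⟩
  have h1 := hx _ (hD.comp (e.symm : A' →ₐ[ℂ] A)) (fun i => by simpa using h0 i)
  ext a
  simpa using LinearMap.congr_fun h1 (e a)

theorem IsDer.map_one {γ : A →ₐ[ℂ] B} {D : A →ₗ[ℂ] B} (hD : IsDer γ D) : D 1 = 0 := by
  simpa using hD 1 1

theorem IsDer.map_algebraMap {γ : A →ₐ[ℂ] B} {D : A →ₗ[ℂ] B} (hD : IsDer γ D) (c : ℂ) :
    D (algebraMap ℂ A c) = 0 := by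
  rw [Algebra.algebraMap_eq_smul_one, map_smul, hD.map_one, smul_zero]

variable (A) in
/-- At every `ℂ`-point of `A`, the Zariski tangent space has dimension at most `n`. -/
def EdimLE (n : ℕ) : Prop := ∀ ε : A →ₐ[ℂ] ℂ, TangentLE ε n

variable (A) in
/-- A necessary condition for `A` to be smooth: modulo the cube of the maximal ideal, the only
squares divisible by an element are those forced by unique factorization of their initial forms. -/
def SquareProperty : Prop :=
  ∀ (ε : A →ₐ[ℂ] ℂ) (D : A →ₗ[ℂ] ℂ) (u v w : A), IsDer ε D → ε u = 0 → ε v = 0 → ε w = 0 →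
    u * v = w * w → D u = 0 → D w = 0

variable (A) in
/-- There is a formal arc along which the tangent space has generic rank more than three. -/
def HasSingularArc : Prop :=
  ∃ γ : A →ₐ[ℂ] PowerSeries ℂ, (∃ a, ∀ c : ℂ, γ a ≠ algebraMap ℂ _ c) ∧ ¬ TangentLE γ 3

theorem EdimLE.mono {n k : ℕ} (h : EdimLE A n) (hk : n ≤ k) : EdimLE A k :=
  fun ε => (h ε).mono hk

theorem EdimLE.of_equiv {n : ℕ} (e : A ≃ₐ[ℂ] A') (h : EdimLE A' n) : EdimLE A n :=
  fun _ => TangentLE.of_equiv e (h _)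

theorem SquareProperty.of_equiv (e : A ≃ₐ[ℂ] A') (h : SquareProperty A') : SquareProperty A := by
  intro ε D u v w hD hu hv hw huv hDu
  have := h (ε.comp (e.symm : A' →ₐ[ℂ] A)) (D ∘ₗ (e.symm : A' →ₐ[ℂ] A).toLinearMap) (e u) (e v)
    (e w) (hD.comp _) (by simpa) (by simpa) (by simpa) (by simp [← map_mul, huv]) (by simpa)
  simpa using this

theorem HasSingularArc.of_equiv (e : A ≃ₐ[ℂ] A') (h : HasSingularArc A') : HasSingularArc A := by
  obtain ⟨γ, ⟨a, ha⟩, hγ⟩ := h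
  refine ⟨γ.comp (e : A →ₐ[ℂ] A'), ⟨e.symm a, by simpa using ha⟩, fun h => hγ ?_⟩
  refine TangentLE.of_equiv e.symm ?_
  simpa using h

end Tangent

/-! ### Rings of convergent power series with exponents in a saturated semigroup -/

section Monomial

variable {σ : Type*}

/-- `A` consists of the convergent power series whose exponents lie in the saturated
semigroup `M`. -/
structure IsMonomialRing (A : Subalgebra ℂ (MvPowerSeries σ ℂ)) (M : Set (σ →₀ ℕ)) : Prop where
  mem_iff : ∀ f, f ∈ A ↔ Converges f ∧ ∀ m, coeff m f ≠ 0 → m ∈ M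
  zero_mem : 0 ∈ M
  add_mem_iff : ∀ a ∈ M, ∀ b, a + b ∈ M ↔ b ∈ M

theorem isMonomialRing_convergentSeries [Finite σ] :
    IsMonomialRing (convergentSeries σ) Set.univ :=
  ⟨fun f => by simp only [Set.mem_univ, implies_true, and_true]; exact Iff.rfl, trivial, by simp⟩

/-- Without a constant term every monomial has degree at least 1, so shrinking the radius by θ
multiplies the sum of norms by at most θ. -/
theorem exists_small_radius {g : MvPowerSeries σ ℂ} (hg : Converges g) (h0 : coeff 0 g = 0) :
    ∃ s : ℝ, 0 < s ∧ ∀ S : Finset (σ →₀ ℕ), ∑ m ∈ S, ‖coeff m g‖ * s ^ m.degree ≤ 1 / 2 := by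
  obtain ⟨r, hr, hs⟩ := hg
  set K := ∑' m : σ →₀ ℕ, ‖coeff m g‖ * r ^ m.degree with hK
  have hK0 : 0 ≤ K := tsum_nonneg fun m => by positivity
  set θ : ℝ := 1 / (2 * (K + 1)) with hθ
  have hθ0 : 0 < θ := by positivity
  have hθ1 : θ ≤ 1 := by
    rw [hθ, div_le_one (by positivity)]
    linarith
  refine ⟨θ * r, by positivity, fun S => ?_⟩
  have h1 : ∀ m ∈ S, ‖coeff m g‖ * (θ * r) ^ m.degree ≤ θ * (‖coeff m g‖ * r ^ m.degree) := by
    intro m _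
    rcases eq_or_ne m 0 with rfl | hm
    · simp [h0]
    · have hd : m.degree ≠ 0 := by simpa [Finsupp.degree_eq_zero_iff] using hm
      rw [mul_pow]
      have : θ ^ m.degree ≤ θ := pow_le_of_le_one hθ0.le hθ1 hd
      calc _ ≤ ‖coeff m g‖ * (θ * r ^ m.degree) := by gcongr
        _ = _ := by ring
  refine (Finset.sum_le_sum h1).trans ?_
  rw [← Finset.mul_sum]
  have h2 : ∑ m ∈ S, ‖coeff m g‖ * r ^ m.degree ≤ K := hs.sum_le_tsum S fun m _ => by positivity
  calc _ ≤ θ * K := by gcongr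
    _ ≤ 1 / 2 := by
      rw [hθ, div_mul_eq_mul_div, div_le_div_iff₀ (by positivity) (by positivity)]
      linarith

/-- This is the geometric series. At a radius where `g` has norm at most 1/2, a partial sum `H` of
norms of `h` satisfies H ≤ 1 + H/2, hence H ≤ 2. -/
theorem converges_of_mul_eq_one {g h : MvPowerSeries σ ℂ} (hg : Converges g)
    (h0 : coeff 0 g = 0) (hgh : h = 1 + g * h) : Converges h := by
  classical
  obtain ⟨s, hs0, hs⟩ := exists_small_radius hg h0
  refine ⟨s, hs0, summable_of_sum_le (c := 2) (fun m => by positivity) fun S => ?_⟩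
  -- Passing to a box makes the index set downward closed, so the recursion for `h` involves only
  -- coefficients inside it.
  let N : σ →₀ ℕ := S.sup id
  have hS : S ⊆ Finset.Iic N := fun m hm => Finset.mem_Iic.2 (Finset.le_sup (f := id) hm)
  refine (Finset.sum_le_sum_of_subset_of_nonneg hS fun m _ _ => by positivity).trans ?_
  set H := ∑ m ∈ Finset.Iic N, ‖coeff m h‖ * s ^ m.degree with hH
  have hpt : ∀ m ∈ Finset.Iic N, ‖coeff m h‖ * s ^ m.degree ≤ (if m = 0 then 1 else 0) +
      ∑ p ∈ Finset.HasAntidiagonal.antidiagonal m,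
        (‖coeff p.1 g‖ * s ^ p.1.degree) * (‖coeff p.2 h‖ * s ^ p.2.degree) := by
    intro m _
    have hm : coeff m h = (if m = 0 then 1 else 0) +
        ∑ p ∈ Finset.HasAntidiagonal.antidiagonal m, coeff p.1 g * coeff p.2 h := by
      conv_lhs => rw [hgh]
      rw [map_add, coeff_one, coeff_mul]
    rw [hm]
    refine (mul_le_mul_of_nonneg_right (norm_add_le _ _) (by positivity)).trans ?_
    rw [add_mul]
    refine add_le_add ?_ ?_
    · split_ifs with h <;> simp [h]
    · refine (mul_le_mul_of_nonneg_right (norm_sum_le _ _) (by positivity)).trans (le_of_eq ?_)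
      rw [Finset.sum_mul]
      refine Finset.sum_congr rfl (fun p hp => ?_)
      rw [← Finset.HasAntidiagonal.mem_antidiagonal.1 hp, map_add, pow_add, norm_mul]
      ring
  have hsum : H ≤ 1 + (∑ m ∈ Finset.Iic N, ‖coeff m g‖ * s ^ m.degree) * H := by
    refine (Finset.sum_le_sum hpt).trans ?_
    rw [Finset.sum_add_distrib]
    refine add_le_add (by simp) ?_
    rw [Finset.sum_sigma', hH, Finset.sum_mul_sum, ← Finset.sum_product']
    rw [← Finset.sum_image (g := fun x : (_ : σ →₀ ℕ) × ((σ →₀ ℕ) × (σ →₀ ℕ)) => x.2)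
      (f := fun p => (‖coeff p.1 g‖ * s ^ p.1.degree) * (‖coeff p.2 h‖ * s ^ p.2.degree))]
    · refine Finset.sum_le_sum_of_subset_of_nonneg ?_ fun p _ _ => by positivity
      intro p hp
      obtain ⟨⟨m, q⟩, hq, rfl⟩ := Finset.mem_image.1 hp
      simp only [Finset.mem_sigma, Finset.HasAntidiagonal.mem_antidiagonal, Finset.mem_Iic] at hq
      simp only [Finset.mem_product, Finset.mem_Iic]
      exact ⟨le_self_add.trans (hq.2.trans_le hq.1), le_add_self.trans (hq.2.trans_le hq.1)⟩
    · rintro ⟨m, p⟩ hm ⟨m', p'⟩ hm' (rfl : p = p')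
      simp only [Finset.coe_sigma, Set.mem_sigma_iff, Finset.mem_coe,
        Finset.HasAntidiagonal.mem_antidiagonal] at hm hm'
      rw [← hm.2, ← hm'.2]
  have hH0 : 0 ≤ H := Finset.sum_nonneg fun m _ => by positivity
  have := mul_le_mul_of_nonneg_right (hs (Finset.Iic N)) hH0
  linarith

end Monomial

section Monomial

variable {σ : Type*}

/-- The constant coefficient, on an algebra of power series. -/
def augmentation (A : Subalgebra ℂ (MvPowerSeries σ ℂ)) : A →ₐ[ℂ] ℂ where
  toRingHom := (constantCoeff (σ := σ) (R := ℂ)).comp A.val.toRingHom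
  commutes' c := by simp [MvPowerSeries.algebraMap_apply]

theorem augmentation_apply {A : Subalgebra ℂ (MvPowerSeries σ ℂ)} (f : A) :
    augmentation A f = coeff 0 (f : MvPowerSeries σ ℂ) := rfl

variable {A : Subalgebra ℂ (MvPowerSeries σ ℂ)} {M : Set (σ →₀ ℕ)}

theorem IsMonomialRing.monomial_mem (hA : IsMonomialRing A M) {m : σ →₀ ℕ} (hm : m ∈ M) (c : ℂ) :
    monomial m c ∈ A := by
  classical
  refine (hA.mem_iff _).2 ⟨?_, fun k hk => ?_⟩
  · rw [← MvPolynomial.coe_monomial]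
    exact converges_coe _
  · rw [coeff_monomial] at hk
    rw [(ite_ne_right_iff.1 hk).1]
    exact hm

/-- The monomial with exponent `m`, as an element of `A`. -/
def IsMonomialRing.mono (hA : IsMonomialRing A M) {m : σ →₀ ℕ} (hm : m ∈ M) : A :=
  ⟨monomial m 1, hA.monomial_mem hm 1⟩

theorem Converges.C_mul {f : MvPowerSeries σ ℂ} (hf : Converges f) (c : ℂ) :
    Converges (MvPowerSeries.C c * f) := by
  refine Converges.mul ?_ hf
  rw [← MvPolynomial.coe_C]
  exact converges_coe _

theorem converges_one : Converges (1 : MvPowerSeries σ ℂ) := by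
  rw [← MvPolynomial.coe_one]
  exact converges_coe _

theorem Converges.inverse {f k : MvPowerSeries σ ℂ} (hf : Converges f) (h0 : coeff 0 f ≠ 0)
    (hk : f * k = 1) : Converges k := by
  set c := coeff 0 f with hc
  have hC : MvPowerSeries.C c * MvPowerSeries.C c⁻¹ = (1 : MvPowerSeries σ ℂ) := by
    rw [← map_mul, mul_inv_cancel₀ h0, map_one]
  have hg : Converges (1 + MvPowerSeries.C (-c⁻¹) * f) :=
    (converges_one.add (hf.C_mul _))
  have := converges_of_mul_eq_one (h := MvPowerSeries.C c * k) hg ?_ ?_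
  · convert this.C_mul c⁻¹ using 1
    linear_combination -k * hC
  · rw [map_add, coeff_C_mul, ← hc, coeff_zero_eq_constantCoeff_apply, map_one]
    field_simp
    ring
  · rw [map_neg]
    linear_combination hk * MvPowerSeries.C c * MvPowerSeries.C c⁻¹ + hC

/-- Keeping only the terms with exponent in `M` commutes with multiplication by an element of `A`,
because `M` is saturated. Applied to the formal inverse it yields an inverse inside `A`. -/
theorem IsMonomialRing.exists_mul_eq_one (hA : IsMonomialRing A M) {f : MvPowerSeries σ ℂ}
    (hf : f ∈ A) (h0 : coeff 0 f ≠ 0) : ∃ k ∈ A, f * k = 1 := by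
  classical
  have hf' := (hA.mem_iff f).1 hf
  have hinv : f * f⁻¹ = 1 := MvPowerSeries.mul_inv_cancel f h0
  have hconv : Converges f⁻¹ := hf'.1.inverse h0 hinv
  let k : MvPowerSeries σ ℂ := fun m => if m ∈ M then coeff m f⁻¹ else 0
  have hk : ∀ m, coeff m k = if m ∈ M then coeff m f⁻¹ else 0 := fun m => rfl
  refine ⟨k, (hA.mem_iff k).2 ⟨?_, fun m hm => ?_⟩, ?_⟩
  · obtain ⟨r, hr, hs⟩ := hconv
    refine ⟨r, hr, hs.of_nonneg_of_le (fun m => by positivity) fun m => ?_⟩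
    rw [hk]
    split_ifs
    · exact le_rfl
    · rw [norm_zero, zero_mul]
      positivity
  · rw [hk] at hm
    exact (ite_ne_right_iff.1 hm).1
  · ext m
    have key : ∀ p ∈ Finset.HasAntidiagonal.antidiagonal m, coeff p.1 f * coeff p.2 k =
        if m ∈ M then coeff p.1 f * coeff p.2 f⁻¹ else 0 := by
      intro p hp
      rw [Finset.HasAntidiagonal.mem_antidiagonal] at hp
      by_cases hp1 : coeff p.1 f = 0
      · simp [hp1]
      · have h1 := hA.add_mem_iff p.1 (hf'.2 _ hp1) p.2
        rw [hp] at h1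
        rw [hk, ← if_congr h1 rfl rfl]
        split_ifs <;> simp
    rw [coeff_mul, Finset.sum_congr rfl key]
    by_cases hm : m ∈ M
    · simp only [hm, if_true]
      rw [← coeff_mul, hinv]
    · simp only [hm, if_false, Finset.sum_const_zero]
      rw [coeff_one, if_neg]
      rintro rfl
      exact hm hA.zero_mem

/-- The ring is local: f - ε(f) lies in a kernel, so it is not a unit and its constant term
vanishes. Statements about all `ℂ`-points thus concern only the origin. -/
theorem IsMonomialRing.algHom_eq (hA : IsMonomialRing A M) (ε : A →ₐ[ℂ] ℂ) :
    ε = augmentation A := by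
  ext f
  by_contra hne
  let g : A := f - algebraMap ℂ A (ε f)
  have hg0 : ε g = 0 := by simp [g]
  have h0 : augmentation A g ≠ 0 := by
    simp only [g, map_sub, AlgHom.commutes]
    exact sub_ne_zero.2 (Ne.symm hne)
  obtain ⟨k, hk, hgk⟩ := hA.exists_mul_eq_one g.2 h0
  have : g * ⟨k, hk⟩ = 1 := Subtype.ext hgk
  simpa [hg0] using congr_arg ε this

/-- The family `g` of exponents in `M` generates `M` in the sense that every nonzero element of `M`
is at least one of them. -/
structure IsDominating {ι : Type*} (M : Set (σ →₀ ℕ)) (g : ι → σ →₀ ℕ) : Prop where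
  mem : ∀ i, g i ∈ M
  ne_zero : ∀ i, g i ≠ 0
  exists_le : ∀ m ∈ M, m ≠ 0 → ∃ i, g i ≤ m

/-- The dominating monomials generate the maximal ideal, with convergent coefficients: each exponent
of `f` is assigned to one generator below it and divided by it. -/
theorem IsMonomialRing.exists_sum_eq (hA : IsMonomialRing A M) {ι : Type*} [Fintype ι]
    {g : ι → σ →₀ ℕ} (hg : IsDominating M g) (f : A) (hf : augmentation A f = 0) :
    ∃ h : ι → A, f = ∑ i, hA.mono (hg.mem i) * h i := by
  classical
  have hfA := (hA.mem_iff f).1 f.2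
  have hex : ∀ m, ∃ i : Option ι, (m ∈ M → m ≠ 0 → ∃ j, i = some j ∧ g j ≤ m) := fun m => by
    by_cases hm : m ∈ M ∧ m ≠ 0
    · obtain ⟨j, hj⟩ := hg.exists_le m hm.1 hm.2
      exact ⟨some j, fun _ _ => ⟨j, rfl, hj⟩⟩
    · exact ⟨none, fun h1 h2 => (hm ⟨h1, h2⟩).elim⟩
  choose idx hidx using hex
  -- `idx` assigns each exponent to a single generator, so no term is counted twice; shifting by `g
  -- i` costs only a constant factor in the norm estimate.
  let h : ι → MvPowerSeries σ ℂ := fun i m =>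
    if idx (g i + m) = some i then coeff (g i + m) (f : MvPowerSeries σ ℂ) else 0
  have hh : ∀ i m, coeff m (h i) =
    if idx (g i + m) = some i then coeff (g i + m) (f : MvPowerSeries σ ℂ) else 0 := fun i m => rfl
  have hmem : ∀ i, h i ∈ A := by
    intro i
    refine (hA.mem_iff _).2 ⟨?_, fun m hm => ?_⟩
    · obtain ⟨r, hr, hs⟩ := hfA.1
      refine ⟨r, hr, ?_⟩
      have h1 := (hs.comp_injective (add_right_injective (g i))).mul_left (r ^ (g i).degree)⁻¹
      refine h1.of_nonneg_of_le (fun m => by positivity) fun m => ?_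
      have h2 : ‖coeff m (h i)‖ ≤ ‖coeff (g i + m) (f : MvPowerSeries σ ℂ)‖ := by
        rw [hh]
        split_ifs
        · exact le_rfl
        · simp
      simp only [Function.comp, map_add, pow_add]
      calc _ ≤ ‖coeff (g i + m) (f : MvPowerSeries σ ℂ)‖ * r ^ m.degree := by gcongr
        _ = _ := by field_simp
    · rw [hh] at hm
      exact (hA.add_mem_iff _ (hg.mem i) m).1 (hfA.2 _ (ite_ne_right_iff.1 hm).2)
  refine ⟨fun i => ⟨h i, hmem i⟩, Subtype.ext ?_⟩
  simp only [AddSubmonoidClass.coe_finsetSum, MulMemClass.coe_mul, IsMonomialRing.mono]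
  ext m
  rw [map_sum]
  simp only [coeff_monomial_mul, one_mul]
  by_cases hm : coeff m (f : MvPowerSeries σ ℂ) = 0
  · rw [hm, Finset.sum_eq_zero]
    intro i _
    split_ifs with hle
    · rw [hh, add_tsub_cancel_of_le hle, hm, ite_self]
    · rfl
  · have hm0 : m ≠ 0 := by
      rintro rfl
      exact hm hf
    obtain ⟨j, hj, hjm⟩ := hidx m (hfA.2 m hm) hm0
    rw [Finset.sum_eq_single j]
    · rw [if_pos hjm, hh, add_tsub_cancel_of_le hjm, if_pos hj]
    · intro i _ hij
      split_ifs with hle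
      · rw [hh, add_tsub_cancel_of_le hle, hj, if_neg]
        simpa using hij.symm
      · rfl
    · simp

theorem IsMonomialRing.augmentation_mono (hA : IsMonomialRing A M) {m : σ →₀ ℕ} (hm : m ∈ M)
    (h0 : m ≠ 0) : augmentation A (hA.mono hm) = 0 := by
  classical
  rw [augmentation_apply, IsMonomialRing.mono, coeff_monomial, if_neg h0.symm]

theorem sub_augmentation (f : A) :
    augmentation A (f - algebraMap ℂ A (augmentation A f)) = 0 := by
  simp

theorem IsDer.eq_sum_of_isDominating {B : Type*} [CommRing B] [Algebra ℂ B]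
    (hA : IsMonomialRing A M) {ι : Type*} [Fintype ι]
    {g : ι → σ →₀ ℕ} (hg : IsDominating M g) {γ : A →ₐ[ℂ] B} {D : A →ₗ[ℂ] B} (hD : IsDer γ D)
    (f : A) : ∃ h : ι → A, D f = ∑ i, (γ (hA.mono (hg.mem i)) * D (h i) +
      γ (h i) * D (hA.mono (hg.mem i))) := by
  obtain ⟨h, hh⟩ := hA.exists_sum_eq hg _ (sub_augmentation f)
  refine ⟨h, ?_⟩
  have := congr_arg D hh
  rw [map_sub, hD.map_algebraMap, sub_zero, map_sum] at this
  rw [this]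
  exact Finset.sum_congr rfl fun i _ => hD _ _

/-- A derivation at the point kills the constants and the square of the maximal ideal, so its values
on generators determine it. -/
theorem IsMonomialRing.der_eq_zero (hA : IsMonomialRing A M) {ι : Type*} [Fintype ι]
    {g : ι → σ →₀ ℕ} (hg : IsDominating M g) {ε : A →ₐ[ℂ] ℂ} {D : A →ₗ[ℂ] ℂ} (hD : IsDer ε D)
    (h0 : ∀ i, D (hA.mono (hg.mem i)) = 0) : D = 0 := by
  ext f
  obtain ⟨h, hh⟩ := hD.eq_sum_of_isDominating hA hg f
  rw [hh, LinearMap.zero_apply]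
  refine Finset.sum_eq_zero fun i _ => ?_
  rw [h0, mul_zero, hA.algHom_eq ε, hA.augmentation_mono _ (hg.ne_zero i), zero_mul, zero_add]

theorem IsMonomialRing.constantCoeff_eq (hA : IsMonomialRing A M)
    (γ : A →ₐ[ℂ] PowerSeries ℂ) (f : A) :
    PowerSeries.constantCoeff (γ f) = augmentation A f := by
  let c : PowerSeries ℂ →ₐ[ℂ] ℂ :=
    { toRingHom := PowerSeries.constantCoeff
      commutes' := fun c => by simp }
  exact AlgHom.congr_fun (hA.algHom_eq (c.comp γ)) f

theorem IsMonomialRing.X_dvd (hA : IsMonomialRing A M)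
    (γ : A →ₐ[ℂ] PowerSeries ℂ) (f : A) (hf : augmentation A f = 0) : PowerSeries.X ∣ γ f := by
  rw [PowerSeries.X_dvd_iff, hA.constantCoeff_eq, hf]

theorem eq_zero_of_forall_X_pow_dvd {p : PowerSeries ℂ} (h : ∀ n, PowerSeries.X ^ n ∣ p) :
    p = 0 := by
  ext n
  simpa using PowerSeries.X_pow_dvd_iff.1 (h (n + 1)) n n.lt_succ_self

/-- Here the derivation is not assumed continuous. Each expansion in the generators gains a factor
`X` in every value of `D`, so the values lie in the intersection of all powers of the ideal of `X`,
which is zero. -/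
theorem IsMonomialRing.arc_der_eq_zero (hA : IsMonomialRing A M) {ι : Type*} [Fintype ι]
    {g : ι → σ →₀ ℕ} (hg : IsDominating M g) {γ : A →ₐ[ℂ] PowerSeries ℂ}
    {D : A →ₗ[ℂ] PowerSeries ℂ} (hD : IsDer γ D)
    (h0 : ∀ i, D (hA.mono (hg.mem i)) = 0) : D = 0 := by
  have key : ∀ n : ℕ, ∀ f, PowerSeries.X ^ n ∣ D f := by
    intro n
    induction n with
    | zero => simp
    | succ n ih =>
      intro f
      obtain ⟨h, hh⟩ := hD.eq_sum_of_isDominating hA hg f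
      rw [hh]
      refine Finset.dvd_sum fun i _ => ?_
      rw [h0, mul_zero, add_zero, pow_succ']
      exact mul_dvd_mul (hA.X_dvd γ _ (hA.augmentation_mono _ (hg.ne_zero i))) (ih _)
  ext1 f
  exact eq_zero_of_forall_X_pow_dvd fun n => key n f

theorem IsMonomialRing.arc_constant (hA : IsMonomialRing A M) {ι : Type*} [Fintype ι]
    {g : ι → σ →₀ ℕ} (hg : IsDominating M g) {γ : A →ₐ[ℂ] PowerSeries ℂ}
    (h0 : ∀ i, γ (hA.mono (hg.mem i)) = 0) (f : A) :
    γ f = algebraMap ℂ _ (augmentation A f) := by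
  obtain ⟨h, hh⟩ := hA.exists_sum_eq hg _ (sub_augmentation f)
  have := congr_arg γ hh
  rw [map_sub, AlgHom.commutes, map_sum] at this
  rw [← sub_eq_zero, this]
  exact Finset.sum_eq_zero fun i _ => by rw [map_mul, h0, zero_mul]

/-- An exponent of `M` that is not the sum of two nonzero ones. -/
def IsIrred (M : Set (σ →₀ ℕ)) (m : σ →₀ ℕ) : Prop :=
  m ∈ M ∧ m ≠ 0 ∧ ∀ a ∈ M, ∀ b ∈ M, a + b = m → a = 0 ∨ b = 0

/-- The coefficient of a monomial, as a linear functional. -/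
def coeffFun (A : Subalgebra ℂ (MvPowerSeries σ ℂ)) (m : σ →₀ ℕ) : A →ₗ[ℂ] ℂ :=
  (coeff m).comp A.val.toLinearMap

theorem coeffFun_apply (m : σ →₀ ℕ) (f : A) : coeffFun A m f = coeff m (f : MvPowerSeries σ ℂ) :=
  rfl

/-- An irreducible exponent splits inside `M` only trivially. The factor `k` may be any power
series: saturation forces its contributing exponents into `M`. -/
theorem IsMonomialRing.coeff_mul_of_irred (hA : IsMonomialRing A M) {f : MvPowerSeries σ ℂ}
    (hf : f ∈ A) (k : MvPowerSeries σ ℂ) {m : σ →₀ ℕ} (hm : IsIrred M m) :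
    coeff m (f * k) = coeff 0 f * coeff m k + coeff 0 k * coeff m f := by
  classical
  rw [coeff_mul]
  have hsub : ({(0, m), (m, 0)} : Finset ((σ →₀ ℕ) × (σ →₀ ℕ))) ⊆
      Finset.HasAntidiagonal.antidiagonal m := by
    intro p hp
    simp only [Finset.mem_insert, Finset.mem_singleton] at hp
    rcases hp with rfl | rfl <;> simp
  rw [← Finset.sum_subset hsub, Finset.sum_pair]
  · ring
  · intro h
    exact hm.2.1 (Prod.ext_iff.1 h).2
  · rintro ⟨a, b⟩ hp hn
    rw [Finset.HasAntidiagonal.mem_antidiagonal] at hp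
    by_contra hne
    obtain ⟨ha, hb⟩ := mul_ne_zero_iff.1 hne
    dsimp only at hp
    have haM := ((hA.mem_iff f).1 hf).2 a ha
    rcases hm.2.2 a haM b ((hA.add_mem_iff a haM b).1 (hp ▸ hm.1)) hp with rfl | rfl
    · exact hn (by simp [← hp])
    · exact hn (by simp [← hp])

theorem IsMonomialRing.isDer_coeffFun (hA : IsMonomialRing A M) {m : σ →₀ ℕ} (hm : IsIrred M m) :
    IsDer (augmentation A) (coeffFun A m) := fun x y =>
  hA.coeff_mul_of_irred x.2 y hm

end Monomial

/-! ### Embedding dimension and square property of quotients of monomial rings. -/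

section Quotient

variable {σ : Type*} {A : Subalgebra ℂ (MvPowerSeries σ ℂ)} {M : Set (σ →₀ ℕ)}

theorem TangentLE.of_family {R B : Type*} [CommRing R] [Algebra ℂ R] [CommRing B] [Algebra ℂ B]
    {γ : R →ₐ[ℂ] B} {ι : Type*} [Fintype ι] (x : ι → R)
    (h : ∀ D : R →ₗ[ℂ] B, IsDer γ D → (∀ i, D (x i) = 0) → D = 0) :
    TangentLE γ (Fintype.card ι) :=
  ⟨fun i => x ((Fintype.equivFin ι).symm i), fun D hD h0 => h D hD fun i => by
    simpa using h0 (Fintype.equivFin ι i)⟩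

variable {R' : Type*} [CommRing R'] [Algebra ℂ R']

theorem eq_zero_of_comp {R B : Type*} [CommRing R] [Algebra ℂ R] [CommRing B] [Algebra ℂ B]
    {π : R →ₐ[ℂ] R'} (hπ : Function.Surjective π) {D : R' →ₗ[ℂ] B}
    (h : D ∘ₗ π.toLinearMap = 0) : D = 0 := by
  ext a
  obtain ⟨a, rfl⟩ := hπ a
  exact LinearMap.congr_fun h a

theorem IsMonomialRing.edimLE (hA : IsMonomialRing A M) {π : A →ₐ[ℂ] R'}
    (hπ : Function.Surjective π) {ι : Type*} [Fintype ι]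
    {g : ι → σ →₀ ℕ} (hg : IsDominating M g) : EdimLE R' (Fintype.card ι) := fun _ =>
  TangentLE.of_family (fun i => π (hA.mono (hg.mem i))) fun _ hD h0 =>
    eq_zero_of_comp hπ (hA.der_eq_zero hg (hD.comp π) h0)

/-- A relation with a nonzero linear term eliminates a generator. -/
theorem IsMonomialRing.edimLE_of_mem (hA : IsMonomialRing A M) {π : A →ₐ[ℂ] R'}
    (hπ : Function.Surjective π) {ι : Type*}
    [Fintype ι] [DecidableEq ι] {g : ι → σ →₀ ℕ} (hg : IsDominating M g)
    (hinj : Function.Injective g) {f : A} (hf : π f = 0) (hf0 : augmentation A f = 0) {i₀ : ι}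
    (hi₀ : IsIrred M (g i₀)) (hfi : coeff (g i₀) (f : MvPowerSeries σ ℂ) ≠ 0) :
    EdimLE R' (Fintype.card {i // i ≠ i₀}) := fun ε => by
  classical
  refine TangentLE.of_family
    (fun i : {i // i ≠ i₀} => π (hA.mono (hg.mem i))) fun D hD h0 =>
    eq_zero_of_comp hπ (hA.der_eq_zero hg (hD.comp π) fun i => ?_)
  have hi : ∀ i, i ≠ i₀ →
      (D ∘ₗ π.toLinearMap) (hA.mono (hg.mem i)) = 0 :=
    fun i h => h0 ⟨i, h⟩
  rcases eq_or_ne i i₀ with rfl | h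
  swap
  · exact hi i h
  set E := D ∘ₗ π.toLinearMap with hE
  have hder := (hD.comp π)
  rw [← hE] at hder
  obtain ⟨h, hh⟩ := hA.exists_sum_eq hg f hf0
  have h1 : E f = 0 := by
    simp only [hE, LinearMap.comp_apply, AlgHom.toLinearMap_apply, hf, map_zero]
  -- The same number `augmentation A (h i)` is the coefficient of `f` at the irreducible exponent `g
  -- i`. It is nonzero, while `E f` vanishes, so `E` kills the last generator too.
  have h2 : E f = augmentation A (h i) * E (hA.mono (hg.mem i)) := by
    rw [hh, map_sum, Finset.sum_eq_single i]
    · rw [hder, hA.algHom_eq (ε.comp _), hA.augmentation_mono _ (hg.ne_zero i), zero_mul, zero_add]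
    · intro j _ hj
      rw [hder, hA.algHom_eq (ε.comp _), hA.augmentation_mono _ (hg.ne_zero j), zero_mul, zero_add,
        hi j hj, mul_zero]
    · simp
  have h3 : coeffFun A (g i) f = augmentation A (h i) := by
    have hco : ∀ j, coeffFun A (g i) (hA.mono (hg.mem j)) = if g i = g j then 1 else 0 :=
      fun j => by rw [coeffFun_apply, IsMonomialRing.mono, coeff_monomial]
    rw [hh, map_sum, Finset.sum_eq_single i]
    · rw [hA.isDer_coeffFun hi₀, hA.augmentation_mono _ (hg.ne_zero i), hco, if_pos rfl]
      ring
    · intro j _ hj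
      rw [hA.isDer_coeffFun hi₀, hA.augmentation_mono _ (hg.ne_zero j), hco,
        if_neg fun h => hj (hinj h.symm)]
      ring
    · simp
  rw [h1, ← h3] at h2
  exact (mul_eq_zero.1 h2.symm).resolve_left hfi

/-- A `ℂ`-linear section of `π` serves to define both maps on the quotient; vanishing on the kernel
makes them independent of the section. -/
theorem exists_der_of_surjective {R : Type*} [CommRing R] [Algebra ℂ R] {π : R →ₐ[ℂ] R'}
    (hπ : Function.Surjective π) {ε : R →ₐ[ℂ] ℂ} {D : R →ₗ[ℂ] ℂ} (hD : IsDer ε D)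
    (hε : ∀ a, π a = 0 → ε a = 0) (h : ∀ a, π a = 0 → D a = 0) :
    ∃ (ε' : R' →ₐ[ℂ] ℂ) (D' : R' →ₗ[ℂ] ℂ), IsDer ε' D' ∧ (∀ a, ε' (π a) = ε a) ∧
      ∀ a, D' (π a) = D a := by
  obtain ⟨s, hs⟩ := π.toLinearMap.exists_rightInverse_of_surjective (LinearMap.range_eq_top.2 hπ)
  have hs' : ∀ x, π (s x) = x := LinearMap.congr_fun hs
  have key : ∀ a, D (s (π a)) = D a := fun a => by
    rw [← sub_eq_zero, ← map_sub]
    exact h _ (by rw [map_sub, hs', sub_self])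
  have keyε : ∀ a, ε (s (π a)) = ε a := fun a => by
    rw [← sub_eq_zero, ← map_sub]
    exact hε _ (by rw [map_sub, hs', sub_self])
  let ε' : R' →ₐ[ℂ] ℂ := AlgHom.ofLinearMap (ε.toLinearMap ∘ₗ s)
    (by simpa using keyε 1) (fun x y => by
      obtain ⟨x, rfl⟩ := hπ x
      obtain ⟨y, rfl⟩ := hπ y
      simp only [LinearMap.comp_apply, AlgHom.toLinearMap_apply, ← map_mul π, keyε, map_mul ε])
  refine ⟨ε', D ∘ₗ s, fun x y => ?_, keyε, key⟩
  obtain ⟨x, rfl⟩ := hπ x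
  obtain ⟨y, rfl⟩ := hπ y
  have h1 : ∀ a, ε' (π a) = ε a := keyε
  rw [← map_mul, h1, h1]
  simp only [LinearMap.comp_apply, key]
  exact hD x y

/-- Coefficients at irreducible exponents are independent derivations. Among their combinations, `k`
linear conditions `φ` ensure descent to the quotient and `n` more ensure vanishing on given
elements; with more than n + k exponents a nonzero combination survives. -/
theorem IsMonomialRing.not_edimLE (hA : IsMonomialRing A M) {π : A →ₐ[ℂ] R'}
    (hπ : Function.Surjective π) {ι : Type*} [Fintype ι]
    {g : ι → σ →₀ ℕ} (hg : ∀ i, IsIrred M (g i)) (hinj : Function.Injective g) {n k : ℕ}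
    (φ : Fin k → ι → ℂ) (hn : n + k < Fintype.card ι) (hI0 : ∀ a, π a = 0 → augmentation A a = 0)
    (hI : ∀ a, π a = 0 → ∀ c : ι → ℂ, (∀ j, ∑ i, c i * φ j i = 0) →
      ∑ i, c i * coeff (g i) (a : MvPowerSeries σ ℂ) = 0) : ¬ EdimLE R' n := by
  classical
  intro h
  obtain ⟨ε, -, -, hε, -⟩ := exists_der_of_surjective hπ (D := 0)
    (fun _ _ => by simp) hI0 (fun _ _ => rfl)
  obtain ⟨x, hx⟩ := h ε
  choose y hy using fun j => hπ (x j)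
  let L : (ι → ℂ) →ₗ[ℂ] (Fin n → ℂ) × (Fin k → ℂ) :=
    LinearMap.prod (LinearMap.pi fun j => ∑ i, (coeffFun A (g i) (y j)) • LinearMap.proj i)
      (LinearMap.pi fun j => ∑ i, (φ j i) • LinearMap.proj i)
  have hker : LinearMap.ker L ≠ ⊥ := LinearMap.ker_ne_bot_of_finrank_lt (by simpa using hn)
  obtain ⟨c, hc, hc0⟩ := (Submodule.ne_bot_iff _).1 hker
  have hL : L c = 0 := hc
  have h1 : ∀ j, ∑ i, coeffFun A (g i) (y j) * c i = 0 := fun j => by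
    simpa [L, LinearMap.sum_apply] using congr_fun (congr_arg Prod.fst hL) j
  have h2 : ∀ j, ∑ i, φ j i * c i = 0 := fun j => by
    simpa [L, LinearMap.sum_apply] using congr_fun (congr_arg Prod.snd hL) j
  let D : A →ₗ[ℂ] ℂ := ∑ i, c i • coeffFun A (g i)
  have hDa : ∀ a, D a = ∑ i, c i * coeff (g i) (a : MvPowerSeries σ ℂ) := fun a => by
    simp [D, LinearMap.sum_apply, coeffFun_apply]
  have hD : IsDer (augmentation A) D := fun a b => by
    simp only [D, LinearMap.sum_apply, LinearMap.smul_apply, hA.isDer_coeffFun (hg _) a b,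
      Finset.mul_sum, ← Finset.sum_add_distrib, smul_eq_mul]
    exact Finset.sum_congr rfl fun i _ => by ring
  obtain ⟨ε', D', hD', hε', hDD⟩ := exists_der_of_surjective hπ hD hI0 fun a ha => by
    rw [hDa]
    exact hI a ha c fun j => by simpa [mul_comm] using h2 j
  obtain rfl : ε = ε' := AlgHom.ext fun a => by
    obtain ⟨a, rfl⟩ := hπ a
    rw [hε, hε']
  have hz : D' = 0 := hx D' hD' fun j => by
    rw [← hy, hDD, hDa]
    simpa [mul_comm, coeffFun_apply] using h1 j
  refine hc0 (funext fun i => ?_)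
  have h3 := hDD (hA.mono (hg i).1)
  rw [hz, hDa, Finset.sum_eq_single i] at h3
  · simpa [IsMonomialRing.mono] using h3.symm
  · intro j _ hj
    rw [IsMonomialRing.mono, coeff_monomial, if_neg (fun h => hj (hinj h)), mul_zero]
  · simp

/-- Typical exponents are those of x², y² and xy: a quotient singularity keeps the relation x²·y² =
(xy)² although xy is part of a system of generators. -/
theorem IsMonomialRing.not_squareProperty (hA : IsMonomialRing A M) {π : A →ₐ[ℂ] R'}
    (hπ : Function.Surjective π)
    {D : A →ₗ[ℂ] ℂ} (hD : IsDer (augmentation A) D) (hI0 : ∀ a, π a = 0 → augmentation A a = 0)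
    (hI : ∀ a, π a = 0 → D a = 0) {u v w : σ →₀ ℕ} (hu : u ∈ M) (hv : v ∈ M) (hw : w ∈ M)
    (hu0 : u ≠ 0)
    (hv0 : v ≠ 0) (hw0 : w ≠ 0) (huv : u + v = w + w) (hDu : D (hA.mono hu) = 0)
    (hDw : D (hA.mono hw) ≠ 0) : ¬ SquareProperty R' := by
  intro h
  obtain ⟨ε, D', hD', hε, hDD⟩ := exists_der_of_surjective hπ hD hI0 hI
  refine hDw ?_
  rw [← hDD]
  refine h _ D' (π (hA.mono hu)) (π (hA.mono hv)) _ hD'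
    (by rw [hε, hA.augmentation_mono hu hu0]) (by rw [hε, hA.augmentation_mono hv hv0])
    (by rw [hε, hA.augmentation_mono hw hw0]) ?_
    (by rw [hDD, hDu])
  rw [← map_mul, ← map_mul]
  congr 1
  refine Subtype.ext ?_
  simp only [IsMonomialRing.mono, MulMemClass.coe_mul, monomial_mul_monomial, huv]

theorem isDominating_single [Fintype σ] :
    IsDominating (Set.univ : Set (σ →₀ ℕ)) fun i : σ => Finsupp.single i 1 := by
  classical
  refine ⟨fun _ => trivial, fun i => by simp, fun m _ hm => ?_⟩
  obtain ⟨i, hi⟩ := Finsupp.ne_iff.1 hm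
  refine ⟨i, Finsupp.single_le_iff.2 ?_⟩
  have : m i ≠ 0 := hi
  omega

/-- Restrict to the line with direction vector D(z). There `u` vanishes to order 2 and `v` to order
1, so w² vanishes to order 3, hence `w` to order 2, which says that D w = 0. -/
theorem squareProperty_convergentSeries [Fintype σ] : SquareProperty (convergentSeries σ) := by
  classical
  intro ε D u v w hD hu hv hw huv hDu
  have hA := isMonomialRing_convergentSeries (σ := σ)
  let z : σ → convergentSeries σ := fun i => hA.mono (isDominating_single.mem i)
  let a : σ → MvPowerSeries Unit ℂ := fun i => MvPowerSeries.C (D (z i)) * PowerSeries.X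
  have ha : HasSubst a := hasSubst_of_constantCoeff_zero fun i => by
    simp [a, PowerSeries.X]
  let ψ : convergentSeries σ →ₐ[ℂ] PowerSeries ℂ :=
    (substAlgHom (R := ℂ) ha).comp (convergentSeries σ).val
  have hψ : ∀ i, ψ (z i) = PowerSeries.C (D (z i)) * PowerSeries.X := fun i => by
    have : ψ (z i) = substAlgHom (R := ℂ) ha (X i) := rfl
    rw [this, substAlgHom_X]
    rfl
  have hε : ∀ f, PowerSeries.constantCoeff (ψ f) = ε f := fun f => by
    rw [hA.constantCoeff_eq, hA.algHom_eq ε]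
  have h1 : ∀ f, ε f = 0 → PowerSeries.coeff 1 (ψ f) = D f := by
    intro f hf
    rw [hA.algHom_eq ε] at hf
    obtain ⟨h, hh⟩ := hA.exists_sum_eq isDominating_single f hf
    rw [hh, map_sum, map_sum, map_sum]
    refine Finset.sum_congr rfl fun i _ => ?_
    have h2 : ε (hA.mono (isDominating_single.mem i)) = 0 := by
      rw [hA.algHom_eq ε]
      exact hA.augmentation_mono _ (isDominating_single.ne_zero i)
    rw [map_mul, hD, h2, zero_mul, zero_add]
    have h3 : ψ (hA.mono (isDominating_single.mem i)) = _ := hψ i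
    rw [h3, mul_assoc, PowerSeries.coeff_C_mul, mul_comm PowerSeries.X,
      PowerSeries.coeff_succ_mul_X, PowerSeries.coeff_zero_eq_constantCoeff_apply, hε, mul_comm]
  have hX : ∀ f, ε f = 0 → PowerSeries.X ∣ ψ f := fun f hf => by
    rw [PowerSeries.X_dvd_iff, hε, hf]
  have hX2 : PowerSeries.X ^ 2 ∣ ψ u := by
    rw [PowerSeries.X_pow_dvd_iff]
    intro m hm
    interval_cases m
    · rw [PowerSeries.coeff_zero_eq_constantCoeff_apply, hε, hu]
    · rw [h1 u hu, hDu]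
  obtain ⟨p, hp⟩ := hX2
  obtain ⟨q, hq⟩ := hX v hv
  obtain ⟨r, hr⟩ := hX w hw
  have h4 : PowerSeries.X * (p * q) = r * r := by
    have := congr_arg ψ huv
    rw [map_mul, map_mul, hp, hq, hr] at this
    refine mul_left_cancel₀ (pow_ne_zero 2 PowerSeries.X_ne_zero) ?_
    linear_combination this
  have h5 : PowerSeries.constantCoeff r = 0 := by
    have := congr_arg PowerSeries.constantCoeff h4
    simpa using this.symm
  rw [← h1 w hw, hr, mul_comm, PowerSeries.coeff_succ_mul_X,
    PowerSeries.coeff_zero_eq_constantCoeff_apply, h5]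

end Quotient

/-! ### An arc along a coordinate axis of transversal singularities. -/

section Slice

variable {σ : Type*} {A : Subalgebra ℂ (MvPowerSeries σ ℂ)} {M : Set (σ →₀ ℕ)} {a b c : σ}

/-- The exponent of `z_a ^ r * z_b ^ n * z_c ^ s`. -/
def expo (a b c : σ) (r n s : ℕ) : σ →₀ ℕ :=
  Finsupp.single a r + Finsupp.single b n + Finsupp.single c s

/-- Pairwise distinctness of three indices. -/
structure Distinct (a b c : σ) : Prop where
  hab : a ≠ b
  hac : a ≠ c
  hbc : b ≠ c

theorem Distinct.expo_a (h : Distinct a b c) (r n s : ℕ) : expo a b c r n s a = r := by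
  simp [expo, h.hab, h.hac]

theorem Distinct.expo_b (h : Distinct a b c) (r n s : ℕ) : expo a b c r n s b = n := by
  simp [expo, h.hbc, h.hab.symm]

theorem Distinct.expo_c (h : Distinct a b c) (r n s : ℕ) : expo a b c r n s c = s := by
  simp [expo, h.hac.symm, h.hbc.symm]

theorem expo_of_ne {j : σ} (ha : j ≠ a) (hb : j ≠ b) (hc : j ≠ c) (r n s : ℕ) :
    expo a b c r n s j = 0 := by
  simp [expo, ha, hb, hc]

theorem Distinct.expo_eq_iff (h : Distinct a b c) {r n s r' n' s' : ℕ} :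
    expo a b c r n s = expo a b c r' n' s' ↔ r = r' ∧ n = n' ∧ s = s' := by
  refine ⟨fun he => ⟨?_, ?_, ?_⟩, by rintro ⟨rfl, rfl, rfl⟩; rfl⟩
  · simpa [h.expo_a] using DFunLike.congr_fun he a
  · simpa [h.expo_b] using DFunLike.congr_fun he b
  · simpa [h.expo_c] using DFunLike.congr_fun he c

theorem Distinct.eq_expo (h : Distinct a b c) {m : σ →₀ ℕ}
    (hm : ∀ j, j ≠ a → j ≠ b → j ≠ c → m j = 0) : m = expo a b c (m a) (m b) (m c) := by
  ext j
  by_cases ha : j = a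
  · rw [ha, h.expo_a]
  by_cases hb : j = b
  · rw [hb, h.expo_b]
  by_cases hc : j = c
  · rw [hc, h.expo_c]
  rw [hm j ha hb hc, expo_of_ne ha hb hc]

theorem expo_add (r n s r' n' s' : ℕ) :
    expo a b c r n s + expo a b c r' n' s' = expo a b c (r + r') (n + n') (s + s') := by
  simp only [expo, Finsupp.single_add]
  abel

/-- The coefficient of `z_a ^ r * z_c ^ s`, as a power series in `z_b`. -/
def slice (a b c : σ) (r s : ℕ) : MvPowerSeries σ ℂ →ₗ[ℂ] PowerSeries ℂ where
  toFun f := PowerSeries.mk fun n => coeff (expo a b c r n s) f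
  map_add' f g := by ext; simp
  map_smul' k f := by ext; simp

theorem coeff_slice (r s n : ℕ) (f : MvPowerSeries σ ℂ) :
    PowerSeries.coeff n (slice a b c r s f) = coeff (expo a b c r n s) f := by
  simp [slice]

theorem Distinct.slice_mul (h : Distinct a b c) (r s : ℕ) (f g : MvPowerSeries σ ℂ) :
    slice a b c r s (f * g) = ∑ p ∈ Finset.HasAntidiagonal.antidiagonal r,
      ∑ q ∈ Finset.HasAntidiagonal.antidiagonal s,
        slice a b c p.1 q.1 f * slice a b c p.2 q.2 g := by
  classical
  ext n
  simp only [map_sum, PowerSeries.coeff_mul, coeff_slice]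
  rw [coeff_mul, ← Finset.sum_product', ← Finset.sum_product']
  refine Finset.sum_bij' (fun p _ => (((p.1 a, p.2 a), (p.1 c, p.2 c)), (p.1 b, p.2 b)))
    (fun q _ => (expo a b c q.1.1.1 q.2.1 q.1.2.1, expo a b c q.1.1.2 q.2.2 q.1.2.2)) ?_ ?_ ?_ ?_ ?_
  · rintro ⟨x, y⟩ hp
    rw [Finset.HasAntidiagonal.mem_antidiagonal] at hp
    have h1 := DFunLike.congr_fun hp a
    have h2 := DFunLike.congr_fun hp b
    have h3 := DFunLike.congr_fun hp c
    simp only [Finsupp.add_apply, h.expo_a, h.expo_b, h.expo_c] at h1 h2 h3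
    simp [h1, h2, h3]
  · rintro ⟨⟨⟨r1, r2⟩, s1, s2⟩, n1, n2⟩ hq
    simp only [Finset.mem_product, Finset.HasAntidiagonal.mem_antidiagonal] at hq ⊢
    rw [expo_add, hq.1.1, hq.1.2, hq.2]
  · rintro ⟨x, y⟩ hp
    rw [Finset.HasAntidiagonal.mem_antidiagonal] at hp
    have h0 : ∀ j, j ≠ a → j ≠ b → j ≠ c → x j = 0 ∧ y j = 0 := fun j ha hb hc => by
      have := DFunLike.congr_fun hp j
      rw [expo_of_ne ha hb hc] at this
      simpa using this
    exact Prod.ext (h.eq_expo fun j ha hb hc => (h0 j ha hb hc).1).symm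
      (h.eq_expo fun j ha hb hc => (h0 j ha hb hc).2).symm
  · rintro ⟨⟨⟨r1, r2⟩, s1, s2⟩, n1, n2⟩ hq
    simp [h.expo_a, h.expo_b, h.expo_c]
  · rintro ⟨x, y⟩ hp
    rw [Finset.HasAntidiagonal.mem_antidiagonal] at hp
    have h0 : ∀ j, j ≠ a → j ≠ b → j ≠ c → x j = 0 ∧ y j = 0 := fun j ha hb hc => by
      have := DFunLike.congr_fun hp j
      rw [expo_of_ne ha hb hc] at this
      simpa using this
    have hx : x = _ := h.eq_expo fun j ha hb hc => (h0 j ha hb hc).1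
    have hy : y = _ := h.eq_expo fun j ha hb hc => (h0 j ha hb hc).2
    dsimp only
    rw [← hx, ← hy]

theorem Distinct.slice_monomial (h : Distinct a b c) (r s r' n' s' : ℕ) :
    slice a b c r s (monomial (expo a b c r' n' s') 1) =
      if r = r' ∧ s = s' then PowerSeries.X ^ n' else 0 := by
  classical
  ext n
  rw [coeff_slice, coeff_monomial, apply_ite (PowerSeries.coeff n), PowerSeries.coeff_X_pow,
    map_zero]
  simp only [h.expo_eq_iff]
  split_ifs <;> first | rfl | (exfalso; tauto)

/-- Restriction to the axis of the coordinate `z_b`. -/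
def Distinct.axis (h : Distinct a b c) : MvPowerSeries σ ℂ →ₐ[ℂ] PowerSeries ℂ :=
  AlgHom.ofLinearMap (slice a b c 0 0)
    (by
      have := h.slice_monomial 0 0 0 0 0
      simpa [expo] using this)
    (fun f g => by simp [h.slice_mul])

theorem Distinct.axis_apply (h : Distinct a b c) (f : MvPowerSeries σ ℂ) :
    h.axis f = slice a b c 0 0 f := rfl

theorem slice_eq_zero (h : Distinct a b c) (hA : IsMonomialRing A M)
    (hM : ∀ m ∈ M, Even (m a + m c)) {r s : ℕ} (hrs : ¬ Even (r + s)) (f : A) :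
    slice a b c r s (f : MvPowerSeries σ ℂ) = 0 := by
  ext n
  rw [coeff_slice, map_zero]
  by_contra hne
  have := hM _ (((hA.mem_iff _).1 f.2).2 _ hne)
  rw [h.expo_a, h.expo_c] at this
  exact hrs this

/-- Terms of odd order in z_a, z_c are absent from `A`, so the cross terms of the product rule in
order 2 vanish. -/
theorem IsMonomialRing.isDer_slice (h : Distinct a b c) (hA : IsMonomialRing A M)
    (hM : ∀ m ∈ M, Even (m a + m c)) {r s : ℕ} (hrs : r + s = 2) :
    IsDer (h.axis.comp A.val) ((slice a b c r s).comp A.val.toLinearMap) := by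
  intro f g
  have h10 := slice_eq_zero h hA hM (r := 1) (s := 0) (by decide)
  have h01 := slice_eq_zero h hA hM (r := 0) (s := 1) (by decide)
  have hr : r ≤ 2 := by omega
  interval_cases r
  · obtain rfl : s = 2 := by omega
    simp [h.slice_mul, h.axis_apply, Finset.Nat.antidiagonal_succ, h01, mul_comm]
  · obtain rfl : s = 1 := by omega
    simp [h.slice_mul, h.axis_apply, Finset.Nat.antidiagonal_succ, h10, h01, mul_comm]
  · obtain rfl : s = 0 := by omega
    simp [h.slice_mul, h.axis_apply, Finset.Nat.antidiagonal_succ, h10, mul_comm]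

theorem IsDer.smul_sum {R B ι : Type*} [CommRing R] [Algebra ℂ R] [CommRing B] [Algebra ℂ B]
    [Fintype ι] {γ : R →ₐ[ℂ] B} {D : ι → R →ₗ[ℂ] B} (hD : ∀ i, IsDer γ (D i)) (k : ι → B) :
    IsDer γ (∑ i, LinearMap.mulLeft ℂ (k i) ∘ₗ D i) := by
  intro x y
  simp only [LinearMap.sum_apply, LinearMap.comp_apply, LinearMap.mulLeft_apply, hD _ x y,
    Finset.mul_sum, ← Finset.sum_add_distrib]
  exact Finset.sum_congr rfl fun i _ => by ring

/-- Along the z_b-axis there are four independent derivations: the three transversal coefficients of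
z_a², z_a z_c, z_c², and d/dz_b. The four monomials in the hypotheses detect them one by one; they
are chosen to be invariant under both μ₂ and μ₄. -/
theorem IsMonomialRing.hasSingularArc (h : Distinct a b c) (hA : IsMonomialRing A M)
    (hM : ∀ m ∈ M, Even (m a + m c)) (h1 : expo a b c 2 1 0 ∈ M) (h2 : expo a b c 1 0 1 ∈ M)
    (h3 : expo a b c 0 1 2 ∈ M) (h4 : expo a b c 0 2 0 ∈ M) : HasSingularArc A := by
  refine ⟨h.axis.comp A.val, ⟨hA.mono h4, fun k hk => ?_⟩, ?_⟩
  · have h5 : slice a b c 0 0 (monomial (expo a b c 0 2 0) 1) = algebraMap ℂ _ k := hk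
    rw [h.slice_monomial, if_pos ⟨rfl, rfl⟩] at h5
    simpa [PowerSeries.coeff_X_pow, PowerSeries.algebraMap_apply, PowerSeries.coeff_C] using
      congr_arg (PowerSeries.coeff 2) h5
  rintro ⟨x, hx⟩
  let D : Fin 4 → A →ₗ[ℂ] PowerSeries ℂ :=
    ![(slice a b c 2 0).comp A.val.toLinearMap, (slice a b c 1 1).comp A.val.toLinearMap,
      (slice a b c 0 2).comp A.val.toLinearMap,
      (PowerSeries.derivative ℂ : PowerSeries ℂ →ₗ[ℂ] PowerSeries ℂ) ∘ₗ
        (h.axis.comp A.val).toLinearMap]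
  have hD : ∀ i, IsDer (h.axis.comp A.val) (D i) := by
    intro i
    fin_cases i
    · exact hA.isDer_slice h hM rfl
    · exact hA.isDer_slice h hM rfl
    · exact hA.isDer_slice h hM rfl
    · intro f g
      simp [D]
  let L : (Fin 4 → PowerSeries ℂ) →ₗ[PowerSeries ℂ] (Fin 3 → PowerSeries ℂ) :=
    LinearMap.pi fun j => ∑ i, (D i (x j)) • LinearMap.proj i
  -- Three conditions on four coefficients in `ℂ[[X]]` have a nonzero solution, so no three elements
  -- determine the derivations.
  have hker : LinearMap.ker L ≠ ⊥ := fun hbot => by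
    have := le_of_fin_injective (PowerSeries ℂ) L (LinearMap.ker_eq_bot.1 hbot)
    omega
  obtain ⟨k, hk, hk0⟩ := (Submodule.ne_bot_iff _).1 hker
  have hL : L k = 0 := hk
  have hz := hx _ (IsDer.smul_sum hD k) fun j => by
    simpa [L, LinearMap.sum_apply, mul_comm] using congr_fun hL j
  have ev : ∀ {r n s : ℕ} (hm : expo a b c r n s ∈ M), ∑ i, k i * D i (hA.mono hm) = 0 :=
    fun hm => by simpa [LinearMap.sum_apply] using LinearMap.congr_fun hz (hA.mono hm)
  have hval : ∀ {r n s : ℕ} (hm : expo a b c r n s ∈ M) (p q : ℕ),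
      slice a b c p q (hA.mono hm : MvPowerSeries σ ℂ) =
        if p = r ∧ q = s then PowerSeries.X ^ n else 0 := fun hm p q => h.slice_monomial _ _ _ _ _
  have e1 := ev h1
  have e2 := ev h2
  have e3 := ev h3
  have e4 := ev h4
  simp [Fin.sum_univ_four, D, hval, h.axis_apply] at e1 e2 e3 e4
  refine hk0 (funext fun i => ?_)
  fin_cases i
  · exact e1
  · exact e2
  · exact e3
  · refine e4.resolve_right fun h2 => ?_
    have := congr_arg PowerSeries.constantCoeff h2
    rw [map_ofNat, map_zero] at this
    exact two_ne_zero this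

end Slice

/-! ### Local rings of weighted projective spaces as monomial rings. -/

section Ambient

variable {n : ℕ}

/-- The exponents of the monomials invariant under the stabilizer. -/
def Point.exponents (w : Fin n → ℕ) (P : Point n) : Set (P.Index →₀ ℕ) :=
  {m | ∀ t ∈ P.stabilizer w, t ^ Finsupp.weight (fun j : P.Index => w j) m = 1}

theorem prod_rescale (w : Fin n → ℕ) (P : Point n) (t : ℂ) (m : P.Index →₀ ℕ) :
    (m.prod fun s k => (t ^ w s) ^ k) = t ^ Finsupp.weight (fun j : P.Index => w j) m := by
  rw [Finsupp.weight_apply, Finsupp.prod, Finsupp.sum, ← Finset.prod_pow_eq_pow_sum]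
  refine Finset.prod_congr rfl fun j _ => ?_
  rw [← pow_mul, smul_eq_mul, mul_comm]

theorem isMonomialRing_ambientRing (w : Fin n → ℕ) (P : Point n) :
    IsMonomialRing (P.ambientRing w) (P.exponents w) where
  mem_iff f := by
    refine and_congr Iff.rfl ?_
    simp only [MvPowerSeries.ext_iff, coeff_rescale, prod_rescale]
    refine ⟨fun h m hm t ht => ?_, fun h t ht m => ?_⟩
    · exact mul_right_cancel₀ hm (by rw [h t ht m, one_mul])
    · by_cases hm : coeff m f = 0
      · simp [hm]
      · rw [h m hm t ht, one_mul]
  zero_mem t _ := by simp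
  add_mem_iff a ha b := by
    refine forall₂_congr fun t ht => ?_
    rw [map_add, pow_add, ha t ht, one_mul]

/-- The projection from the local ring of the ambient space to that of the hypersurface. -/
def Point.proj (w : Fin n → ℕ) (F : MvPolynomial (Fin n) ℂ) (P : Point n) :
    P.ambientRing w →ₐ[ℂ] P.localRing w F :=
  Ideal.Quotient.mkₐ ℂ _

theorem Point.proj_surjective (w : Fin n → ℕ) (F : MvPolynomial (Fin n) ℂ) (P : Point n) :
    Function.Surjective (P.proj w F) :=
  Ideal.Quotient.mkₐ_surjective ℂ _

theorem Point.proj_eq_zero_iff {w : Fin n → ℕ} {F : MvPolynomial (Fin n) ℂ} {P : Point n}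
    {a : P.ambientRing w} : P.proj w F a = 0 ↔
      ∃ k : MvPowerSeries P.Index ℂ, Converges k ∧
        (a : MvPowerSeries P.Index ℂ) = (P.localEquation F : MvPowerSeries P.Index ℂ) * k := by
  refine Ideal.Quotient.eq_zero_iff_mem.trans ?_
  rw [Point.hypersurfaceIdeal, Ideal.mem_comap, Ideal.mem_span_singleton]
  constructor
  · rintro ⟨k, hk⟩
    exact ⟨k, k.2, congr_arg Subtype.val hk⟩
  · rintro ⟨k, hk, h⟩
    exact ⟨⟨k, hk⟩, Subtype.ext h⟩

theorem Point.proj_zero_injective (w : Fin n → ℕ) (P : Point n) :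
    Function.Injective (P.proj w 0) := by
  refine (injective_iff_map_eq_zero _).2 fun a ha => ?_
  obtain ⟨k, -, hk⟩ := Point.proj_eq_zero_iff.1 ha
  refine Subtype.ext ?_
  rw [hk]
  simp [Point.localEquation]

/-- The local ring of the weighted projective space itself. -/
def Point.localRingZeroEquiv (w : Fin n → ℕ) (P : Point n) :
    P.ambientRing w ≃ₐ[ℂ] P.localRing w 0 :=
  AlgEquiv.ofBijective (P.proj w 0) ⟨P.proj_zero_injective w, P.proj_surjective w 0⟩

/-- Testing invariance on a primitive `N`-th root of unity is enough. -/
theorem exponents_eq_of_stabilizer {w : Fin n → ℕ} {P : Point n} {N : ℕ} (hN : N ≠ 0)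
    (h : P.stabilizer w = {t | t ^ N = 1}) (m : P.Index →₀ ℕ) :
    m ∈ P.exponents w ↔ N ∣ Finsupp.weight (fun j : P.Index => w j) m := by
  have hprim := Complex.isPrimitiveRoot_exp N hN
  constructor
  · intro hm
    refine hprim.dvd_of_pow_eq_one _ (hm _ ?_)
    rw [h]
    exact hprim.pow_eq_one
  · rintro ⟨k, hk⟩ t ht
    rw [h] at ht
    have ht' : t ^ N = 1 := ht
    rw [hk, pow_mul, ht', one_pow]

end Ambient

/-! ### Exponent vectors and finite checks of generators. -/

section Vec

theorem vec_ext {σ : Type*} {d : ℕ} (e : Fin d ≃ σ) {m m' : σ →₀ ℕ}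
    (h : ∀ i, m (e i) = m' (e i)) : m = m' := by
  ext j
  simpa using h (e.symm j)

variable {σ : Type*} [Finite σ] {d : ℕ}

/-- The exponent with given components, for an enumeration of the variables. -/
def vec (e : Fin d ≃ σ) (v : Fin d → ℕ) : σ →₀ ℕ := Finsupp.equivFunOnFinite.symm (v ∘ e.symm)

theorem vec_apply (e : Fin d ≃ σ) (v : Fin d → ℕ) (i : Fin d) : vec e v (e i) = v i := by
  simp [vec]

theorem vec_le_iff (e : Fin d ≃ σ) {v : Fin d → ℕ} {m : σ →₀ ℕ} :
    vec e v ≤ m ↔ ∀ i, v i ≤ m (e i) := by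
  rw [Finsupp.le_def, ← e.forall_congr_right]
  simp only [vec_apply]

theorem vec_self (e : Fin d ≃ σ) (m : σ →₀ ℕ) : vec e (fun i => m (e i)) = m :=
  vec_ext e fun i => vec_apply e _ i

theorem vec_injective (e : Fin d ≃ σ) : Function.Injective (vec e) := fun v v' h => by
  ext i
  simpa [vec_apply] using DFunLike.congr_fun h (e i)

theorem vec_zero (e : Fin d ≃ σ) : vec e 0 = 0 := vec_ext e fun i => by simp [vec_apply]

theorem vec_add (e : Fin d ≃ σ) (v v' : Fin d → ℕ) : vec e (v + v') = vec e v + vec e v' :=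
  vec_ext e fun i => by simp [vec_apply]

theorem weight_vec (e : Fin d ≃ σ) (w : σ → ℕ) (v : Fin d → ℕ) :
    Finsupp.weight w (vec e v) = ∑ i, w (e i) * v i := by
  have := Fintype.ofEquiv _ e
  rw [Finsupp.weight_apply, Finsupp.sum_fintype _ _ (by simp), ← e.sum_comp]
  simp [vec_apply, mul_comm]

/-- Every nonzero vector whose weight is divisible by `N` is bounded below by some `G i`. -/
def Covers {ι : Type*} (N : ℕ) (wt : Fin d → ℕ) (G : ι → Fin d → ℕ) : Prop :=
  ∀ v : Fin d → ℕ, N ∣ ∑ i, wt i * v i → v ≠ 0 → ∃ i, G i ≤ v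

theorem isDominating_vec {ι : Type*} (e : Fin d ≃ σ) {M : Set (σ →₀ ℕ)} {N : ℕ} {wt : Fin d → ℕ}
    (hM : ∀ v, vec e v ∈ M ↔ N ∣ ∑ i, wt i * v i) {G : ι → Fin d → ℕ} (hG : Covers N wt G)
    (h1 : ∀ i, N ∣ ∑ j, wt j * G i j) (h0 : ∀ i, G i ≠ 0) :
    IsDominating M fun i => vec e (G i) where
  mem i := (hM _).2 (h1 i)
  ne_zero i h := h0 i (vec_injective e (h.trans (vec_zero e).symm))
  exists_le m hm hm0 := by
    rw [← vec_self e m] at hm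
    obtain ⟨i, hi⟩ := hG _ ((hM _).1 hm) fun h => hm0 (by rw [← vec_self e m, h, vec_zero])
    exact ⟨i, (vec_le_iff e).2 hi⟩

theorem isIrred_vec (e : Fin d ≃ σ) {M : Set (σ →₀ ℕ)} {N : ℕ} {wt : Fin d → ℕ}
    (hM : ∀ v, vec e v ∈ M ↔ N ∣ ∑ i, wt i * v i) {v : Fin d → ℕ} (h1 : N ∣ ∑ j, wt j * v j)
    (h0 : v ≠ 0) (h : ∀ x ≤ v, N ∣ ∑ j, wt j * x j → x = 0 ∨ x = v) : IsIrred M (vec e v) := by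
  refine ⟨(hM v).2 h1, fun hv => h0 (vec_injective e (hv.trans (vec_zero e).symm)),
    fun a ha b hb hab => ?_⟩
  rw [← vec_self e a] at ha
  have hle : (fun i => a (e i)) ≤ v := fun i => by
    rw [← vec_apply e v i, ← hab]
    simp
  rcases h _ hle ((hM _).1 ha) with h | h
  · left
    rw [← vec_self e a, h, vec_zero]
  · right
    rw [← vec_self e a, h] at hab
    simpa using hab

/-- A vector with a component at least `N` lies above a generator bounded by the `N`-th power of
that variable; only vectors with all components below `N` remain, which is decidable. -/
theorem covers_three {ι : Type*} {N : ℕ} {wt : Fin 3 → ℕ} {G : ι → Fin 3 → ℕ}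
    (h0 : ∃ i, ∀ j, G i j ≤ ![N, 0, 0] j) (h1 : ∃ i, ∀ j, G i j ≤ ![0, N, 0] j)
    (h2 : ∃ i, ∀ j, G i j ≤ ![0, 0, N] j)
    (h : ∀ x y z : Fin N, N ∣ wt 0 * x + wt 1 * y + wt 2 * z →
      ((x : ℕ) = 0 ∧ (y : ℕ) = 0 ∧ (z : ℕ) = 0) ∨ ∃ i, G i 0 ≤ x ∧ G i 1 ≤ y ∧ G i 2 ≤ z) :
    Covers N wt G := by
  intro v hv hv0
  simp only [Fin.sum_univ_three] at hv
  by_cases hx : N ≤ v 0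
  · obtain ⟨i, hi⟩ := h0
    exact ⟨i, fun j => (hi j).trans (by fin_cases j <;> simp [hx])⟩
  by_cases hy : N ≤ v 1
  · obtain ⟨i, hi⟩ := h1
    exact ⟨i, fun j => (hi j).trans (by fin_cases j <;> simp [hy])⟩
  by_cases hz : N ≤ v 2
  · obtain ⟨i, hi⟩ := h2
    exact ⟨i, fun j => (hi j).trans (by fin_cases j <;> simp [hz])⟩
  rcases h ⟨v 0, by omega⟩ ⟨v 1, by omega⟩ ⟨v 2, by omega⟩ hv with h | ⟨i, hi⟩
  · dsimp only at h
    exact (hv0 (funext fun j => by fin_cases j <;> simp <;> tauto)).elim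
  · exact ⟨i, fun j => by fin_cases j <;> simp [hi]⟩

theorem covers_four {ι : Type*} {N : ℕ} {wt : Fin 4 → ℕ} {G : ι → Fin 4 → ℕ}
    (h0 : ∃ i, ∀ j, G i j ≤ ![N, 0, 0, 0] j) (h1 : ∃ i, ∀ j, G i j ≤ ![0, N, 0, 0] j)
    (h2 : ∃ i, ∀ j, G i j ≤ ![0, 0, N, 0] j) (h3 : ∃ i, ∀ j, G i j ≤ ![0, 0, 0, N] j)
    (h : ∀ x y z u : Fin N, N ∣ wt 0 * x + wt 1 * y + wt 2 * z + wt 3 * u →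
      ((x : ℕ) = 0 ∧ (y : ℕ) = 0 ∧ (z : ℕ) = 0 ∧ (u : ℕ) = 0) ∨
        ∃ i, G i 0 ≤ x ∧ G i 1 ≤ y ∧ G i 2 ≤ z ∧ G i 3 ≤ u) : Covers N wt G := by
  intro v hv hv0
  simp only [Fin.sum_univ_four] at hv
  by_cases hx : N ≤ v 0
  · obtain ⟨i, hi⟩ := h0
    exact ⟨i, fun j => (hi j).trans (by fin_cases j <;> simp [hx])⟩
  by_cases hy : N ≤ v 1
  · obtain ⟨i, hi⟩ := h1
    exact ⟨i, fun j => (hi j).trans (by fin_cases j <;> simp [hy])⟩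
  by_cases hz : N ≤ v 2
  · obtain ⟨i, hi⟩ := h2
    exact ⟨i, fun j => (hi j).trans (by fin_cases j <;> simp [hz])⟩
  by_cases hu : N ≤ v 3
  · obtain ⟨i, hi⟩ := h3
    exact ⟨i, fun j => (hi j).trans (by fin_cases j <;> simp [hu])⟩
  rcases h ⟨v 0, by omega⟩ ⟨v 1, by omega⟩ ⟨v 2, by omega⟩ ⟨v 3, by omega⟩ hv with h | ⟨i, hi⟩
  · dsimp only at h
    exact (hv0 (funext fun j => by fin_cases j <;> simp <;> tauto)).elim
  · exact ⟨i, fun j => by fin_cases j <;> simp [hi]⟩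

/-- The enumeration of the local coordinates at a point. -/
def Point.enum {n : ℕ} (P : Point (n + 1)) : Fin n ≃ P.Index :=
  finSuccAboveEquiv P.chart

theorem Point.vec_mem_exponents {n : ℕ} {w : Fin (n + 1) → ℕ} {P : Point (n + 1)} {N : ℕ}
    (hN : N ≠ 0) (h : P.stabilizer w = {t | t ^ N = 1}) (v : Fin n → ℕ) :
    vec P.enum v ∈ P.exponents w ↔ N ∣ ∑ i, w (P.chart.succAbove i) * v i := by
  rw [exponents_eq_of_stabilizer hN h, weight_vec]
  rfl

end Vec

/-! ### The types of germs on `ℙ(1,2,4,7)`. -/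

/-- Exponents of the generators of the invariants of `μ₇` with weights `1, 2, 4`. -/
def gens7 : Fin 13 → Fin 3 → ℕ :=
  ![![7, 0, 0], ![0, 7, 0], ![0, 0, 7], ![1, 1, 1], ![5, 1, 0], ![3, 2, 0], ![1, 3, 0],
    ![3, 0, 1], ![2, 0, 3], ![1, 0, 5], ![0, 5, 1], ![0, 3, 2], ![0, 1, 3]]

theorem covers_gens7 : Covers 7 ![1, 2, 4] gens7 := by
  refine covers_three ⟨0, by decide⟩ ⟨1, by decide⟩ ⟨2, by decide⟩ ?_
  decide

theorem gens7_irred : ∀ i, ∀ x ≤ gens7 i, 7 ∣ ∑ j, ![1, 2, 4] j * x j → x = 0 ∨ x = gens7 i := by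
  have key : ∀ i, ∀ (x : Fin (gens7 i 0 + 1)) (y : Fin (gens7 i 1 + 1)) (z : Fin (gens7 i 2 + 1)),
      7 ∣ (x : ℕ) + 2 * y + 4 * z → ((x : ℕ) = 0 ∧ (y : ℕ) = 0 ∧ (z : ℕ) = 0) ∨
        ((x : ℕ) = gens7 i 0 ∧ (y : ℕ) = gens7 i 1 ∧ (z : ℕ) = gens7 i 2) := by
    decide
  intro i x hx hd
  rcases key i ⟨x 0, Nat.lt_succ_of_le (hx 0)⟩ ⟨x 1, Nat.lt_succ_of_le (hx 1)⟩
    ⟨x 2, Nat.lt_succ_of_le (hx 2)⟩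
    (by simpa [Fin.sum_univ_three] using hd) with h | h
  · dsimp only at h
    exact Or.inl (funext fun j => by fin_cases j <;> simp <;> tauto)
  · dsimp only at h
    exact Or.inr (funext fun j => by fin_cases j <;> simp <;> tauto)

/-- Exponents of the generators of the invariants of `μ₄` with weights `1, 2, 3`. -/
def gens4 : Fin 6 → Fin 3 → ℕ :=
  ![![4, 0, 0], ![0, 2, 0], ![0, 0, 4], ![1, 0, 1], ![2, 1, 0], ![0, 1, 2]]

/-- Exponents of the generators of the invariants of `μ₂` with weights `1, 0, 1`. -/
def gens2 : Fin 4 → Fin 3 → ℕ := ![![2, 0, 0], ![0, 1, 0], ![0, 0, 2], ![1, 0, 1]]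

theorem covers_gens4 : Covers 4 ![1, 2, 7] gens4 :=
  covers_three ⟨0, by decide⟩ ⟨1, by decide⟩ ⟨2, by decide⟩ (by decide)

theorem covers_gens2 {k : ℕ} (hk : 2 ∣ k) : Covers 2 ![1, k, 7] gens2 := by
  refine covers_three ⟨0, by decide⟩ ⟨1, by decide⟩ ⟨2, by decide⟩ ?_
  obtain ⟨k, rfl⟩ := hk
  intro x y z h
  have h1 : 2 ∣ (x : ℕ) + 7 * z := by
    have h2 : 2 ∣ (x : ℕ) + 2 * k * y + 7 * z := by simpa using h
    have h3 : 2 * k * y = 2 * (k * y) := by ring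
    rw [h3] at h2
    omega
  revert h1
  clear h
  revert x y z
  decide

theorem Point.isDominating {n : ℕ} {w : Fin (n + 1) → ℕ} {P : Point (n + 1)} {N : ℕ} {ι : Type*}
    (hN : N ≠ 0) (h : P.stabilizer w = {t | t ^ N = 1}) {wt : Fin n → ℕ}
    (hwt : ∀ i, w (P.chart.succAbove i) = wt i) {G : ι → Fin n → ℕ} (hG : Covers N wt G)
    (h1 : ∀ i, N ∣ ∑ j, wt j * G i j) (h0 : ∀ i, G i ≠ 0) :
    IsDominating (P.exponents w) fun i => vec P.enum (G i) :=
  isDominating_vec P.enum (fun v => by simp only [Point.vec_mem_exponents hN h, hwt]) hG h1 h0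

theorem Point.edimLE {n : ℕ} {w : Fin (n + 1) → ℕ} {P : Point (n + 1)} {N : ℕ} {ι : Type*}
    [Fintype ι] (F : MvPolynomial (Fin (n + 1)) ℂ)
    (hN : N ≠ 0) (h : P.stabilizer w = {t | t ^ N = 1}) {wt : Fin n → ℕ}
    (hwt : ∀ i, w (P.chart.succAbove i) = wt i) {G : ι → Fin n → ℕ} (hG : Covers N wt G)
    (h1 : ∀ i, N ∣ ∑ j, wt j * G i j) (h0 : ∀ i, G i ≠ 0) :
    EdimLE (P.localRing w F) (Fintype.card ι) :=
  (isMonomialRing_ambientRing w P).edimLE (P.proj_surjective w F)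
    (Point.isDominating hN h hwt hG h1 h0)

theorem stabilizer_eq_of_forall {n : ℕ} {w : Fin n → ℕ} {P : Point n} {N : ℕ} (hN : N ≠ 0)
    (h1 : ∀ t : ℂ, t ^ N = 1 → ∀ j, P.coord j ≠ 0 → t ^ w j = 1)
    (h2 : ∀ t : ℂ, t ≠ 0 → (∀ j, P.coord j ≠ 0 → t ^ w j = 1) → t ^ N = 1) :
    P.stabilizer w = {t | t ^ N = 1} := by
  ext t
  have key : ∀ j, t ^ w j * P.coord j = P.coord j ↔ (P.coord j ≠ 0 → t ^ w j = 1) := fun j => by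
    by_cases hj : P.coord j = 0
    · simp [hj]
    · simp [hj]
  simp only [Point.stabilizer, Set.mem_ofPred_eq, key]
  refine ⟨fun h => h2 t h.1 h.2, fun h => ⟨?_, h1 t h⟩⟩
  rintro rfl
  rw [zero_pow hN] at h
  exact zero_ne_one h

/-- The stabilizer consists of the roots of unity whose order divides the gcd of the weights of the
nonzero coordinates. The trivial group is written with exponent 1 so that the general lemmas apply
to it. -/
theorem stabilizer_cases (Q : Point 4) :
    Q.stabilizer w₄ = {t | t ^ 1 = 1} ∨ (Q.chart = 3 ∧ Q.stabilizer w₄ = {t | t ^ 7 = 1}) ∨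
      ((Q.chart = 1 ∨ Q.chart = 2) ∧ Q.stabilizer w₄ = {t | t ^ 2 = 1}) ∨
      (Q.chart = 2 ∧ Q.stabilizer w₄ = {t | t ^ 4 = 1}) := by
  have hc : Q.coord Q.chart ≠ 0 := by rw [Q.coord_chart]; exact one_ne_zero
  have w0 : w₄ 0 = 1 := rfl
  have w1 : w₄ 1 = 2 := rfl
  have w2 : w₄ 2 = 4 := rfl
  have w3 : w₄ 3 = 7 := rfl
  have triv : (∀ t : ℂ, t ≠ 0 → (∀ j, Q.coord j ≠ 0 → t ^ w₄ j = 1) → t ^ 1 = 1) →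
      Q.stabilizer w₄ = {t | t ^ 1 = 1} := fun h =>
    stabilizer_eq_of_forall one_ne_zero (fun t ht j _ => by simp [(pow_one t).symm.trans ht]) h
  by_cases h0 : Q.coord 0 = 0
  swap
  · exact Or.inl (triv fun t _ ht => ht 0 h0)
  by_cases h3 : Q.coord 3 = 0
  · right; right
    by_cases h1 : Q.coord 1 = 0
    · right
      have hch : Q.chart = 2 := by
        generalize Q.chart = i at hc
        fin_cases i
        · exact (hc h0).elim
        · exact (hc h1).elim
        · rfl
        · exact (hc h3).elim
      refine ⟨hch, stabilizer_eq_of_forall (by norm_num) (fun t ht j hj => ?_) fun t _ ht => ?_⟩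
      · fin_cases j
        · exact (hj h0).elim
        · exact (hj h1).elim
        · exact ht
        · exact (hj h3).elim
      · exact ht 2 (hch ▸ hc)
    · left
      refine ⟨?_, stabilizer_eq_of_forall (by norm_num) (fun t ht j hj => ?_) fun t _ ht => ?_⟩
      · generalize Q.chart = i at hc
        fin_cases i
        · exact (hc h0).elim
        · exact Or.inl rfl
        · exact Or.inr rfl
        · exact (hc h3).elim
      · fin_cases j
        · exact (hj h0).elim
        · exact ht
        · change t ^ 4 = 1
          rw [show (4 : ℕ) = 2 * 2 from rfl, pow_mul, ht, one_pow]
        · exact (hj h3).elim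
      · exact ht 1 h1
  by_cases h1 : Q.coord 1 = 0
  swap
  · refine Or.inl (triv fun t _ ht => ?_)
    have e1 : t ^ 2 = 1 := ht 1 h1
    have e2 : t ^ 7 = 1 := ht 3 h3
    have e3 : t ^ 7 = (t ^ 2) ^ 3 * t := by ring
    rw [e2, e1, one_pow, one_mul] at e3
    rw [pow_one, ← e3]
  by_cases h2 : Q.coord 2 = 0
  swap
  · refine Or.inl (triv fun t _ ht => ?_)
    have e1 : t ^ 4 = 1 := ht 2 h2
    have e2 : t ^ 7 = 1 := ht 3 h3
    have e3 : (t ^ 4) ^ 2 = t ^ 7 * t := by ring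
    rw [e2, e1, one_pow, one_mul] at e3
    rw [pow_one, ← e3]
  right; left
  have hch : Q.chart = 3 := by
    generalize Q.chart = i at hc
    fin_cases i
    · exact (hc h0).elim
    · exact (hc h1).elim
    · exact (hc h2).elim
    · rfl
  refine ⟨hch, stabilizer_eq_of_forall (by norm_num) (fun t ht j hj => ?_) fun t _ ht => ?_⟩
  · fin_cases j
    · exact (hj h0).elim
    · exact (hj h1).elim
    · exact (hj h2).elim
    · exact ht
  · exact ht 3 h3

theorem vec_three {σ : Type*} [Finite σ] (e : Fin 3 ≃ σ) (v : Fin 3 → ℕ) :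
    vec e v = expo (e 0) (e 1) (e 2) (v 0) (v 1) (v 2) := by
  refine vec_ext e fun i => ?_
  rw [vec_apply]
  fin_cases i <;> simp [expo, e.injective.eq_iff]

/-- The arc is the axis of the coordinate of even weight `k`, in coordinates of weights 1, k, 7. The
divisibility hypotheses are the invariance of the test monomials z_b², z_a² z_b, z_b z_c² and z_a
z_c, for `N` equal to 2 or 4. -/
theorem Point.hasSingularArc {w : Fin 4 → ℕ} {P : Point 4} {N : ℕ} (hN : N ≠ 0)
    (h : P.stabilizer w = {t | t ^ N = 1}) (hN2 : 2 ∣ N) {k : ℕ} (hk : 2 ∣ k)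
    (hk2 : N ∣ 2 * k) (hN4 : N ∣ 2 + k) (hN14 : N ∣ k + 14)
    (hwt : ∀ i, w (P.chart.succAbove i) = ![1, k, 7] i) (hN8 : N ∣ 8) :
    HasSingularArc (P.localRing w 0) := by
  have hM : ∀ x y z, expo (P.enum 0) (P.enum 1) (P.enum 2) x y z ∈ P.exponents w ↔
      N ∣ x + k * y + 7 * z := fun x y z => by
    have h1 := vec_three P.enum ![x, y, z]
    have h2 := Point.vec_mem_exponents hN h ![x, y, z]
    rw [h1] at h2
    simp only [Fin.sum_univ_three, hwt] at h2
    exact h2.trans (by simp)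
  have hd : Distinct (P.enum 0) (P.enum 1) (P.enum 2) :=
    ⟨by simp [P.enum.injective.eq_iff], by simp [P.enum.injective.eq_iff],
      by simp [P.enum.injective.eq_iff]⟩
  refine HasSingularArc.of_equiv (P.localRingZeroEquiv w).symm
    (IsMonomialRing.hasSingularArc hd (isMonomialRing_ambientRing w P) (fun m hm => ?_) ?_ ?_ ?_ ?_)
  · have hm' : m = expo (P.enum 0) (P.enum 1) (P.enum 2) (m (P.enum 0)) (m (P.enum 1))
        (m (P.enum 2)) := by
      rw [← vec_three P.enum fun i => m (P.enum i), vec_self]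
    rw [hm', hM] at hm
    obtain ⟨k, rfl⟩ := hk
    have h1 := hN2.trans hm
    have h3 : 2 * k * m (P.enum 1) = 2 * (k * m (P.enum 1)) := by ring
    rw [h3] at h1
    rw [Nat.even_iff]
    omega
  · rw [hM]
    simpa using hN4
  · rw [hM]
    simpa using hN8
  · rw [hM]
    simpa using hN14
  · rw [hM]
    simpa [mul_comm] using hk2

/-- The invariants of the local rings of `ℙ(1,2,4,7)`. -/
theorem localRing_w₄_cases (Q : Point 4) :
    (EdimLE (Q.localRing w₄ 0) 6 ∧
      (SquareProperty (Q.localRing w₄ 0) ∨ HasSingularArc (Q.localRing w₄ 0))) ∨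
      (EdimLE (Q.localRing w₄ 0) 13 ∧ ¬ EdimLE (Q.localRing w₄ 0) 12) := by
  have mapped : ∀ {c : Fin 4}, Q.chart = c → ∀ wt : Fin 3 → ℕ,
      (∀ i, w₄ (c.succAbove i) = wt i) → ∀ i, w₄ (Q.chart.succAbove i) = wt i := by
    rintro _ rfl wt h
    exact h
  rcases stabilizer_cases Q with h | ⟨hc, h⟩ | ⟨hc, h⟩ | ⟨hc, h⟩
  -- Trivial stabilizer: the ring is that of all convergent series.
  · left
    have hexp : Q.exponents w₄ = Set.univ := by
      ext m
      simp [exponents_eq_of_stabilizer one_ne_zero h]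
    have hA : Q.ambientRing w₄ = convergentSeries Q.Index := by
      ext f
      rw [(isMonomialRing_ambientRing w₄ Q).mem_iff, isMonomialRing_convergentSeries.mem_iff, hexp]
    have hdom : IsDominating (Q.exponents w₄) fun i : Q.Index => Finsupp.single i 1 := by
      rw [hexp]
      exact isDominating_single
    refine ⟨((isMonomialRing_ambientRing w₄ Q).edimLE (Q.proj_surjective w₄ 0) hdom).mono ?_,
      Or.inl ?_⟩
    · rw [Fintype.card_congr Q.enum.symm, Fintype.card_fin]
      norm_num
    · exact SquareProperty.of_equiv ((Q.localRingZeroEquiv w₄).symm.trans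
        (Subalgebra.equivOfEq _ _ hA)) squareProperty_convergentSeries
  · right
    have hwt := mapped hc ![1, 2, 4] (by decide)
    refine ⟨Point.edimLE 0 (by norm_num) h hwt covers_gens7 (by decide) (by decide), ?_⟩
    -- All 13 generators are irreducible and there is no relation (`k := 0`), so 12 elements cannot
    -- suffice.
    refine (isMonomialRing_ambientRing w₄ Q).not_edimLE (Q.proj_surjective w₄ 0)
      (g := fun i => vec Q.enum (gens7 i)) (k := 0) (fun i => ?_) ?_ Fin.elim0 (by simp) ?_ ?_
    · refine isIrred_vec Q.enum (N := 7) (wt := ![1, 2, 4]) (fun v => ?_) ?_ ?_ (gens7_irred i)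
      · simp only [Point.vec_mem_exponents (by norm_num) h, hwt]
      · revert i; decide
      · revert i; decide
    · exact (vec_injective Q.enum).comp (by decide)
    · intro a ha
      rw [(map_eq_zero_iff _ (Q.proj_zero_injective w₄)).1 ha, map_zero]
    · intro a ha c _
      rw [(map_eq_zero_iff _ (Q.proj_zero_injective w₄)).1 ha]
      simp
  · left
    rcases hc with hc | hc
    · have hwt := mapped hc ![1, 4, 7] (by decide)
      exact ⟨(Point.edimLE 0 (by norm_num) h hwt (covers_gens2 (by norm_num)) (by decide)
        (by decide)).mono (by simp), Or.inr (Point.hasSingularArc (by norm_num) h (by norm_num)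
        (by norm_num) (by norm_num) (by norm_num) (by norm_num) hwt (by norm_num))⟩
    · have hwt := mapped hc ![1, 2, 7] (by decide)
      exact ⟨(Point.edimLE 0 (by norm_num) h hwt (covers_gens2 (by norm_num)) (by decide)
        (by decide)).mono (by simp), Or.inr (Point.hasSingularArc (by norm_num) h (by norm_num)
        (by norm_num) (by norm_num) (by norm_num) (by norm_num) hwt (by norm_num))⟩
  · left
    have hwt := mapped hc ![1, 2, 7] (by decide)
    exact ⟨(Point.edimLE 0 (by norm_num) h hwt covers_gens4 (by decide)
      (by decide)).mono (by simp), Or.inr (Point.hasSingularArc (by norm_num) h (by norm_num)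
      (by norm_num) (by norm_num) (by norm_num) (by norm_num) hwt (by norm_num))⟩

end LocalAlgebra

section Hypersurface

open MvPolynomial

/-! ### The equation of a hypersurface at a coordinate vertex. -/

section Vertex

variable {n : ℕ}

theorem Point.coeff_zero_localEquation (P : Point n) (F : MvPolynomial (Fin n) ℂ) :
    coeff 0 (P.localEquation F) = eval P.coord F := by
  rw [← constantCoeff_eq]
  have : ((constantCoeff (R := ℂ) (σ := P.Index)).comp
      (aeval (R := ℂ) (fun j => if h : j = P.chart then (1 : MvPolynomial P.Index ℂ) else
        X ⟨j, h⟩ + C (P.coord j))).toRingHom) = eval P.coord := by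
    refine ringHom_ext (fun c => by simp) fun j => ?_
    by_cases h : j = P.chart
    · subst h
      simp [P.coord_chart]
    · simp [h]
  exact RingHom.congr_fun this F

/-- The point all of whose homogeneous coordinates but the `i`-th vanish. -/
def vertex (i : Fin n) : Point n := ⟨i, Pi.single i 1, by simp⟩

theorem stabilizer_vertex {w : Fin n → ℕ} (i : Fin n) (hi : w i ≠ 0) :
    (vertex i).stabilizer w = {t | t ^ w i = 1} := by
  refine stabilizer_eq_of_forall hi (fun t ht j hj => ?_) fun t _ ht => ht i (by simp [vertex])
  rcases eq_or_ne j i with rfl | h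
  · exact ht
  · simp [vertex, h] at hj

/-- The exponents of the variables other than the one of the chart. -/
def Point.restrict (P : Point n) (m : Fin n →₀ ℕ) : P.Index →₀ ℕ :=
  m.subtypeDomain (· ≠ P.chart)

theorem localEquation_vertex_monomial (i : Fin n) (m : Fin n →₀ ℕ) (c : ℂ) :
    (vertex i).localEquation (monomial m c) = monomial ((vertex i).restrict m) c := by
  classical
  rw [Point.localEquation, aeval_monomial, monomial_eq (s := (vertex i).restrict m),
    algebraMap_eq]
  congr 1
  rw [Finsupp.prod_fintype _ _ (by simp), Finsupp.prod_fintype _ _ (by simp)]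
  have h1 : ∀ j : Fin n, (if h : j = (vertex i).chart then (1 : MvPolynomial (vertex i).Index ℂ)
      else X ⟨j, h⟩ + C ((vertex i).coord j)) ^ m j =
        if h : j ≠ (vertex i).chart then X ⟨j, h⟩ ^ m j else 1 := by
    intro j
    by_cases h : j = (vertex i).chart
    · simp [h]
    · have h' : j ≠ i := h
      have h0 : (vertex i).coord j = 0 := by simp [vertex, h']
      rw [dif_neg h, dif_pos h, h0, C_0, add_zero]
  simp only [h1]
  rw [Finset.prod_dite]
  simp only [Finset.prod_const_one, mul_one]
  refine Finset.prod_bij' (fun j _ => ⟨j.1, (Finset.mem_filter.1 j.2).2⟩)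
    (fun j _ => ⟨j.1, by simp [j.2]⟩) ?_ ?_ ?_ ?_ ?_
  all_goals simp [Point.restrict]

theorem coeff_localEquation_vertex (i : Fin n) (F : MvPolynomial (Fin n) ℂ)
    (k : (vertex i).Index →₀ ℕ) : coeff k ((vertex i).localEquation F) =
      ∑ m ∈ F.support, if (vertex i).restrict m = k then coeff m F else 0 := by
  classical
  have h1 : (vertex i).localEquation F =
      ∑ m ∈ F.support, (vertex i).localEquation (monomial m (coeff m F)) := by
    conv_lhs => rw [F.as_sum]
    simp only [Point.localEquation, map_sum]
  rw [h1, coeff_sum]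
  refine Finset.sum_congr rfl fun m _ => ?_
  rw [localEquation_vertex_monomial, coeff_monomial]

theorem Point.weight_restrict (w : Fin n → ℕ) (P : Point n) (m : Fin n →₀ ℕ) :
    Finsupp.weight w m =
      Finsupp.weight (fun j : P.Index => w j) (P.restrict m) + m P.chart * w P.chart := by
  classical
  rw [Finsupp.weight_apply, Finsupp.weight_apply, Finsupp.sum_fintype _ _ (by simp),
    Finsupp.sum_fintype _ _ (by simp)]
  have := Fintype.sum_subtype_add_sum_subtype (· ≠ P.chart) (fun j => m j • w j)
  rw [← this]
  congr 1
  rw [Fintype.sum_eq_single ⟨P.chart, by simp⟩]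
  · simp
  · rintro ⟨j, hj⟩ h
    exact (h (Subtype.ext (not_not.1 hj))).elim

theorem exists_of_coeff_localEquation_ne_zero {i : Fin n} {F : MvPolynomial (Fin n) ℂ}
    {k : (vertex i).Index →₀ ℕ} (h : coeff k ((vertex i).localEquation F) ≠ 0) :
    ∃ m, coeff m F ≠ 0 ∧ (vertex i).restrict m = k := by
  rw [coeff_localEquation_vertex] at h
  obtain ⟨m, hm, h⟩ := Finset.exists_ne_zero_of_sum_ne_zero h
  exact ⟨m, mem_support_iff.1 hm, (ite_ne_right_iff.1 h).1⟩

/-- Setting y_i = 1 merges no monomials, since the weight recovers the exponent of y_i. -/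
theorem coeff_localEquation_restrict {w : Fin n → ℕ} {i : Fin n} (hi : w i ≠ 0)
    {F : MvPolynomial (Fin n) ℂ} {d : ℕ} (hF : F.IsWeightedHomogeneous w d) {m : Fin n →₀ ℕ}
    (hm : Finsupp.weight w m = d) :
    coeff ((vertex i).restrict m) ((vertex i).localEquation F) = coeff m F := by
  classical
  rw [coeff_localEquation_vertex]
  have key : ∀ m' ∈ F.support, (vertex i).restrict m' = (vertex i).restrict m → m' = m := by
    intro m' hm' h
    have h1 : Finsupp.weight w m' = d := hF (mem_support_iff.1 hm')
    rw [← hm, (vertex i).weight_restrict w m', (vertex i).weight_restrict w m, h] at h1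
    have h2 : m' i = m i := Nat.eq_of_mul_eq_mul_right (Nat.pos_of_ne_zero hi)
      (Nat.add_left_cancel h1)
    ext j
    rcases eq_or_ne j i with rfl | hj
    · exact h2
    · exact DFunLike.congr_fun h (⟨j, hj⟩ : (vertex i).Index)
  by_cases hmF : m ∈ F.support
  · rw [Finset.sum_eq_single m, if_pos rfl]
    · intro m' hm' hne
      rw [if_neg fun h => hne (key m' hm' h)]
    · exact fun h => (h hmF).elim
  · rw [Finset.sum_eq_zero fun m' hm' => if_neg fun h => hmF (key m' hm' h ▸ hm'),
      notMem_support_iff.1 hmF]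

theorem localEquation_vertex_mem {w : Fin n → ℕ} {i : Fin n} (hi : w i ≠ 0)
    {F : MvPolynomial (Fin n) ℂ} {d : ℕ} (hF : F.IsWeightedHomogeneous w d) (hd : w i ∣ d) :
    ((vertex i).localEquation F : MvPowerSeries (vertex i).Index ℂ) ∈ (vertex i).ambientRing w := by
  rw [(isMonomialRing_ambientRing w _).mem_iff]
  refine ⟨converges_coe _, fun k hk => ?_⟩
  rw [coeff_coe] at hk
  obtain ⟨m, hm, rfl⟩ := exists_of_coeff_localEquation_ne_zero hk
  rw [exponents_eq_of_stabilizer hi (stabilizer_vertex i hi)]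
  have h1 := (vertex i).weight_restrict w m
  rw [hF hm] at h1
  rw [h1] at hd
  exact (Nat.dvd_add_left (dvd_mul_left (w i) (m i))).1 hd

end Vertex

/-! ### Criteria for singular points and for types that do not occur. -/

theorem isSingularPoint_of_not_squareProperty {n : ℕ} {w : Fin n → ℕ} {F : MvPolynomial (Fin n) ℂ}
    {P : Point n} (h0 : eval P.coord F = 0) (h : ¬ SquareProperty (P.localRing w F)) :
    IsSingularPoint w F P :=
  ⟨h0, fun _ => ⟨fun e => h (SquareProperty.of_equiv e squareProperty_convergentSeries)⟩⟩

theorem TypeOccurs.cases {F : MvPolynomial (Fin 5) ℂ} {P : Point 5} (h : TypeOccurs F P) :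
    (EdimLE (P.localRing w₅ F) 6 ∧
      (SquareProperty (P.localRing w₅ F) ∨ HasSingularArc (P.localRing w₅ F))) ∨
      (EdimLE (P.localRing w₅ F) 13 ∧ ¬ EdimLE (P.localRing w₅ F) 12) := by
  obtain ⟨Q, -, ⟨e⟩⟩ := h
  rcases localRing_w₄_cases Q with ⟨h1, h2⟩ | ⟨h1, h2⟩
  · refine Or.inl ⟨h1.of_equiv e, ?_⟩
    exact h2.imp (SquareProperty.of_equiv e) (HasSingularArc.of_equiv e)
  · exact Or.inr ⟨h1.of_equiv e, fun h => h2 (h.of_equiv e.symm)⟩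

theorem restrict_enum {n : ℕ} (P : Point (n + 1)) (m : Fin (n + 1) →₀ ℕ) (i : Fin n) :
    P.restrict m (P.enum i) = m (P.chart.succAbove i) := rfl

/-- An invariant of the least possible positive weight `N` cannot be a product of two nontrivial
ones. -/
theorem irred_of_weight_eq {d N : ℕ} {wt : Fin d → ℕ} (hwt : ∀ i, wt i ≠ 0) {v : Fin d → ℕ}
    (hv : ∑ i, wt i * v i = N) {x : Fin d → ℕ} (hx : x ≤ v) (hN : N ∣ ∑ i, wt i * x i) :
    x = 0 ∨ x = v := by
  have hle : ∀ i ∈ Finset.univ, wt i * x i ≤ wt i * v i := fun i _ => Nat.mul_le_mul_left _ (hx i)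
  rcases Nat.eq_zero_or_pos (∑ i, wt i * x i) with h | h
  · left
    ext i
    simpa [hwt i] using Finset.sum_eq_zero_iff.1 h i (Finset.mem_univ i)
  · right
    have h1 : ∑ i, wt i * x i = ∑ i, wt i * v i :=
      le_antisymm (Finset.sum_le_sum hle) (hv.trans_le (Nat.le_of_dvd h hN))
    ext i
    exact Nat.eq_of_mul_eq_mul_left (Nat.pos_of_ne_zero (hwt i))
      ((Finset.sum_eq_sum_iff_of_le hle).1 h1 i (Finset.mem_univ i))

theorem vertex_mem_exponents {n : ℕ} {w : Fin (n + 1) → ℕ} {i : Fin (n + 1)} (hi : w i ≠ 0)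
    {wt : Fin n → ℕ} (hwt : ∀ j, w (i.succAbove j) = wt j) (v : Fin n → ℕ) :
    vec (vertex i).enum v ∈ (vertex i).exponents w ↔ w i ∣ ∑ j, wt j * v j := by
  rw [Point.vec_mem_exponents hi (stabilizer_vertex i hi)]
  simp only [← hwt]
  rfl

theorem weight_w₅ (m : Fin 5 →₀ ℕ) :
    Finsupp.weight w₅ m = m 0 + m 1 + 2 * m 2 + 4 * m 3 + 7 * m 4 := by
  rw [Finsupp.weight_apply, Finsupp.sum_fintype _ _ (by simp), Fin.sum_univ_five]
  simp [w₅]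
  ring

theorem Point.not_edimLE {n : ℕ} {w : Fin n → ℕ} {F : MvPolynomial (Fin n) ℂ} (P : Point n)
    {ι : Type*} [Fintype ι] {g : ι → P.Index →₀ ℕ} (hg : ∀ i, IsIrred (P.exponents w) (g i))
    (hinj : Function.Injective g) {l k : ℕ} (φ : Fin k → ι → ℂ) (hn : l + k < Fintype.card ι)
    (hI0 : ∀ a, P.proj w F a = 0 → augmentation _ a = 0)
    (hI : ∀ a, P.proj w F a = 0 → ∀ c : ι → ℂ, (∀ j, ∑ i, c i * φ j i = 0) →
      ∑ i, c i * MvPowerSeries.coeff (g i) (a : MvPowerSeries P.Index ℂ) = 0) :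
    ¬ EdimLE (P.localRing w F) l :=
  (isMonomialRing_ambientRing w P).not_edimLE (P.proj_surjective w F) hg hinj φ hn hI0 hI

theorem Point.edimLE_of_mem {n : ℕ} {w : Fin n → ℕ} {F : MvPolynomial (Fin n) ℂ} (P : Point n)
    {ι : Type*} [Fintype ι] [DecidableEq ι] {g : ι → P.Index →₀ ℕ}
    (hg : IsDominating (P.exponents w) g) (hinj : Function.Injective g) {f : P.ambientRing w}
    (hf : P.proj w F f = 0) (hf0 : augmentation _ f = 0) {i₀ : ι}
    (hi₀ : IsIrred (P.exponents w) (g i₀))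
    (hfi : MvPowerSeries.coeff (g i₀) (f : MvPowerSeries P.Index ℂ) ≠ 0) :
    EdimLE (P.localRing w F) (Fintype.card {i // i ≠ i₀}) :=
  (isMonomialRing_ambientRing w P).edimLE_of_mem (P.proj_surjective w F) hg hinj hf hf0 hi₀ hfi

theorem not_typeOccurs_of_not_edimLE {F : MvPolynomial (Fin 5) ℂ} {P : Point 5}
    (h : ¬ EdimLE (P.localRing w₅ F) 13) : ¬ TypeOccurs F P := fun hT => by
  rcases hT.cases with h' | h'
  · exact h (h'.1.mono (by norm_num))
  · exact h h'.1

theorem not_typeOccurs_of_edimLE {F : MvPolynomial (Fin 5) ℂ} {P : Point 5}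
    (h : ¬ EdimLE (P.localRing w₅ F) 6) (h12 : EdimLE (P.localRing w₅ F) 12) :
    ¬ TypeOccurs F P := fun hT => by
  rcases hT.cases with h' | h'
  · exact h h'.1
  · exact h'.2 h12

/-! ### The points (0:0:0:0:1) and (0:0:0:1:0). -/

/-- Exponents of some monomials of weight `7` in variables of weights `1, 1, 2, 4`. -/
def weightSeven : Fin 14 → Fin 4 → ℕ :=
  ![![7, 0, 0, 0], ![6, 1, 0, 0], ![5, 2, 0, 0], ![4, 3, 0, 0], ![3, 4, 0, 0], ![2, 5, 0, 0],
    ![1, 6, 0, 0], ![0, 7, 0, 0], ![5, 0, 1, 0], ![4, 1, 1, 0], ![3, 2, 1, 0], ![2, 3, 1, 0],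
    ![1, 4, 1, 0], ![0, 5, 1, 0]]

/-- If the equation has no term linear in `y₀, y₁` at the point `(0:0:0:0:1)`, then this point is
singular and its type does not occur. -/
theorem vertex_four {F : MvPolynomial (Fin 5) ℂ} (hF : F.IsWeightedHomogeneous w₅ 8)
    (h0 : coeff (Finsupp.single 0 1 + Finsupp.single 4 1) F = 0)
    (h1 : coeff (Finsupp.single 1 1 + Finsupp.single 4 1) F = 0) :
    IsSingularPoint w₅ F (vertex 4) ∧ ¬ TypeOccurs F (vertex 4) := by
  have hwt : ∀ j : Fin 4, w₅ ((4 : Fin 5).succAbove j) = ![1, 1, 2, 4] j := by decide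
  have hw4 : w₅ 4 = 7 := rfl
  have hmem := vertex_mem_exponents (w := w₅) (i := 4) (by decide) hwt
  rw [hw4] at hmem
  have hA := isMonomialRing_ambientRing w₅ (vertex (4 : Fin 5))
  -- A monomial of weight 8 containing y₄ is y₀y₄ or y₁y₄, and both are excluded; so the local
  -- equation is homogeneous of weight 8.
  have hsupp : ∀ k, coeff k ((vertex 4).localEquation F) ≠ 0 →
      Finsupp.weight (fun j : (vertex (4 : Fin 5)).Index => w₅ j) k = 8 := by
    intro k hk
    obtain ⟨m, hm, rfl⟩ := exists_of_coeff_localEquation_ne_zero hk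
    have h2 := hF hm
    have h3 := (vertex 4).weight_restrict w₅ m
    have h4 : m 4 = 0 := by
      by_contra h4
      rw [weight_w₅] at h2
      have h5 : m 2 = 0 ∧ m 3 = 0 ∧ m 4 = 1 := by omega
      rcases (by omega : m 0 = 1 ∧ m 1 = 0 ∨ m 0 = 0 ∧ m 1 = 1) with h6 | h6
      · refine hm ?_
        convert h0
        ext j
        fin_cases j <;> simp [h5, h6]
      · refine hm ?_
        convert h1
        ext j
        fin_cases j <;> simp [h5, h6]
    have h5 : m (vertex (4 : Fin 5)).chart = 0 := h4
    rw [h2, h5, zero_mul, add_zero] at h3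
    exact h3.symm
  -- The whole ideal starts in weight 8, so it does not affect the invariants of weight 7.
  have hmul : ∀ k, Finsupp.weight (fun j : (vertex (4 : Fin 5)).Index => w₅ j) k < 8 →
      ∀ a, (vertex 4).proj w₅ F a = 0 →
      MvPowerSeries.coeff k (a : MvPowerSeries (vertex (4 : Fin 5)).Index ℂ) = 0 := by
    classical
    intro k hk a ha
    obtain ⟨q, -, hq⟩ := Point.proj_eq_zero_iff.1 ha
    rw [hq, MvPowerSeries.coeff_mul]
    refine Finset.sum_eq_zero fun p hp => ?_
    rw [Finset.HasAntidiagonal.mem_antidiagonal] at hp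
    by_contra hne
    have h2 := hsupp p.1 (by
      rw [← coeff_coe]
      exact (mul_ne_zero_iff.1 hne).1)
    rw [← hp, map_add, h2] at hk
    omega
  have hwv : ∀ v : Fin 4 → ℕ, Finsupp.weight (fun j : (vertex (4 : Fin 5)).Index => w₅ j)
      (vec (vertex 4).enum v) = ∑ j, ![1, 1, 2, 4] j * v j := fun v => by
    rw [weight_vec]
    simp only [← hwt]
    rfl
  have hw7 : ∀ i, ∑ j, ![1, 1, 2, 4] j * weightSeven i j = 7 := by decide
  have hirr : ∀ i, IsIrred ((vertex 4).exponents w₅) (vec (vertex 4).enum (weightSeven i)) :=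
    fun i => isIrred_vec _ hmem ((hw7 i).symm ▸ dvd_rfl) (by revert i; decide)
      fun x hx hd => irred_of_weight_eq (by decide) (hw7 i) hx hd
  have hz : ∀ i a, (vertex 4).proj w₅ F a = 0 → MvPowerSeries.coeff
      (vec (vertex 4).enum (weightSeven i)) (a : MvPowerSeries (vertex (4 : Fin 5)).Index ℂ) = 0 :=
    fun i a ha => hmul _ (by rw [hwv, hw7]; norm_num) a ha
  have h00 : ∀ a, (vertex 4).proj w₅ F a = 0 → augmentation _ a = 0 :=
    fun a ha => hmul 0 (by simp) a ha
  refine ⟨isSingularPoint_of_not_squareProperty ?_ ?_, fun hT => ?_⟩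
  · rw [← Point.coeff_zero_localEquation]
    by_contra hne
    simpa using hsupp 0 hne
  · have hinj := vec_injective (vertex (4 : Fin 5)).enum
    have hne : ∀ i j, i ≠ j → vec (vertex (4 : Fin 5)).enum (weightSeven i) ≠
        vec (vertex (4 : Fin 5)).enum (weightSeven j) := fun i j hij h =>
      hij ((by decide : Function.Injective weightSeven) (hinj h))
    -- The relation is y₀⁷ · y₀⁵y₁² = (y₀⁶y₁)².
    refine hA.not_squareProperty ((vertex 4).proj_surjective w₅ F) (hA.isDer_coeffFun (hirr 1)) h00
      (hz 1) (hirr 0).1 (hirr 2).1 (hirr 1).1 (hirr 0).2.1 (hirr 2).2.1 (hirr 1).2.1 ?_ ?_ ?_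
    · rw [← vec_add, ← vec_add]
      congr 1
      decide
    · exact MvPowerSeries.coeff_monomial_ne (hne 1 0 (by decide)) 1
    · rw [coeffFun_apply, IsMonomialRing.mono, MvPowerSeries.coeff_monomial_same]
      exact one_ne_zero
  · exact not_typeOccurs_of_not_edimLE (F := F) (P := vertex 4) ((vertex (4 : Fin 5)).not_edimLE
      (g := fun i => vec (vertex (4 : Fin 5)).enum (weightSeven i)) (k := 0) hirr
      ((vec_injective _).comp (by decide)) Fin.elim0 (by simp) h00 fun a ha c _ =>
        Finset.sum_eq_zero fun i _ => by rw [hz i a ha, mul_zero]) hT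

/-- Exponents of the generators of the invariants of `μ₄` with weights `1, 1, 2, 3`. -/
def gensVertex : Fin 13 → Fin 4 → ℕ :=
  ![![4, 0, 0, 0], ![3, 1, 0, 0], ![2, 2, 0, 0], ![1, 3, 0, 0], ![0, 4, 0, 0], ![2, 0, 1, 0],
    ![1, 1, 1, 0], ![0, 2, 1, 0], ![0, 0, 2, 0], ![1, 0, 0, 1], ![0, 1, 0, 1], ![0, 0, 1, 2],
    ![0, 0, 0, 4]]

theorem covers_gensVertex : Covers 4 ![1, 1, 2, 7] gensVertex :=
  covers_four ⟨0, by decide⟩ ⟨4, by decide⟩ ⟨8, by decide⟩ ⟨12, by decide⟩ (by decide)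

theorem gensVertex_irred (i : Fin 11) (hi : 9 ≤ (i : ℕ)) (x : Fin 4 → ℕ)
    (hx : x ≤ gensVertex (Fin.castLE (by norm_num) i)) (hd : 4 ∣ ∑ j, ![1, 1, 2, 7] j * x j) :
    x = 0 ∨ x = gensVertex (Fin.castLE (by norm_num) i) := by
  have key : ∀ i : Fin 11, 9 ≤ (i : ℕ) → ∀ v, v = gensVertex (Fin.castLE (by norm_num) i) →
      ∀ a b c d : Fin 2, (a : ℕ) ≤ v 0 → (b : ℕ) ≤ v 1 → (c : ℕ) ≤ v 2 → (d : ℕ) ≤ v 3 →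
      4 ∣ (a : ℕ) + b + 2 * c + 7 * d → ((a : ℕ) = 0 ∧ (b : ℕ) = 0 ∧ (c : ℕ) = 0 ∧ (d : ℕ) = 0) ∨
        ((a : ℕ) = v 0 ∧ (b : ℕ) = v 1 ∧ (c : ℕ) = v 2 ∧ (d : ℕ) = v 3) := by
    simp only [forall_eq]
    decide
  have hb : ∀ i : Fin 11, 9 ≤ (i : ℕ) → ∀ j, gensVertex (Fin.castLE (by norm_num) i) j < 2 := by
    decide
  have hx' : ∀ j, x j < 2 := fun j => (hx j).trans_lt (hb i hi j)
  rcases key i hi _ rfl ⟨x 0, hx' 0⟩ ⟨x 1, hx' 1⟩ ⟨x 2, hx' 2⟩ ⟨x 3, hx' 3⟩ (hx 0) (hx 1) (hx 2)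
    (hx 3) (by simpa [Fin.sum_univ_four] using hd) with h | h
  · dsimp only at h
    exact Or.inl (funext fun j => by fin_cases j <;> simp <;> tauto)
  · dsimp only at h
    exact Or.inr (funext fun j => by fin_cases j <;> simp <;> tauto)

/-- If the equation contains `y₀ * y₄` or `y₁ * y₄` but not `y₃ ^ 2`, then the point `(0:0:0:1:0)`
is singular and its type does not occur. -/
theorem vertex_three {F : MvPolynomial (Fin 5) ℂ} (hF : F.IsWeightedHomogeneous w₅ 8)
    (h3 : coeff (Finsupp.single 3 2) F = 0)
    (h4 : coeff (Finsupp.single 0 1 + Finsupp.single 4 1) F ≠ 0 ∨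
      coeff (Finsupp.single 1 1 + Finsupp.single 4 1) F ≠ 0) :
    IsSingularPoint w₅ F (vertex 3) ∧ ¬ TypeOccurs F (vertex 3) := by
  have hwt : ∀ j : Fin 4, w₅ ((3 : Fin 5).succAbove j) = ![1, 1, 2, 7] j := by decide
  have hw3 : w₅ 3 = 4 := rfl
  have hw3' : w₅ 3 ≠ 0 := by decide
  have hmem := vertex_mem_exponents hw3' hwt
  rw [hw3] at hmem
  have hA := isMonomialRing_ambientRing w₅ (vertex (3 : Fin 5))
  set f : (vertex (3 : Fin 5)).ambientRing w₅ := ⟨_, localEquation_vertex_mem hw3' hF (by decide)⟩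
    with hf
  have hfc : ∀ k, MvPowerSeries.coeff k (f : MvPowerSeries (vertex (3 : Fin 5)).Index ℂ) =
      coeff k ((vertex 3).localEquation F) := fun k => coeff_coe _ _
  have hf0 : coeff 0 ((vertex 3).localEquation F) = 0 := by
    rw [← h3, ← coeff_localEquation_restrict hw3' hF
      (m := Finsupp.single 3 2) (by rw [weight_w₅]; simp)]
    congr 1
    refine vec_ext (vertex (3 : Fin 5)).enum fun i => ?_
    rw [restrict_enum]
    have : (vertex (3 : Fin 5)).chart.succAbove i ≠ 3 := Fin.succAbove_ne _ _
    simp [this.symm]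
  have hproj : (vertex 3).proj w₅ F f = 0 :=
    Point.proj_eq_zero_iff.2 ⟨1, converges_one, by rw [mul_one]⟩
  have h00 : ∀ a, (vertex 3).proj w₅ F a = 0 → augmentation _ a = 0 := fun a ha => by
    obtain ⟨q, -, hq⟩ := Point.proj_eq_zero_iff.1 ha
    rw [augmentation_apply, hq, MvPowerSeries.coeff_zero_eq_constantCoeff_apply, map_mul,
      ← MvPowerSeries.coeff_zero_eq_constantCoeff_apply, coeff_coe, hf0, zero_mul]
  have hirr : ∀ i : Fin 11, IsIrred ((vertex 3).exponents w₅)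
      (vec (vertex 3).enum (gensVertex (Fin.castLE (by norm_num) i))) := by
    intro i
    refine isIrred_vec _ hmem (by revert i; decide) (by revert i; decide) fun x hx hd => ?_
    -- The first nine generators have weight 4; the next two are y₀y₄ and y₁y₄, of weight 8.
    by_cases hi : (i : ℕ) < 9
    · refine irred_of_weight_eq (by decide) ?_ hx hd
      clear hx hd
      revert i
      decide
    · exact gensVertex_irred i (by omega) x hx hd
  have hcoef : ∀ i : Fin 11, ∀ a, (vertex 3).proj w₅ F a = 0 → ∀ q, (a : MvPowerSeries _ ℂ) =
      ((vertex 3).localEquation F : MvPowerSeries (vertex (3 : Fin 5)).Index ℂ) * q →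
      MvPowerSeries.coeff (vec (vertex 3).enum (gensVertex (Fin.castLE (by norm_num) i)))
        (a : MvPowerSeries (vertex (3 : Fin 5)).Index ℂ) = MvPowerSeries.coeff 0 q *
      coeff (vec (vertex 3).enum (gensVertex (Fin.castLE (by norm_num) i)))
        ((vertex 3).localEquation F) := by
    intro i a _ q hq
    have := hA.coeff_mul_of_irred f.2 q (hirr i)
    rw [hq, this, hfc, hfc, hf0, zero_mul, zero_add]
  obtain ⟨i₀, hi₀, hne⟩ : ∃ i₀ : Fin 11, 9 ≤ (i₀ : ℕ) ∧
      coeff (vec (vertex 3).enum (gensVertex (Fin.castLE (by norm_num) i₀)))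
        ((vertex 3).localEquation F) ≠ 0 := by
    rcases h4 with h4 | h4
    · refine ⟨9, by decide, ?_⟩
      rw [← coeff_localEquation_restrict hw3' hF (by rw [weight_w₅]; simp)] at h4
      convert h4
      refine vec_ext (vertex (3 : Fin 5)).enum fun i => ?_
      rw [restrict_enum, vec_apply]
      change gensVertex 9 i = (Finsupp.single 0 1 + Finsupp.single 4 1 : Fin 5 →₀ ℕ)
        ((3 : Fin 5).succAbove i)
      fin_cases i <;> simp [gensVertex, Fin.succAbove, Fin.ext_iff]
    · refine ⟨10, by decide, ?_⟩
      rw [← coeff_localEquation_restrict hw3' hF (by rw [weight_w₅]; simp)] at h4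
      convert h4
      refine vec_ext (vertex (3 : Fin 5)).enum fun i => ?_
      rw [restrict_enum, vec_apply]
      change gensVertex 10 i = (Finsupp.single 1 1 + Finsupp.single 4 1 : Fin 5 →₀ ℕ)
        ((3 : Fin 5).succAbove i)
      fin_cases i <;> simp [gensVertex, Fin.succAbove, Fin.ext_iff]
  have hvinj : Function.Injective fun i => vec (vertex (3 : Fin 5)).enum (gensVertex i) :=
    (vec_injective _).comp (by decide)
  refine ⟨isSingularPoint_of_not_squareProperty ?_ ?_, fun hT => ?_⟩
  · rw [← Point.coeff_zero_localEquation, hf0]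
  · set κ := coeff (vec (vertex 3).enum (gensVertex (Fin.castLE (by norm_num) i₀)))
      ((vertex 3).localEquation F) with hκ
    set κ₁ := coeff (vec (vertex 3).enum (gensVertex 1)) ((vertex 3).localEquation F) with hκ₁
    have hdiff : ∀ i j : Fin 13, i ≠ j → vec (vertex (3 : Fin 5)).enum (gensVertex i) ≠
        vec (vertex (3 : Fin 5)).enum (gensVertex j) := fun i j h h' => h (hvinj h')
    -- The coefficient at y₀³y₁ is corrected by that of the eliminated generator `i₀`, so that the
    -- derivation kills the equation. It separates y₀³y₁ from y₀⁴ in the relation y₀⁴ · y₀²y₁² =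
    -- (y₀³y₁)².
    have hder : IsDer (augmentation ((vertex (3 : Fin 5)).ambientRing w₅))
        (κ • coeffFun _ (vec (vertex 3).enum (gensVertex 1)) -
          κ₁ • coeffFun _ (vec (vertex 3).enum (gensVertex (Fin.castLE (by norm_num) i₀)))) := by
      intro a b
      have d1 := hA.isDer_coeffFun (hirr 1) a b
      have d2 := hA.isDer_coeffFun (hirr i₀) a b
      have e1 : Fin.castLE (by norm_num : 11 ≤ 13) 1 = 1 := rfl
      rw [e1] at d1
      simp only [LinearMap.sub_apply, LinearMap.smul_apply, d1, d2, smul_eq_mul]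
      ring
    have hval : ∀ i : Fin 13, ∀ hm : vec (vertex (3 : Fin 5)).enum (gensVertex i) ∈ _, ∀ j,
        coeffFun _ (vec (vertex 3).enum (gensVertex j)) (hA.mono hm) = if j = i then 1 else 0 := by
      classical
      intro i hm j
      rw [coeffFun_apply, IsMonomialRing.mono, MvPowerSeries.coeff_monomial]
      simp only [hvinj.eq_iff]
    have hi0 : ∀ j : Fin 13, (j : ℕ) < 9 → Fin.castLE (by norm_num) i₀ ≠ j := fun j hj h => by
      have := congr_arg Fin.val h
      simp at this
      omega
    refine hA.not_squareProperty ((vertex 3).proj_surjective w₅ F) hder h00 ?_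
      (hirr 0).1 (hirr 2).1 (hirr 1).1 (hirr 0).2.1 (hirr 2).2.1 (hirr 1).2.1 ?_ ?_ ?_
    · intro a ha
      obtain ⟨q, -, hq⟩ := Point.proj_eq_zero_iff.1 ha
      have e1 := hcoef 1 a ha q hq
      have e2 := hcoef i₀ a ha q hq
      simp only [LinearMap.sub_apply, LinearMap.smul_apply, coeffFun_apply, smul_eq_mul]
      rw [e2]
      refine (congr_arg₂ _ (congr_arg _ e1) rfl).trans ?_
      rw [← hκ]
      change κ * (_ * κ₁) - _ = _
      ring
    · rw [← vec_add, ← vec_add]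
      congr 1
      decide
    · simp only [LinearMap.sub_apply, LinearMap.smul_apply]
      rw [hval, hval, if_neg (by decide), if_neg (hi0 _ (by decide))]
      simp
    · simp only [LinearMap.sub_apply, LinearMap.smul_apply]
      rw [hval, hval, if_pos (by decide), if_neg (hi0 _ (by decide))]
      simpa using hne
  · refine not_typeOccurs_of_edimLE (F := F) (P := vertex 3) ?_ ?_ hT
    -- Eight generators of weight 4 and one linear condition from the equation: 6 + 1 < 8.
    · refine (vertex (3 : Fin 5)).not_edimLE
        (g := fun i : Fin 8 => vec (vertex (3 : Fin 5)).enum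
          (gensVertex (Fin.castLE (by norm_num) (Fin.castLE (by norm_num : 8 ≤ 11) i)))) (k := 1)
        (fun i => hirr _) (hvinj.comp (by decide)) (fun _ i => coeff (vec (vertex 3).enum
          (gensVertex (Fin.castLE (by norm_num) (Fin.castLE (by norm_num : 8 ≤ 11) i))))
            ((vertex 3).localEquation F)) (by simp) h00 ?_
      intro a ha c hc
      obtain ⟨q, -, hq⟩ := Point.proj_eq_zero_iff.1 ha
      simp only [hcoef _ a ha q hq]
      have := congr_arg (MvPowerSeries.coeff 0 q * ·) (hc 0)
      simp only [mul_zero, Finset.mul_sum] at this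
      rw [← this]
      exact Finset.sum_congr rfl fun i _ => by ring
    -- The term y₀y₄ or y₁y₄ of the equation removes one of the 13 generators.
    · have := (vertex (3 : Fin 5)).edimLE_of_mem
        (isDominating_vec _ hmem covers_gensVertex (by decide) (by decide)) hvinj hproj
        (h00 f hproj) (hirr i₀) (by rw [hfc]; exact hne)
      simpa using this

/-! ### The additional singular point of a normal form. -/

/-- The equations `y₀y₄ - y₃² + η y₂⁴ + b₁y₂³y₁² + b₂y₂²y₁⁴ + b₃y₂y₁⁶ + b₄y₁⁸`. -/
def octic (η b₁ b₂ b₃ b₄ : ℂ) : MvPolynomial (Fin 5) ℂ :=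
  X 0 * X 4 - X 3 ^ 2 + (C η * X 2 ^ 4 + C b₁ * (X 2 ^ 3 * X 1 ^ 2) + C b₂ * (X 2 ^ 2 * X 1 ^ 4) +
    C b₃ * (X 2 * X 1 ^ 6) + C b₄ * X 1 ^ 8)

/-- The point `(0:0:1:η:0)`. -/
def axisPoint (η : ℂ) : Point 5 := ⟨2, ![0, 0, 1, η, 0], rfl⟩

theorem stabilizer_axisPoint (η : ℂ) : (axisPoint η).stabilizer w₅ = {t | t ^ 2 = 1} := by
  refine stabilizer_eq_of_forall two_ne_zero (fun t ht j hj => ?_) fun t _ ht =>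
    ht 2 (by simp [axisPoint])
  fin_cases j
  · simp [axisPoint] at hj
  · simp [axisPoint] at hj
  · exact ht
  · change t ^ 4 = 1
    rw [show (4 : ℕ) = 2 * 2 from rfl, pow_mul, ht, one_pow]
  · simp [axisPoint] at hj

/-- Exponents of the generators of the invariants of `μ₂` with weights `1, 1, 0, 1`. -/
def gensAxis : Fin 7 → Fin 4 → ℕ :=
  ![![2, 0, 0, 0], ![1, 1, 0, 0], ![0, 2, 0, 0], ![1, 0, 0, 1], ![0, 1, 0, 1], ![0, 0, 0, 2],
    ![0, 0, 1, 0]]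

theorem covers_gensAxis : Covers 2 ![1, 1, 4, 7] gensAxis :=
  covers_four ⟨0, by decide⟩ ⟨2, by decide⟩ ⟨6, by decide⟩ ⟨5, by decide⟩ (by decide)

theorem axisPoint_weights (η : ℂ) (j : Fin 4) :
    w₅ ((axisPoint η).chart.succAbove j) = ![1, 1, 4, 7] j := by
  change w₅ ((2 : Fin 5).succAbove j) = _
  revert j
  decide

theorem isDominating_gensAxis (η : ℂ) :
    IsDominating ((axisPoint η).exponents w₅) fun i => vec (axisPoint η).enum (gensAxis i) :=
  Point.isDominating two_ne_zero (stabilizer_axisPoint η) (axisPoint_weights η) covers_gensAxis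
    (by decide) (by decide)

/-- The generators of the local ring of the ambient space at `(0:0:1:η:0)`. -/
def axisGen (η : ℂ) (i : Fin 7) : (axisPoint η).ambientRing w₅ :=
  (isMonomialRing_ambientRing w₅ (axisPoint η)).mono ((isDominating_gensAxis η).mem i)

theorem axisGen_mul (η : ℂ) {i j k l : Fin 7}
    (h : gensAxis i + gensAxis j = gensAxis k + gensAxis l) :
    axisGen η i * axisGen η j = axisGen η k * axisGen η l := by
  refine Subtype.ext ?_
  simp only [axisGen, IsMonomialRing.mono, MulMemClass.coe_mul,
    MvPowerSeries.monomial_mul_monomial, ← vec_add, h]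

/-- The coordinates on the chart at `(0:0:1:η:0)`. -/
def axisCoord (η : ℂ) (i : Fin 4) : MvPowerSeries (axisPoint η).Index ℂ :=
  MvPowerSeries.X ((axisPoint η).enum i)

theorem monomial_vec_eq_prod {σ : Type*} [Finite σ] (e : Fin 4 ≃ σ) (v : Fin 4 → ℕ) :
    MvPowerSeries.monomial (R := ℂ) (vec e v) 1 = MvPowerSeries.X (e 0) ^ v 0 *
      MvPowerSeries.X (e 1) ^ v 1 * MvPowerSeries.X (e 2) ^ v 2 * MvPowerSeries.X (e 3) ^ v 3 := by
  simp only [MvPowerSeries.X_pow_eq, MvPowerSeries.monomial_mul_monomial, mul_one]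
  congr 2
  refine vec_ext e fun i => ?_
  rw [vec_apply]
  fin_cases i <;> simp [e.injective.eq_iff]

theorem coe_axisGen (η : ℂ) (i : Fin 7) :
    (axisGen η i : MvPowerSeries (axisPoint η).Index ℂ) = axisCoord η 0 ^ gensAxis i 0 *
      axisCoord η 1 ^ gensAxis i 1 * axisCoord η 2 ^ gensAxis i 2 * axisCoord η 3 ^ gensAxis i 3 :=
  monomial_vec_eq_prod _ _

/-- The invariant function defined by the local equation. -/
def axisEquation (η b₁ b₂ b₃ b₄ : ℂ) : (axisPoint η).ambientRing w₅ :=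
  axisGen η 3 - axisGen η 6 * axisGen η 6 - (2 * η) • axisGen η 6 + axisGen η 2 * (b₁ • 1 +
    axisGen η 2 * (b₂ • 1 + axisGen η 2 * (b₃ • 1 + axisGen η 2 * b₄ • 1)))

/-- The constant term of the local equation is η - η², so the condition η² = η says that the point
lies on the hypersurface. -/
theorem coe_axisEquation {η : ℂ} (hη : η ^ 2 = η) (b₁ b₂ b₃ b₄ : ℂ) :
    (axisEquation η b₁ b₂ b₃ b₄ : MvPowerSeries (axisPoint η).Index ℂ) =
      ((axisPoint η).localEquation (octic η b₁ b₂ b₃ b₄) : MvPolynomial _ ℂ) := by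
  have h2 : (axisPoint η).chart = 2 := rfl
  have hc : (axisPoint η).coord = ![0, 0, 1, η, 0] := rfl
  have e0 : (axisPoint η).enum 0 = ⟨0, show (0 : Fin 5) ≠ 2 by decide⟩ := rfl
  have e1 : (axisPoint η).enum 1 = ⟨1, show (1 : Fin 5) ≠ 2 by decide⟩ := rfl
  have e3 : (axisPoint η).enum 2 = ⟨3, show (3 : Fin 5) ≠ 2 by decide⟩ := rfl
  have e4 : (axisPoint η).enum 3 = ⟨4, show (4 : Fin 5) ≠ 2 by decide⟩ := rfl
  have hC : (MvPowerSeries.C η : MvPowerSeries (axisPoint η).Index ℂ) ^ 2 = MvPowerSeries.C η := by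
    rw [← map_pow, hη]
  have hL : (axisPoint η).localEquation (octic η b₁ b₂ b₃ b₄) =
      X ((axisPoint η).enum 0) * X ((axisPoint η).enum 3) - (X ((axisPoint η).enum 2) + C η) ^ 2 +
      (C η + C b₁ * X ((axisPoint η).enum 1) ^ 2 + C b₂ * X ((axisPoint η).enum 1) ^ 4 +
        C b₃ * X ((axisPoint η).enum 1) ^ 6 + C b₄ * X ((axisPoint η).enum 1) ^ 8) := by
    rw [e0, e1, e3, e4]
    simp [Point.localEquation, octic, h2, hc, algebraMap_eq]
  rw [hL]
  have hs : ∀ (k : ℂ) (x : MvPowerSeries (axisPoint η).Index ℂ),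
      k • x = MvPowerSeries.C k * x := fun k x => MvPowerSeries.smul_eq_C_mul x k
  have hsub : ∀ p q : MvPolynomial (axisPoint η).Index ℂ,
      ((p - q : MvPolynomial _ ℂ) : MvPowerSeries (axisPoint η).Index ℂ) = p - q := fun p q =>
    map_sub (MvPolynomial.coeToMvPowerSeries.ringHom (R := ℂ)) p q
  simp only [axisEquation, coe_add, coe_mul, coe_pow, coe_X, coe_C, hsub, AddMemClass.coe_add,
    MulMemClass.coe_mul, AddSubgroupClass.coe_sub, SetLike.val_smul, OneMemClass.coe_one,
    coe_axisGen, hs]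
  simp [gensAxis, axisCoord]
  have hC2 : (MvPowerSeries.C 2 : MvPowerSeries (axisPoint η).Index ℂ) = 2 := map_ofNat _ 2
  linear_combination hC - MvPowerSeries.X ((axisPoint η).enum 2) * MvPowerSeries.C η * hC2

section AxisRing

variable {η b₁ b₂ b₃ b₄ : ℂ}

theorem proj_axisEquation (hη : η ^ 2 = η) : (axisPoint η).proj w₅ (octic η b₁ b₂ b₃ b₄)
    (axisEquation η b₁ b₂ b₃ b₄) = 0 :=
  Point.proj_eq_zero_iff.2 ⟨1, converges_one, by rw [mul_one, coe_axisEquation hη]⟩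

theorem augmentation_axisGen (i : Fin 7) : augmentation _ (axisGen η i) = 0 :=
  (isMonomialRing_ambientRing w₅ (axisPoint η)).augmentation_mono _
    ((isDominating_gensAxis η).ne_zero i)

theorem augmentation_axisEquation : augmentation _ (axisEquation η b₁ b₂ b₃ b₄) = 0 := by
  simp [axisEquation, augmentation_axisGen]

theorem exists_eq_axisEquation_mul (hη : η ^ 2 = η) {a : (axisPoint η).ambientRing w₅}
    (ha : (axisPoint η).proj w₅ (octic η b₁ b₂ b₃ b₄) a = 0) :
    ∃ q : MvPowerSeries (axisPoint η).Index ℂ,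
      (a : MvPowerSeries (axisPoint η).Index ℂ) = axisEquation η b₁ b₂ b₃ b₄ * q := by
  obtain ⟨q, -, hq⟩ := Point.proj_eq_zero_iff.1 ha
  exact ⟨q, by rw [hq, coe_axisEquation hη]⟩

theorem augmentation_of_proj (hη : η ^ 2 = η) (a : (axisPoint η).ambientRing w₅)
    (ha : (axisPoint η).proj w₅ (octic η b₁ b₂ b₃ b₄) a = 0) : augmentation _ a = 0 := by
  obtain ⟨q, hq⟩ := exists_eq_axisEquation_mul hη ha
  have h0 : MvPowerSeries.coeff 0 (axisEquation η b₁ b₂ b₃ b₄ :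
    MvPowerSeries (axisPoint η).Index ℂ) = 0 := augmentation_axisEquation
  rw [MvPowerSeries.coeff_zero_eq_constantCoeff_apply] at h0
  rw [augmentation_apply, hq, MvPowerSeries.coeff_zero_eq_constantCoeff_apply, map_mul, h0,
    zero_mul]

theorem gensAxis_irred (η : ℂ) : IsIrred ((axisPoint η).exponents w₅)
    (vec (axisPoint η).enum (gensAxis 1)) := by
  refine isIrred_vec _ (N := 2) (wt := ![1, 1, 4, 7]) (fun v => ?_) (by decide) (by decide)
    fun x hx hd => ?_
  · simp only [Point.vec_mem_exponents two_ne_zero (stabilizer_axisPoint η), axisPoint_weights]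
  · simp only [Fin.sum_univ_four] at hd
    have h0 : x 0 ≤ 1 := hx 0
    have h1 : x 1 ≤ 1 := hx 1
    have h2 : x 2 = 0 := Nat.le_zero.1 (hx 2)
    have h3 : x 3 = 0 := Nat.le_zero.1 (hx 3)
    simp [h2, h3] at hd
    rcases (by omega : x 0 = 0 ∧ x 1 = 0 ∨ x 0 = 1 ∧ x 1 = 1) with h | h
    · exact Or.inl (funext fun j => by fin_cases j <;> simp [h, h2, h3])
    · exact Or.inr (funext fun j => by fin_cases j <;> simp [h, h2, h3, gensAxis])

/-- The relation is y₀² · y₁² = (y₀y₁)². The invariant y₀y₁ does not occur in the equation, so its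
coefficient is a derivation of the quotient. -/
theorem not_squareProperty_axis (hη : η ^ 2 = η) :
    ¬ SquareProperty ((axisPoint η).localRing w₅ (octic η b₁ b₂ b₃ b₄)) := by
  have hA := isMonomialRing_ambientRing w₅ (axisPoint η)
  have hder := hA.isDer_coeffFun (gensAxis_irred η)
  have hinj : Function.Injective fun i => vec (axisPoint η).enum (gensAxis i) :=
    (vec_injective _).comp (by decide)
  have hval : ∀ i, coeffFun _ (vec (axisPoint η).enum (gensAxis 1)) (axisGen η i) =
      if 1 = i then 1 else 0 := by
    classical
    intro i
    rw [coeffFun_apply, axisGen, IsMonomialRing.mono, MvPowerSeries.coeff_monomial]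
    simp only [hinj.eq_iff]
  have hf : coeffFun _ (vec (axisPoint η).enum (gensAxis 1)) (axisEquation η b₁ b₂ b₃ b₄) = 0 := by
    simp only [axisEquation, map_add, map_sub, map_smul, hder _ _, hval, augmentation_axisGen,
      hder.map_one]
    simp
  refine hA.not_squareProperty ((axisPoint η).proj_surjective w₅ _) hder
    (augmentation_of_proj hη) ?_ ((isDominating_gensAxis η).mem 0) ((isDominating_gensAxis η).mem 2)
    ((isDominating_gensAxis η).mem 1) ((isDominating_gensAxis η).ne_zero 0)
    ((isDominating_gensAxis η).ne_zero 2) ((isDominating_gensAxis η).ne_zero 1) ?_ ?_ ?_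
  · intro a ha
    obtain ⟨q, hq⟩ := exists_eq_axisEquation_mul hη ha
    have h0 : MvPowerSeries.coeff 0 (axisEquation η b₁ b₂ b₃ b₄ :
      MvPowerSeries (axisPoint η).Index ℂ) = 0 := augmentation_axisEquation
    rw [coeffFun_apply, hq, hA.coeff_mul_of_irred (axisEquation η b₁ b₂ b₃ b₄).2 q
      (gensAxis_irred η), h0, ← coeffFun_apply, hf]
    ring
  · rw [← vec_add, ← vec_add]
    congr 1
    decide
  · exact (hval 0).trans (if_neg (by decide))
  · intro h
    have := (hval 1).symm.trans h
    simp at this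

/-- A nonzero polynomial in a nonzero series without constant term is nonzero, by comparing orders;
Horner form allows peeling off one coefficient at a time. -/
theorem bracket_ne_zero {p : PowerSeries ℂ} (hp : PowerSeries.constantCoeff p = 0) (hp0 : p ≠ 0)
    (hb : b₁ ≠ 0 ∨ b₂ ≠ 0 ∨ b₃ ≠ 0 ∨ b₄ ≠ 0) :
    b₁ • 1 + p * (b₂ • 1 + p * (b₃ • 1 + p * b₄ • 1)) ≠ 0 := by
  have key : ∀ (b : ℂ) (q : PowerSeries ℂ), b ≠ 0 ∨ q ≠ 0 → b • 1 + p * q ≠ 0 := by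
    intro b q hbq h
    by_cases hb : b = 0
    · rw [hb, zero_smul, zero_add] at h
      exact (mul_ne_zero hp0 (hbq.resolve_left (not_not.2 hb))) h
    · have := congr_arg PowerSeries.constantCoeff h
      rw [map_add, map_mul, hp, zero_mul, add_zero, PowerSeries.smul_eq_C_mul, mul_one,
        PowerSeries.constantCoeff_C, map_zero] at this
      exact hb this
  refine key _ _ (hb.imp_right fun hb => key _ _ (hb.imp_right fun hb => key _ _
    (hb.imp_right fun hb => ?_)))
  rw [PowerSeries.smul_eq_C_mul, mul_one]
  simpa using hb

/-- The germ is smooth of dimension 3 away from the point, so along a nonconstant arc three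
generators determine every derivation. Which three depends on the generators that vanish on the arc.
Generators 0 to 6 are y₀², y₀y₁, y₁², y₀y₄, y₁y₄, y₄², y₃ - η. -/
theorem not_hasSingularArc_axis (hη : η = 1 ∨ (η = 0 ∧ (b₁ ≠ 0 ∨ b₂ ≠ 0 ∨ b₃ ≠ 0 ∨ b₄ ≠ 0))) :
    ¬ HasSingularArc ((axisPoint η).localRing w₅ (octic η b₁ b₂ b₃ b₄)) := by
  have hη2 : η ^ 2 = η := by rcases hη with h | h <;> simp [h]
  rintro ⟨γ, ⟨a₀, ha₀⟩, hγ⟩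
  have hA := isMonomialRing_ambientRing w₅ (axisPoint η)
  set π := (axisPoint η).proj w₅ (octic η b₁ b₂ b₃ b₄) with hπ
  have hsurj : Function.Surjective π := (axisPoint η).proj_surjective w₅ _
  set p : Fin 7 → PowerSeries ℂ := fun i => γ (π (axisGen η i)) with hp
  have hp0 : ∀ i, PowerSeries.constantCoeff (p i) = 0 := fun i => by
    have := hA.constantCoeff_eq (γ.comp π) (axisGen η i)
    rw [augmentation_axisGen] at this
    exact this
  have hrel : ∀ i j k l, gensAxis i + gensAxis j = gensAxis k + gensAxis l →
      p i * p j = p k * p l := fun i j k l h => by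
    simp only [hp, ← map_mul, axisGen_mul η h]
  have hfp : p 3 - p 6 * p 6 - (2 * η) • p 6 + p 2 * (b₁ • 1 + p 2 * (b₂ • 1 + p 2 * (b₃ • 1 +
      p 2 * b₄ • 1))) = 0 := by
    have := congr_arg γ (proj_axisEquation (b₁ := b₁) (b₂ := b₂) (b₃ := b₃) (b₄ := b₄) hη2)
    simpa only [axisEquation, map_add, map_sub, map_mul, map_smul, map_one, map_zero] using this
  -- A derivation is reduced to its values `d` on the generators. They satisfy the linearized
  -- binomial relations and the linearized equation; the part of the latter coming from the quartic
  -- is a multiple of the value at y₁².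
  have suff : ∀ i j k : Fin 7, (∀ d : Fin 7 → PowerSeries ℂ,
      (∀ i j k l, gensAxis i + gensAxis j = gensAxis k + gensAxis l →
        p i * d j + p j * d i = p k * d l + p l * d k) →
      (∃ s, d 3 = 2 * (p 6 + PowerSeries.C η) * d 6 + s * d 2) → d i = 0 → d j = 0 → d k = 0 →
        ∀ l, d l = 0) → False := by
    intro i j k h
    refine hγ ⟨![π (axisGen η i), π (axisGen η j), π (axisGen η k)], fun D hD h0 => ?_⟩
    refine eq_zero_of_comp hsurj (hA.arc_der_eq_zero (isDominating_gensAxis η) (hD.comp π) ?_)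
    refine h (fun l => D (π (axisGen η l))) (fun i j k l h => ?_) ?_ (h0 0) (h0 1) (h0 2)
    · simp only [hp, ← hD _ _, ← map_mul, axisGen_mul η h]
    · set E := D ∘ₗ π.toLinearMap with hE
      have hEder : IsDer (γ.comp π) E := hD.comp π
      have hQ1 : ∀ b : ℂ, ∃ s, E (b • 1) = s * E (axisGen η 2) := fun b =>
        ⟨0, by rw [map_smul, hEder.map_one, smul_zero, zero_mul]⟩
      have hQa : ∀ x y, (∃ s, E x = s * E (axisGen η 2)) → (∃ s, E y = s * E (axisGen η 2)) →
          ∃ s, E (x + y) = s * E (axisGen η 2) := by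
        rintro x y ⟨s, hs⟩ ⟨t, ht⟩
        exact ⟨s + t, by rw [map_add, hs, ht, add_mul]⟩
      have hQm : ∀ x, (∃ s, E x = s * E (axisGen η 2)) →
          ∃ s, E (axisGen η 2 * x) = s * E (axisGen η 2) := by
        rintro x ⟨s, hs⟩
        exact ⟨(γ.comp π) (axisGen η 2) * s + (γ.comp π) x, by rw [hEder, hs]; ring⟩
      obtain ⟨s, hs⟩ := hQm _ (hQa _ _ (hQ1 b₁) (hQm _ (hQa _ _ (hQ1 b₂) (hQm _ (hQa _ _ (hQ1 b₃)
        (hQm _ (hQ1 b₄)))))))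
      have h1 : E (axisEquation η b₁ b₂ b₃ b₄) = 0 := by
        simp only [hE, LinearMap.comp_apply, AlgHom.toLinearMap_apply, hπ,
          proj_axisEquation hη2, map_zero]
      rw [axisEquation, map_add, hs, map_sub, map_sub, hEder, map_smul,
        PowerSeries.smul_eq_C_mul, map_mul] at h1
      have h2 : (PowerSeries.C (2 : ℂ) : PowerSeries ℂ) = 2 := map_ofNat _ 2
      rw [h2] at h1
      refine ⟨-s, ?_⟩
      change E (axisGen η 3) = 2 * ((γ.comp π) (axisGen η 6) + PowerSeries.C η) *
        E (axisGen η 6) + -s * E (axisGen η 2)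
      linear_combination h1
  have r1 := hrel 0 2 1 1 (by decide)
  have r2 := hrel 0 5 3 3 (by decide)
  have r3 := hrel 2 5 4 4 (by decide)
  have r5 := hrel 2 3 1 4 (by decide)
  have htwo : (2 : PowerSeries ℂ) ≠ 0 := fun h => by
    have := congr_arg PowerSeries.constantCoeff h
    rw [map_ofNat, map_zero] at this
    exact two_ne_zero this
  have hconst : PowerSeries.constantCoeff (p 6 + PowerSeries.C η) = η := by
    rw [map_add, hp0, PowerSeries.constantCoeff_C, zero_add]
  by_cases h2 : p 2 = 0
  · have h1 : p 1 = 0 := by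
      rw [h2, mul_zero] at r1
      exact mul_self_eq_zero.1 r1.symm
    have h4 : p 4 = 0 := by
      rw [h2, zero_mul] at r3
      exact mul_self_eq_zero.1 r3.symm
    by_cases h0 : p 0 = 0
    -- If y₀², y₁² and y₄² all vanish on the arc, then so does y₃ - η, because it is a root of z² +
    -- 2ηz with zero constant term. The arc is then constant.
    · by_cases h5 : p 5 = 0
      · have h3 : p 3 = 0 := by
          rw [h5, mul_zero] at r2
          exact mul_self_eq_zero.1 r2.symm
        have h6 : p 6 = 0 := by
          rw [h3, h2, PowerSeries.smul_eq_C_mul, map_mul] at hfp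
          have hC2 : (PowerSeries.C (2 : ℂ) : PowerSeries ℂ) = 2 := map_ofNat _ 2
          have h6' : p 6 * (p 6 + 2 * PowerSeries.C η) = 0 := by
            rw [hC2] at hfp
            linear_combination -hfp
          refine (mul_eq_zero.1 h6').elim id fun h => ?_
          have hc := congr_arg PowerSeries.constantCoeff h
          rw [map_add, hp0, map_mul, PowerSeries.constantCoeff_C, map_ofNat, map_zero, zero_add,
            mul_eq_zero] at hc
          have hη0 : η = 0 := hc.resolve_left two_ne_zero
          rw [hη0, map_zero, mul_zero, add_zero] at h
          exact h
        obtain ⟨a, rfl⟩ := hsurj a₀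
        refine ha₀ _ (hA.arc_constant (isDominating_gensAxis η) (γ := γ.comp π) (fun i => ?_) a)
        change p i = 0
        fin_cases i <;> assumption
      · refine suff 5 4 6 fun d hd ⟨s, hs⟩ k5 k4 k6 => ?_
        have e2 := hd 0 5 3 3 (by decide)
        have e3 := hd 2 5 4 4 (by decide)
        have e6 := hd 5 1 3 4 (by decide)
        have k2 : d 2 = 0 := by
          refine (mul_eq_zero.1 ?_).resolve_left h5
          rw [k4, k5] at e3
          linear_combination e3
        have k3 : d 3 = 0 := by rw [hs, k6, k2]; ring
        have k1 : d 1 = 0 := by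
          refine (mul_eq_zero.1 ?_).resolve_left h5
          rw [k4, k5, k3] at e6
          linear_combination e6
        have k0 : d 0 = 0 := by
          refine (mul_eq_zero.1 ?_).resolve_left h5
          rw [k5, k3] at e2
          linear_combination e2
        intro l
        fin_cases l <;> assumption
    · refine suff 0 1 6 fun d hd ⟨s, hs⟩ k0 k1 k6 => ?_
      have e1 := hd 0 2 1 1 (by decide)
      have e2 := hd 0 5 3 3 (by decide)
      have e4 := hd 0 4 1 3 (by decide)
      have k2 : d 2 = 0 := by
        refine (mul_eq_zero.1 ?_).resolve_left h0
        rw [k0, k1] at e1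
        linear_combination e1
      have k3 : d 3 = 0 := by rw [hs, k6, k2]; ring
      have k4 : d 4 = 0 := by
        refine (mul_eq_zero.1 ?_).resolve_left h0
        rw [k0, k1, k3] at e4
        linear_combination e4
      have k5 : d 5 = 0 := by
        refine (mul_eq_zero.1 ?_).resolve_left h0
        rw [k0, k3] at e2
        linear_combination e2
      intro l
      fin_cases l <;> assumption
  · by_cases h6 : p 6 + PowerSeries.C η = 0
    -- Here y₃ vanishes on the arc but y₁² does not. The equation makes y₀y₄ nonzero because the
    -- quartic is nonzero; this is where ν = ∞ would fail.
    · have hη0 : η = 0 := by rw [← hconst, h6, map_zero]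
      have hb := (hη.resolve_left (by rw [hη0]; exact zero_ne_one)).2
      have hp6 : p 6 = 0 := by rwa [hη0, map_zero, add_zero] at h6
      have h3 : p 3 ≠ 0 := by
        intro h3
        rw [h3, hp6, mul_zero, smul_zero, sub_zero, sub_zero, zero_add] at hfp
        exact mul_ne_zero h2 (bracket_ne_zero (hp0 2) h2 hb) hfp
      have h1 : p 1 ≠ 0 := by
        intro h1
        rw [h1, zero_mul] at r5
        exact mul_ne_zero h2 h3 r5
      refine suff 2 1 6 fun d hd ⟨s, hs⟩ k2 k1 k6 => ?_
      have e1 := hd 0 2 1 1 (by decide)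
      have e3 := hd 2 5 4 4 (by decide)
      have e5 := hd 2 3 1 4 (by decide)
      have k3 : d 3 = 0 := by rw [hs, k6, k2]; ring
      have k4 : d 4 = 0 := by
        refine (mul_eq_zero.1 ?_).resolve_left h1
        rw [k1, k2, k3] at e5
        linear_combination -e5
      have k0 : d 0 = 0 := by
        refine (mul_eq_zero.1 ?_).resolve_left h2
        rw [k1, k2] at e1
        linear_combination e1
      have k5 : d 5 = 0 := by
        refine (mul_eq_zero.1 ?_).resolve_left h2
        rw [k2, k4] at e3
        linear_combination e3
      intro l
      fin_cases l <;> assumption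
    -- The partial derivative of the equation in y₃ is nonzero on the arc, so the equation
    -- determines the value at y₃ - η.
    · refine suff 2 1 4 fun d hd ⟨s, hs⟩ k2 k1 k4 => ?_
      have e1 := hd 0 2 1 1 (by decide)
      have e3 := hd 2 5 4 4 (by decide)
      have e5 := hd 2 3 1 4 (by decide)
      have k0 : d 0 = 0 := by
        refine (mul_eq_zero.1 ?_).resolve_left h2
        rw [k1, k2] at e1
        linear_combination e1
      have k5 : d 5 = 0 := by
        refine (mul_eq_zero.1 ?_).resolve_left h2
        rw [k2, k4] at e3
        linear_combination e3
      have k3 : d 3 = 0 := by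
        refine (mul_eq_zero.1 ?_).resolve_left h2
        rw [k1, k2, k4] at e5
        linear_combination e5
      have k6 : d 6 = 0 := by
        refine (mul_eq_zero.1 ?_).resolve_left (mul_ne_zero htwo h6)
        rw [k2, k3] at hs
        linear_combination -hs
      intro l
      fin_cases l <;> assumption

theorem eval_axisPoint (hη : η ^ 2 = η) :
    eval (axisPoint η).coord (octic η b₁ b₂ b₃ b₄) = 0 := by
  rw [← Point.coeff_zero_localEquation, ← coeff_coe, ← coe_axisEquation hη]
  exact augmentation_axisEquation

/-- Smoothness fails by the square property, the types with a singular arc are excluded, and the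
seven generators of the ambient ring are too few for 1/7(1,2,4). -/
theorem octic_singular (hη : η = 1 ∨ (η = 0 ∧ (b₁ ≠ 0 ∨ b₂ ≠ 0 ∨ b₃ ≠ 0 ∨ b₄ ≠ 0))) :
    IsSingularPoint w₅ (octic η b₁ b₂ b₃ b₄) (axisPoint η) ∧
      ¬ TypeOccurs (octic η b₁ b₂ b₃ b₄) (axisPoint η) := by
  have hη2 : η ^ 2 = η := by rcases hη with h | h <;> simp [h]
  refine ⟨isSingularPoint_of_not_squareProperty (eval_axisPoint hη2)
    (not_squareProperty_axis hη2), fun hT => ?_⟩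
  rcases hT.cases with ⟨-, h | h⟩ | ⟨-, h⟩
  · exact not_squareProperty_axis hη2 h
  · exact not_hasSingularArc_axis hη h
  · exact h ((Point.edimLE _ two_ne_zero (stabilizer_axisPoint η) (axisPoint_weights η)
      covers_gensAxis (by decide) (by decide)).mono (by simp))

end AxisRing

theorem IsNormalForm.exists_singular {ν : ℕ∞} {F : MvPolynomial (Fin 5) ℂ} (h : IsNormalForm ν F)
    (hν : ν ≠ ⊤) : ∃ P, IsSingularPoint w₅ F P ∧ ¬ TypeOccurs F P := by
  have key : ∀ η b₁ b₂ b₃ b₄, F = octic η b₁ b₂ b₃ b₄ →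
      (η = 1 ∨ (η = 0 ∧ (b₁ ≠ 0 ∨ b₂ ≠ 0 ∨ b₃ ≠ 0 ∨ b₄ ≠ 0))) →
      ∃ P, IsSingularPoint w₅ F P ∧ ¬ TypeOccurs F P := by
    rintro η b₁ b₂ b₃ b₄ rfl hη
    exact ⟨_, octic_singular hη⟩
  cases h with
  | nu_top => exact (hν rfl).elim
  | nu_five => exact key 0 0 0 0 1 (by simp [octic]) (by simp)
  | nu_four => exact key 0 0 0 1 0 (by simp [octic]) (by simp)
  | nu_three a₅ => exact key 0 0 1 0 a₅ (by simp [octic]; ring) (by simp)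
  | nu_two a₄ a₅ => exact key 0 1 0 a₄ a₅ (by simp [octic]; ring) (by simp)
  | nu_one a₃ a₄ a₅ => exact key 1 0 a₃ a₄ a₅ (by simp [octic]; ring) (by simp)

/-! ### Weighted homogeneous polynomials and elementary coordinate changes. -/

section Division

variable {n : ℕ} {w : Fin n → ℕ}

/-- Division of a weighted homogeneous polynomial by a variable. -/
theorem exists_eq_X_mul_add {F : MvPolynomial (Fin n) ℂ} {d e : ℕ} (j : Fin n)
    (hF : F.IsWeightedHomogeneous w d) (hd : e + w j = d) :
    ∃ A B : MvPolynomial (Fin n) ℂ, F = X j * A + B ∧ A.IsWeightedHomogeneous w e ∧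
      B.IsWeightedHomogeneous w d ∧ j ∉ B.vars ∧
      (∀ m, coeff m A = coeff (Finsupp.single j 1 + m) F) ∧
      (∀ m, m j = 0 → coeff m B = coeff m F) ∧ ∀ i, i ∉ F.vars → i ∉ A.vars ∧ i ∉ B.vars := by
  classical
  have hA : ∀ m, coeff m (F.divMonomial (Finsupp.single j 1)) = coeff (Finsupp.single j 1 + m) F :=
    fun m => coeff_divMonomial _ _ _
  have hB0 : ∀ m, coeff m (F.modMonomial (Finsupp.single j 1)) ≠ 0 →
      m j = 0 ∧ coeff m (F.modMonomial (Finsupp.single j 1)) = coeff m F := by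
    intro m hm
    by_cases h : Finsupp.single j 1 ≤ m
    · exact (hm (coeff_modMonomial_of_le _ h)).elim
    · refine ⟨?_, coeff_modMonomial_of_not_le _ h⟩
      by_contra h'
      exact h (Finsupp.single_le_iff.2 (Nat.one_le_iff_ne_zero.2 h'))
  refine ⟨F.divMonomial (Finsupp.single j 1), F.modMonomial (Finsupp.single j 1),
    (divMonomial_add_modMonomial_single F j).symm, ?_, ?_, ?_, hA, ?_, ?_⟩
  · intro m hm
    rw [hA] at hm
    have := hF hm
    rw [map_add, Finsupp.weight_single, one_smul] at this
    omega
  · intro m hm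
    rw [(hB0 m hm).2] at hm
    exact hF hm
  · rw [mem_vars_iff_mem_support]
    rintro ⟨m, hm, hj⟩
    exact (Finsupp.mem_support_iff.1 hj) (hB0 m (mem_support_iff.1 hm)).1
  · intro m hm
    refine coeff_modMonomial_of_not_le _ fun h => ?_
    have := Finsupp.single_le_iff.1 h
    omega
  · intro i hi
    rw [mem_vars_iff_mem_support] at hi
    constructor
    · rw [mem_vars_iff_mem_support]
      rintro ⟨m, hm, hj⟩
      rw [mem_support_iff, hA] at hm
      refine hi ⟨_, mem_support_iff.2 hm, ?_⟩
      rw [Finsupp.mem_support_iff] at hj ⊢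
      rw [Finsupp.add_apply]
      omega
    · rw [mem_vars_iff_mem_support]
      rintro ⟨m, hm, hj⟩
      rw [mem_support_iff] at hm
      have := (hB0 m hm).2
      exact hi ⟨_, mem_support_iff.2 (this ▸ hm), hj⟩

theorem isWeightedHomogeneous_algHom {F : MvPolynomial (Fin n) ℂ} {d : ℕ}
    (hF : F.IsWeightedHomogeneous w d) {φ : MvPolynomial (Fin n) ℂ →ₐ[ℂ] MvPolynomial (Fin n) ℂ}
    (hφ : ∀ j, (φ (X j)).IsWeightedHomogeneous w (w j)) : (φ F).IsWeightedHomogeneous w d := by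
  rw [F.as_sum, map_sum]
  refine IsWeightedHomogeneous.sum _ _ _ fun m hm => ?_
  rw [monomial_eq, map_mul, ← algebraMap_eq, AlgHom.commutes, algebraMap_eq,
    Finsupp.prod, map_prod]
  refine IsWeightedHomogeneous.C_mul ?_ _
  rw [← hF (mem_support_iff.1 hm), Finsupp.weight_apply, Finsupp.sum]
  refine IsWeightedHomogeneous.prod _ _ _ fun i _ => ?_
  rw [map_pow]
  exact (hφ i).pow _

end Division

/-- Equivalence under a coordinate change. -/
def Equivalent (F G : MvPolynomial (Fin 5) ℂ) : Prop :=
  ∃ φ, IsCoordinateChange φ ∧ φ F = G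

theorem Equivalent.trans {F G H : MvPolynomial (Fin 5) ℂ} (h : Equivalent F G)
    (h' : Equivalent G H) : Equivalent F H := by
  obtain ⟨φ, hφ, rfl⟩ := h
  obtain ⟨ψ, hψ, rfl⟩ := h'
  exact ⟨φ.trans ψ,
    fun j => isWeightedHomogeneous_algHom (φ := AlgHomClass.toAlgHom ψ) (hφ j) hψ, rfl⟩

section Elementary

/-- The substitution `y_j ↦ p`. -/
def substHom (j : Fin 5) (p : MvPolynomial (Fin 5) ℂ) :
    MvPolynomial (Fin 5) ℂ →ₐ[ℂ] MvPolynomial (Fin 5) ℂ :=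
  aeval (Function.update X j p)

variable {j : Fin 5} {p q : MvPolynomial (Fin 5) ℂ}

theorem substHom_self : substHom j p (X j) = p := by simp [substHom]

theorem substHom_X {i : Fin 5} (h : i ≠ j) : substHom j p (X i) = X i := by simp [substHom, h]

theorem substHom_C (a : ℂ) : substHom j p (C a) = C a := by simp [substHom, algebraMap_eq]

theorem substHom_of_notMem (hq : j ∉ q.vars) : substHom j p q = q := by
  have : aeval (Function.update X j p) q = aeval X q := by
    refine hom_congr_vars (by ext; simp) (fun i hi _ => ?_) rfl
    change aeval _ (X i) = aeval X (X i)
    have hij : i ≠ j := fun h => hq (h ▸ hi)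
    simp [hij]
  rw [substHom, this, aeval_X_left_apply]

theorem notMem_vars_substHom {i : Fin 5} (hp : i ∉ p.vars) (hq : i ∉ q.vars) :
    i ∉ (substHom j p q).vars := by
  classical
  intro h
  obtain ⟨k, hk, hi⟩ := mem_vars_bind₁ _ _ h
  rcases eq_or_ne k j with rfl | hkj
  · rw [Function.update_self] at hi
    exact hp hi
  · rw [Function.update_of_ne hkj, vars_X, Finset.mem_singleton] at hi
    exact hq (hi ▸ hk)

theorem isWeightedHomogeneous_substHom (hp : p.IsWeightedHomogeneous w₅ (w₅ j)) {d : ℕ}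
    (hq : q.IsWeightedHomogeneous w₅ d) : (substHom j p q).IsWeightedHomogeneous w₅ d := by
  refine isWeightedHomogeneous_algHom hq fun i => ?_
  rcases eq_or_ne i j with rfl | h
  · rwa [substHom_self]
  · rw [substHom_X h]
    exact isWeightedHomogeneous_X _ _ _

/-- Since `q` does not involve y_j, the substitution has the inverse y_j ↦ c⁻¹(y_j - q). -/
theorem equivalent_substHom {c : ℂ} (hc : c ≠ 0) (hq : j ∉ q.vars)
    (hw : q.IsWeightedHomogeneous w₅ (w₅ j)) (F : MvPolynomial (Fin 5) ℂ) :
    Equivalent F (substHom j (C c * X j + q) F) := by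
  have hcc : (C c * C c⁻¹ : MvPolynomial (Fin 5) ℂ) = 1 := by
    rw [← C_mul, mul_inv_cancel₀ hc, C_1]
  have h1 : (substHom j (C c * X j + q)).comp (substHom j (C c⁻¹ * (X j - q))) =
      AlgHom.id ℂ _ := by
    refine algHom_ext fun i => ?_
    rcases eq_or_ne i j with rfl | h
    · rw [AlgHom.comp_apply, substHom_self, map_mul, map_sub, substHom_self, substHom_C,
        substHom_of_notMem hq, AlgHom.id_apply]
      linear_combination X i * hcc
    · rw [AlgHom.comp_apply, substHom_X h, substHom_X h, AlgHom.id_apply]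
  have h2 : (substHom j (C c⁻¹ * (X j - q))).comp (substHom j (C c * X j + q)) =
      AlgHom.id ℂ _ := by
    refine algHom_ext fun i => ?_
    rcases eq_or_ne i j with rfl | h
    · rw [AlgHom.comp_apply, substHom_self, map_add, map_mul, substHom_self, substHom_C,
        substHom_of_notMem hq, AlgHom.id_apply]
      linear_combination (X i - q) * hcc
    · rw [AlgHom.comp_apply, substHom_X h, substHom_X h, AlgHom.id_apply]
  refine ⟨AlgEquiv.ofAlgHom _ _ h1 h2, fun i => ?_, rfl⟩
  change (substHom j (C c * X j + q) (X i)).IsWeightedHomogeneous w₅ (w₅ i)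
  rcases eq_or_ne i j with rfl | h
  · rw [substHom_self]
    exact ((isWeightedHomogeneous_X _ _ _).C_mul c).add hw
  · rw [substHom_X h]
    exact isWeightedHomogeneous_X _ _ _

end Elementary

/-! ### Reduction to normal form. -/

/-- Polynomials `(αy₀ + βy₁)y₄ + cy₃² + y₃q + g` with `q`, `g` of weights `4`, `8` in
`y₀, y₁, y₂`. -/
structure Reduced (α β c : ℂ) (F q g : MvPolynomial (Fin 5) ℂ) : Prop where
  eq : F = (C α * X 0 + C β * X 1) * X 4 + C c * X 3 ^ 2 + X 3 * q + g
  hq : q.IsWeightedHomogeneous w₅ 4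
  hg : g.IsWeightedHomogeneous w₅ 8
  q3 : 3 ∉ q.vars
  q4 : 4 ∉ q.vars
  g3 : 3 ∉ g.vars
  g4 : 4 ∉ g.vars

/-- Division by y₄ leaves a quotient of weight 1, a linear form in y₀ and y₁. Two divisions of the
remainder by y₃ leave a quotient of weight 0, the constant `c`. -/
theorem exists_reduced {F : MvPolynomial (Fin 5) ℂ} (hF : F.IsWeightedHomogeneous w₅ 8) :
    ∃ q g, Reduced (coeff (Finsupp.single 0 1 + Finsupp.single 4 1) F)
      (coeff (Finsupp.single 1 1 + Finsupp.single 4 1) F) (coeff (Finsupp.single 3 2) F) F q g := by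
  classical
  obtain ⟨A, F₁, e1, hA, hF₁, v1, cA, cF₁, -⟩ := exists_eq_X_mul_add (e := 1) 4 hF rfl
  obtain ⟨B, g, e2, hB, hg, v2, cB, -, k2⟩ := exists_eq_X_mul_add (e := 4) 3 hF₁ rfl
  obtain ⟨D, q, e3, hD, hq, v3, cD, -, k3⟩ := exists_eq_X_mul_add (e := 0) 3 hB rfl
  refine ⟨q, g, ?_, hq, hg, v3, (k3 4 (k2 4 v1).1).2, v2, (k2 4 v1).2⟩
  have hA' : A = C (coeff (Finsupp.single 0 1 + Finsupp.single 4 1) F) * X 0 +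
      C (coeff (Finsupp.single 1 1 + Finsupp.single 4 1) F) * X 1 := by
    ext m
    rw [add_comm (Finsupp.single 0 1), add_comm (Finsupp.single 1 1), ← cA, ← cA, coeff_add,
      coeff_C_mul, coeff_C_mul, coeff_X, coeff_X]
    by_cases hm : coeff m A = 0
    · split_ifs with h0 h1 h1 <;> simp_all
    · have h1 := hA hm
      rw [weight_w₅] at h1
      rcases (by omega : m 0 = 1 ∧ m 1 = 0 ∨ m 0 = 0 ∧ m 1 = 1) with h | h
      · have : m = Finsupp.single 0 1 := by
          ext i
          fin_cases i <;> simp <;> omega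
        subst this
        simp [Finsupp.single_left_inj]
      · have : m = Finsupp.single 1 1 := by
          ext i
          fin_cases i <;> simp <;> omega
        subst this
        simp [Finsupp.single_left_inj]
  have hD' : D = C (coeff (Finsupp.single 3 2) F) := by
    ext m
    rw [coeff_C]
    split_ifs with h
    · subst h
      rw [cD, cB, add_zero, ← Finsupp.single_add, cF₁ _ (by simp)]
    · by_contra hm
      have h1 := hD hm
      rw [weight_w₅] at h1
      refine h ?_
      ext i
      fin_cases i <;> simp <;> omega
  refine e1.trans ?_
  rw [e2, e3, hA', hD']
  ring

variable {α β c : ℂ} {F q g : MvPolynomial (Fin 5) ℂ}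

theorem Reduced.substHom (h : Reduced α β c F q g) {j : Fin 5} (h3 : 3 ≠ j) (h4 : 4 ≠ j)
    {p : MvPolynomial (Fin 5) ℂ} (hp : p.IsWeightedHomogeneous w₅ (w₅ j)) (p3 : 3 ∉ p.vars)
    (p4 : 4 ∉ p.vars) {α' β' : ℂ}
    (e : WeightedOctic.substHom j p (C α * X 0 + C β * X 1) = C α' * X 0 + C β' * X 1) :
    Reduced α' β' c (WeightedOctic.substHom j p F) (WeightedOctic.substHom j p q)
      (WeightedOctic.substHom j p g) where
  eq := by
    conv_lhs => rw [h.eq]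
    rw [map_add, map_add, map_add, map_mul, e, map_mul, map_mul, map_pow, substHom_X h3,
      substHom_X h4, substHom_C]
  hq := isWeightedHomogeneous_substHom hp h.hq
  hg := isWeightedHomogeneous_substHom hp h.hg
  q3 := notMem_vars_substHom p3 h.q3
  q4 := notMem_vars_substHom p4 h.q4
  g3 := notMem_vars_substHom p3 h.g3
  g4 := notMem_vars_substHom p4 h.g4

theorem notMem_vars_C_mul {i : Fin 5} (a : ℂ) {p : MvPolynomial (Fin 5) ℂ} (hp : i ∉ p.vars) :
    i ∉ (C a * p).vars := by
  classical
  intro hi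
  have := vars_mul _ _ hi
  rw [vars_C, Finset.empty_union] at this
  exact hp this

theorem notMem_vars_C_mul_X {i k : Fin 5} (h : i ≠ k) (a : ℂ) :
    i ∉ (C a * X k : MvPolynomial (Fin 5) ℂ).vars :=
  notMem_vars_C_mul a (by rwa [vars_X, Finset.mem_singleton])

theorem notMem_vars_add {i : Fin 5} {p r : MvPolynomial (Fin 5) ℂ} (hp : i ∉ p.vars)
    (hr : i ∉ r.vars) : i ∉ (p + r).vars := by
  classical
  intro h
  rcases Finset.mem_union.1 (vars_add_subset _ _ h) with h | h
  exacts [hp h, hr h]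

theorem isWeightedHomogeneous_C_mul_X (a : ℂ) {i k : Fin 5} (h : w₅ i = w₅ k) :
    (C a * X i : MvPolynomial (Fin 5) ℂ).IsWeightedHomogeneous w₅ (w₅ k) :=
  h ▸ (isWeightedHomogeneous_X ℂ w₅ i).C_mul a

/-- The linear form multiplying `y₄` can be moved to `y₀`. -/
theorem Reduced.exists_one_zero (h : Reduced α β c F q g) (hne : α ≠ 0 ∨ β ≠ 0) :
    ∃ G q' g', Equivalent F G ∧ Reduced 1 0 c G q' g' := by
  have key : ∀ {α β : ℂ} {F q g : MvPolynomial (Fin 5) ℂ}, Reduced α β c F q g → α ≠ 0 →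
      ∃ G q' g', Equivalent F G ∧ Reduced 1 0 c G q' g' := by
    intro α β F q g h hα
    refine ⟨_, _, _, equivalent_substHom (j := 0) (c := α⁻¹) (q := C (-(β / α)) * X 1)
      (inv_ne_zero hα) (notMem_vars_C_mul_X (by decide) _)
      (isWeightedHomogeneous_C_mul_X _ rfl) F,
      h.substHom (j := 0) (p := C α⁻¹ * X 0 + C (-(β / α)) * X 1) (by decide) (by decide)
        ((isWeightedHomogeneous_C_mul_X _ rfl).add
        (isWeightedHomogeneous_C_mul_X _ rfl))
        (notMem_vars_add (notMem_vars_C_mul_X (by decide) _) (notMem_vars_C_mul_X (by decide) _))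
        (notMem_vars_add (notMem_vars_C_mul_X (by decide) _) (notMem_vars_C_mul_X (by decide) _))
        ?_⟩
    have h1 : (C α * C α⁻¹ : MvPolynomial (Fin 5) ℂ) = C 1 := by
      rw [← C_mul, mul_inv_cancel₀ hα]
    have h2 : (C α * C (-(β / α)) : MvPolynomial (Fin 5) ℂ) = - C β := by
      rw [← C_mul, ← C_neg, mul_neg, mul_div_cancel₀ _ hα]
    rw [map_add, map_mul, map_mul, substHom_self, substHom_C, substHom_C,
      substHom_X (show (1 : Fin 5) ≠ 0 by decide), C_0]
    linear_combination X 0 * h1 + X 1 * h2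
  by_cases hα : α = 0
  · have hβ : β ≠ 0 := hne.resolve_left (not_not.2 hα)
    -- The substitution y₁ ↦ y₁ + y₀ turns βy₁ into β(y₀ + y₁), which is the case α ≠ 0.
    have e1 := equivalent_substHom (j := 1) (c := 1) (q := C 1 * X 0) one_ne_zero
      (notMem_vars_C_mul_X (by decide) _) (isWeightedHomogeneous_C_mul_X _ rfl) F
    have r1 := h.substHom (j := 1) (p := C 1 * X 1 + C 1 * X 0) (α' := β) (β' := β)
      (by decide) (by decide)
      ((isWeightedHomogeneous_C_mul_X _ rfl).add (isWeightedHomogeneous_C_mul_X _ rfl))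
      (notMem_vars_add (notMem_vars_C_mul_X (by decide) _) (notMem_vars_C_mul_X (by decide) _))
      (notMem_vars_add (notMem_vars_C_mul_X (by decide) _) (notMem_vars_C_mul_X (by decide) _))
      (by
        rw [map_add, map_mul, map_mul, substHom_self, substHom_C, substHom_C,
          substHom_X (show (0 : Fin 5) ≠ 1 by decide), hα, C_0, C_1]
        ring)
    obtain ⟨G, q', g', e2, r2⟩ := key r1 hβ
    exact ⟨G, q', g', e1.trans e2, r2⟩
  · exact key h hα

/-- Completing the square. -/
theorem Reduced.exists_square (h : Reduced 1 0 c F q g) (hc : c ≠ 0) :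
    ∃ g' : MvPolynomial (Fin 5) ℂ, Equivalent F (X 0 * X 4 - X 3 ^ 2 + g') ∧
      g'.IsWeightedHomogeneous w₅ 8 ∧ 3 ∉ g'.vars ∧ 4 ∉ g'.vars := by
  classical
  obtain ⟨κ, hκ⟩ := IsAlgClosed.exists_pow_nat_eq (-c⁻¹) (n := 2) two_pos
  have hκ' : c * κ ^ 2 = -1 := by rw [hκ]; field_simp
  have hκ0 : κ ≠ 0 := by
    rintro rfl
    simp at hκ'
  have v2 : ∀ {i : Fin 5} (a : ℂ), i ∉ q.vars → i ∉ (C a * q ^ 2).vars := fun a hi =>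
    notMem_vars_C_mul a fun hv => hi (vars_pow _ _ hv)
  refine ⟨g + C (-(1 / (4 * c))) * q ^ 2, ?_, h.hg.add ((h.hq.pow 2).C_mul _),
    notMem_vars_add h.g3 (v2 _ h.q3), notMem_vars_add h.g4 (v2 _ h.q4)⟩
  -- The substitution y₃ ↦ κy₃ - q/(2c) removes the term linear in y₃, contributes -q²/(4c), and
  -- gives y₃² the coefficient cκ² = -1.
  convert equivalent_substHom (j := 3) (c := κ) (q := C (-(1 / (2 * c))) * q) hκ0
    (notMem_vars_C_mul _ h.q3) (h.hq.C_mul _) F using 1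
  conv_rhs => rw [h.eq]
  simp only [map_add, map_mul, map_pow, substHom_C, substHom_self,
    substHom_X (show (0 : Fin 5) ≠ 3 by decide), substHom_X (show (1 : Fin 5) ≠ 3 by decide),
    substHom_X (show (4 : Fin 5) ≠ 3 by decide), substHom_of_notMem h.q3,
    substHom_of_notMem h.g3, map_zero, map_one]
  have h1 : (C c * C κ ^ 2 : MvPolynomial (Fin 5) ℂ) = -1 := by
    rw [← C_pow, ← C_mul, hκ', C_neg, C_1]
  have h2 : (2 * C c * C (-(1 / (2 * c))) : MvPolynomial (Fin 5) ℂ) = -1 := by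
    rw [show (2 : MvPolynomial (Fin 5) ℂ) = C 2 from rfl, ← C_mul, ← C_mul, ← C_1, ← C_neg]
    congr 1
    field_simp
  have h3 : (C c * C (-(1 / (2 * c))) ^ 2 + C (-(1 / (2 * c))) : MvPolynomial (Fin 5) ℂ) =
      C (-(1 / (4 * c))) := by
    rw [← C_pow, ← C_mul, ← C_add]
    congr 1
    field_simp
    ring
  linear_combination (-X 3 ^ 2) * h1 - X 3 * q * C κ * h2 - q ^ 2 * h3

/-- Removing the multiples of `y₀`. -/
theorem exists_equivalent_add (hg : g.IsWeightedHomogeneous w₅ 8) (g3 : 3 ∉ g.vars)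
    (g4 : 4 ∉ g.vars) :
    ∃ r : MvPolynomial (Fin 5) ℂ, Equivalent (X 0 * X 4 - X 3 ^ 2 + g) (X 0 * X 4 - X 3 ^ 2 + r) ∧
      r.IsWeightedHomogeneous w₅ 8 ∧ 0 ∉ r.vars ∧ 3 ∉ r.vars ∧ 4 ∉ r.vars := by
  obtain ⟨A, r, e, hA, hr, r0, -, -, hv⟩ := exists_eq_X_mul_add (e := 7) 0 hg rfl
  refine ⟨r, ?_, hr, r0, (hv 3 g3).2, (hv 4 g4).2⟩
  -- With g = y₀A + r, the substitution y₄ ↦ y₄ - A cancels y₀A against y₀y₄; the weight 7 of `A` is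
  -- that of y₄.
  convert equivalent_substHom (j := 4) (c := 1) (q := -A) one_ne_zero
    (by rw [vars_neg]; exact (hv 4 g4).1) (by simpa [w₅] using hA.C_mul (-1)) _ using 1
  rw [map_add, map_sub, map_mul, map_pow, substHom_self, substHom_of_notMem g4,
    substHom_X (show (0 : Fin 5) ≠ 4 by decide), substHom_X (show (3 : Fin 5) ≠ 4 by decide), e,
    C_1]
  ring

theorem exists_eq_octic {r : MvPolynomial (Fin 5) ℂ} (hr : r.IsWeightedHomogeneous w₅ 8)
    (r0 : 0 ∉ r.vars) (r3 : 3 ∉ r.vars) (r4 : 4 ∉ r.vars) :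
    ∃ b₀ b₁ b₂ b₃ b₄, X 0 * X 4 - X 3 ^ 2 + r = octic b₀ b₁ b₂ b₃ b₄ := by
  classical
  let e (k l : ℕ) : Fin 5 →₀ ℕ := Finsupp.single 2 k + Finsupp.single 1 l
  have he : ∀ k l k' l' : ℕ, e k l = e k' l' ↔ k = k' ∧ l = l' := by
    refine fun k l k' l' => ⟨fun h => ⟨?_, ?_⟩, fun h => by rw [h.1, h.2]⟩
    · simpa [e] using DFunLike.congr_fun h 2
    · simpa [e] using DFunLike.congr_fun h 1
  have hz : ∀ i, i ∉ r.vars → ∀ m, coeff m r ≠ 0 → m i = 0 := by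
    intro i hi m hm
    by_contra h
    exact hi ((mem_vars_iff_mem_support _).2 ⟨m, mem_support_iff.2 hm, Finsupp.mem_support_iff.2 h⟩)
  have hmon : ∀ k l : ℕ, (X 2 ^ k * X 1 ^ l : MvPolynomial (Fin 5) ℂ) = monomial (e k l) 1 := by
    intro k l
    rw [X_pow_eq_monomial, X_pow_eq_monomial, monomial_mul, one_mul]
  have key : r = C (coeff (e 4 0) r) * (X 2 ^ 4 * X 1 ^ 0) +
      C (coeff (e 3 2) r) * (X 2 ^ 3 * X 1 ^ 2) +
      C (coeff (e 2 4) r) * (X 2 ^ 2 * X 1 ^ 4) + C (coeff (e 1 6) r) * (X 2 ^ 1 * X 1 ^ 6) +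
      C (coeff (e 0 8) r) * (X 2 ^ 0 * X 1 ^ 8) := by
    simp only [hmon]
    ext m
    simp only [coeff_add, coeff_C_mul, coeff_monomial]
    by_cases hm : coeff m r = 0
    · rw [hm]
      have : ∀ k l, coeff (e k l) r * (if e k l = m then 1 else 0) = 0 := by
        intro k l
        split_ifs with h
        · rw [h, hm, zero_mul]
        · rw [mul_zero]
      simp [this]
    · have hw := hr hm
      rw [weight_w₅, hz 0 r0 m hm, hz 3 r3 m hm, hz 4 r4 m hm] at hw
      have hme : m = e (m 2) (m 1) := by
        ext i
        fin_cases i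
        · simpa [e] using hz 0 r0 m hm
        · simp [e]
        · simp [e]
        · simpa [e] using hz 3 r3 m hm
        · simpa [e] using hz 4 r4 m hm
      obtain ⟨k, l, rfl⟩ : ∃ k l, m = e k l := ⟨_, _, hme⟩
      have hk : (e k l) 2 = k := by simp [e]
      have hl : (e k l) 1 = l := by simp [e]
      rw [hk, hl] at hw
      simp only [he]
      have : k ≤ 4 := by omega
      obtain rfl : l = 8 - 2 * k := by omega
      interval_cases k <;> simp
  refine ⟨coeff (e 4 0) r, coeff (e 3 2) r, coeff (e 2 4) r, coeff (e 1 6) r, coeff (e 0 8) r, ?_⟩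
  rw [octic]
  conv_lhs => rw [key]
  simp only [pow_zero, pow_one, mul_one, one_mul]

/-- The substitution is y₂ ↦ l y₂ + μ y₁²; the new coefficients are those of the Taylor expansion at
μ of the quartic in y₂/y₁², scaled by powers of `l`. -/
theorem equivalent_octic_subst {l : ℂ} (hl : l ≠ 0) (μ b₀ b₁ b₂ b₃ b₄ : ℂ) :
    Equivalent (octic b₀ b₁ b₂ b₃ b₄)
      (octic (l ^ 4 * b₀) (l ^ 3 * (4 * b₀ * μ + b₁)) (l ^ 2 * (6 * b₀ * μ ^ 2 + 3 * b₁ * μ + b₂))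
        (l * (4 * b₀ * μ ^ 3 + 3 * b₁ * μ ^ 2 + 2 * b₂ * μ + b₃))
        (b₀ * μ ^ 4 + b₁ * μ ^ 3 + b₂ * μ ^ 2 + b₃ * μ + b₄)) := by
  convert equivalent_substHom (j := 2) (c := l) (q := C μ * X 1 ^ 2) hl
    (notMem_vars_C_mul μ fun hv => by
      have := vars_pow _ _ hv
      rw [vars_X] at this
      simp at this)
    (((isWeightedHomogeneous_X ℂ w₅ 1).pow 2).C_mul μ) _ using 1
  simp only [octic, map_add, map_sub, map_mul, map_pow, substHom_C, substHom_self,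
    substHom_X (show (0 : Fin 5) ≠ 2 by decide), substHom_X (show (1 : Fin 5) ≠ 2 by decide),
    substHom_X (show (3 : Fin 5) ≠ 2 by decide), substHom_X (show (4 : Fin 5) ≠ 2 by decide),
    show (C 2 : MvPolynomial (Fin 5) ℂ) = 2 from rfl,
    show (C 3 : MvPolynomial (Fin 5) ℂ) = 3 from rfl,
    show (C 4 : MvPolynomial (Fin 5) ℂ) = 4 from rfl,
    show (C 6 : MvPolynomial (Fin 5) ℂ) = 6 from rfl]
  ring

theorem equivalent_octic_scale {ρ : ℂ} (hρ : ρ ≠ 0) (b : ℂ) :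
    Equivalent (octic 0 0 0 0 b) (octic 0 0 0 0 (ρ ^ 8 * b)) := by
  convert equivalent_substHom (j := 1) (c := ρ) (q := 0) hρ (by simp)
    (isWeightedHomogeneous_zero _ _ _) _ using 1
  simp only [octic, map_add, map_sub, map_mul, map_pow, substHom_C, substHom_self,
    substHom_X (show (0 : Fin 5) ≠ 1 by decide), substHom_X (show (2 : Fin 5) ≠ 1 by decide),
    substHom_X (show (3 : Fin 5) ≠ 1 by decide), substHom_X (show (4 : Fin 5) ≠ 1 by decide),
    map_zero]
  ring

theorem exists_pow_mul_eq_one {n : ℕ} (hn : 0 < n) {b : ℂ} (hb : b ≠ 0) :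
    ∃ l : ℂ, l ≠ 0 ∧ l ^ n * b = 1 := by
  obtain ⟨l, hl⟩ := IsAlgClosed.exists_pow_nat_eq b⁻¹ hn
  have h : l ^ n * b = 1 := by rw [hl, inv_mul_cancel₀ hb]
  refine ⟨l, ?_, h⟩
  rintro rfl
  simp [hn.ne'] at h

theorem isNormalForm_one (a b c : ℂ) : IsNormalForm 1 (octic 1 0 a b c) := by
  convert IsNormalForm.nu_one a b c using 1
  simp [octic]
  ring

theorem isNormalForm_two (a b : ℂ) : IsNormalForm 2 (octic 0 1 0 a b) := by
  convert IsNormalForm.nu_two a b using 1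
  simp [octic]
  ring

theorem isNormalForm_three (a : ℂ) : IsNormalForm 3 (octic 0 0 1 0 a) := by
  convert IsNormalForm.nu_three a using 1
  simp [octic]
  ring

theorem isNormalForm_four : IsNormalForm 4 (octic 0 0 0 1 0) := by
  convert IsNormalForm.nu_four using 1
  simp [octic]

theorem isNormalForm_five : IsNormalForm 5 (octic 0 0 0 0 1) := by
  convert IsNormalForm.nu_five using 1
  simp [octic]

theorem isNormalForm_top : IsNormalForm ⊤ (octic 0 0 0 0 0) := by
  convert IsNormalForm.nu_top using 1
  simp [octic]

/-- The first nonzero coefficient is scaled to 1 by the choice of `l`, and the Tschirnhaus shift μ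
kills the next one. When only y₁⁸ is left, y₁ is scaled instead. -/
theorem exists_isNormalForm_octic (b₀ b₁ b₂ b₃ b₄ : ℂ) :
    ∃ ν G, Equivalent (octic b₀ b₁ b₂ b₃ b₄) G ∧ IsNormalForm ν G := by
  by_cases h0 : b₀ = 0
  swap
  · obtain ⟨l, hl, e⟩ := exists_pow_mul_eq_one (n := 4) (by norm_num) h0
    have := equivalent_octic_subst hl (-b₁ / (4 * b₀)) b₀ b₁ b₂ b₃ b₄
    rw [e, show 4 * b₀ * (-b₁ / (4 * b₀)) + b₁ = 0 by field_simp; ring, mul_zero] at this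
    exact ⟨_, _, this, isNormalForm_one _ _ _⟩
  subst h0
  by_cases h1 : b₁ = 0
  swap
  · obtain ⟨l, hl, e⟩ := exists_pow_mul_eq_one (n := 3) (by norm_num) h1
    have := equivalent_octic_subst hl (-b₂ / (3 * b₁)) 0 b₁ b₂ b₃ b₄
    rw [mul_zero, mul_zero, zero_mul, zero_add, e,
      show 6 * 0 * (-b₂ / (3 * b₁)) ^ 2 + 3 * b₁ * (-b₂ / (3 * b₁)) + b₂ = 0 by field_simp; ring,
      mul_zero] at this
    exact ⟨_, _, this, isNormalForm_two _ _⟩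
  subst h1
  by_cases h2 : b₂ = 0
  swap
  · obtain ⟨l, hl, e⟩ := exists_pow_mul_eq_one (n := 2) (by norm_num) h2
    have := equivalent_octic_subst hl (-b₃ / (2 * b₂)) 0 0 b₂ b₃ b₄
    simp only [mul_zero, zero_mul, zero_add, e] at this
    rw [show 2 * b₂ * (-b₃ / (2 * b₂)) + b₃ = 0 by field_simp; ring, mul_zero] at this
    exact ⟨_, _, this, isNormalForm_three _⟩
  subst h2
  by_cases h3 : b₃ = 0
  swap
  · have := equivalent_octic_subst (inv_ne_zero h3) (-b₄ / b₃) 0 0 0 b₃ b₄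
    simp only [mul_zero, zero_mul, zero_add, inv_mul_cancel₀ h3] at this
    rw [show b₃ * (-b₄ / b₃) + b₄ = 0 by field_simp; ring] at this
    exact ⟨_, _, this, isNormalForm_four⟩
  subst h3
  by_cases h4 : b₄ = 0
  swap
  · obtain ⟨l, hl, e⟩ := exists_pow_mul_eq_one (n := 8) (by norm_num) h4
    have := equivalent_octic_scale hl b₄
    rw [e] at this
    exact ⟨_, _, this, isNormalForm_five⟩
  subst h4
  exact ⟨_, _, ⟨AlgEquiv.refl, fun j => isWeightedHomogeneous_X _ _ _, rfl⟩, isNormalForm_top⟩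

/-- A weighted octic with `y₃²` and a term `ℓ(y₀, y₁)y₄` can be brought to normal form. -/
theorem exists_isNormalForm (hF : F.IsWeightedHomogeneous w₅ 8)
    (h3 : coeff (Finsupp.single 3 2) F ≠ 0)
    (h4 : coeff (Finsupp.single 0 1 + Finsupp.single 4 1) F ≠ 0 ∨
      coeff (Finsupp.single 1 1 + Finsupp.single 4 1) F ≠ 0) :
    ∃ ν G, Equivalent F G ∧ IsNormalForm ν G := by
  obtain ⟨q, g, h⟩ := exists_reduced hF
  obtain ⟨G₁, q₁, g₁, e1, h⟩ := h.exists_one_zero h4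
  obtain ⟨g₂, e2, hg, g3, g4⟩ := h.exists_square h3
  obtain ⟨r, e3, hr, r0, r3, r4⟩ := exists_equivalent_add hg g3 g4
  obtain ⟨b₀, b₁, b₂, b₃, b₄, e⟩ := exists_eq_octic hr r0 r3 r4
  obtain ⟨ν, G, e4, hG⟩ := exists_isNormalForm_octic b₀ b₁ b₂ b₃ b₄
  exact ⟨ν, G, ((e1.trans e2).trans (e ▸ e3)).trans e4, hG⟩

theorem HasSingularitiesOfP1247.exists_isNormalForm (h : HasSingularitiesOfP1247 F)
    (hF : F.IsWeightedHomogeneous w₅ 8) :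
    ∃ ν G, Equivalent F G ∧ IsNormalForm ν G := by
  have h4 : coeff (Finsupp.single 0 1 + Finsupp.single 4 1) F ≠ 0 ∨
      coeff (Finsupp.single 1 1 + Finsupp.single 4 1) F ≠ 0 := by
    by_contra! h4
    obtain ⟨hs, ht⟩ := vertex_four hF h4.1 h4.2
    exact ht (h.1 _ hs)
  refine WeightedOctic.exists_isNormalForm hF (fun h3 => ?_) h4
  obtain ⟨hs, ht⟩ := vertex_three hF h3 h4
  exact ht (h.1 _ hs)

end Hypersurface

end WeightedOctic

end

theorem proposition5p2 :
    (∀ F : MvPolynomial (Fin 5) ℂ, F ≠ 0 → F.IsWeightedHomogeneous WeightedOctic.w₅ 8 →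
      WeightedOctic.HasSingularitiesOfP1247 F →
      ∃ (φ : MvPolynomial (Fin 5) ℂ ≃ₐ[ℂ] MvPolynomial (Fin 5) ℂ) (ν : ℕ∞),
        WeightedOctic.IsCoordinateChange φ ∧ WeightedOctic.IsNormalForm ν (φ F)) ∧
    (∀ (ν : ℕ∞) (F : MvPolynomial (Fin 5) ℂ), WeightedOctic.IsNormalForm ν F → ν ≠ ⊤ →
      ∃ P : WeightedOctic.Point 5,
        WeightedOctic.IsSingularPoint WeightedOctic.w₅ F P ∧ ¬ WeightedOctic.TypeOccurs F P) := by
  refine ⟨fun F _ hF h => ?_, fun ν F h hν => h.exists_singular hν⟩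
  obtain ⟨ν, G, ⟨φ, hφ, rfl⟩, hG⟩ := h.exists_isNormalForm hF
  exact ⟨φ, ν, hφ, hG⟩
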